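/- Let $n\ge 1$. Define $$f_n(\eta)=\eta^{1-n}\int_0^\infty e^{-s^4}(\eta s)^{n/2}J_{\frac{n-2}{2}}(\eta s)\,ds$$ for $\eta>0$ (extended continuously to $\eta=0$), where $J_\nu$ is the Bessel function of the first kind, and let $\alpha_n=(2\pi)^{-n/2}$. For $(x_0,t_0)\in\mathbb R^n\times(0,\infty)$ and $t<t_0$ let $$B(x,t)=\frac{\alpha_n}{(t_0-t)^{n/4}}\,f_n\!\left(\frac{|x-x_0|}{(t_0-t)^{1/4}}\right)$$ be the backwards biharmonic heat kernel, and let $T_R=\mathbb R^n\times(t_0-16R^4,\,t_0-R^4)$. Let $N\subset\mathbb R^k$ be a smooth embedded submanifold that is compact without boundary, or $N=\mathbb R^k$. A smooth solution of the extrinsic biharmonic map heat flow is a map $u:\mathbb R^n\times[0,T)\to N\subset\mathbb R^k$, smooth on $\mathbb R^n\times[0,T)$, with $\partial_tu=-\Delta^2u-f(u)$, where $$f(u)=\sum_i\Big(\Delta\langle\nabla u,(d\nu_i\circ u)\nabla u\rangle+\operatorname{div}\langle\Delta u,(d\nu_i\circ u)\nabla u\rangle+\langle\nabla\Delta u,(d\nu_i\circ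 u)\nabla u\rangle\Big)\,\nu_i\circ u$$ and $(\nu_i)$ is a smooth orthonormal frame of the normal space of $N$ near $u(x,t)$. Write $u_0=u(\cdot,0)$ and $\operatorname{Sol}u=\nabla u\cdot(x-x_0)+4(t-t_0)\partial_tu$. For $\varphi\in C_c^\infty(\mathbb R^n)$ put $$\Psi(u,R,\varphi)=\frac12\int_{T_R}|\Delta u|^2B\varphi\,dx\,dt-\frac12\int_{T_R}|\nabla u|^2\,\Delta B\,\varphi\,dx\,dt .$$ **Theorem.** For every $n\ge1$ there is a constant $C>0$ depending only on $n$ (that is, on $f_n$), and for every $R_0>0$ there is a smooth cut-off function $\varphi_0\in C_c^\infty(\mathbb R^n)$ depending only on $n$ and $R_0$, with $0\le\varphi_0\le1$ and $\varphi_0=1$ in a neighbourhood of $0$, such that the following holds. Let $u:\mathbb R^n\times[0,T)\to N\subset\mathbb R^k$ be a smooth solution of the extrinsic biharmonic map heat flow with $\int_{\mathbb R^n}|\Delta u_0|^2\,dx<\infty$ and $\int_0^{T'}\!\int_{\mathbb R^n}\big(|\Delta u|^2+|\nabla\Delta u|^2\big)\,dx\,dt<\infty$ for every $T'<T$. Let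 $(x_0,t_0)\in\mathbb R^n\times(0,T)$ and $\varphi(x)=\varphi_0(x-x_0)$. Then, for every $R$ with $R_0\le R\le\min\{t_0^{1/4}/2,1\}$, both terms in the definition of $\Psi(u,R,\varphi)$ are non-negative, the function $r\mapsto\Psi(u,r,\varphi)$ is differentiable at $R$ (from the left if $R=t_0^{1/4}/2$), and $$\frac{\partial}{\partial R}\Psi(u,R,\varphi)\ \ge\ \frac1{2R}\int_{T_R}\frac{|\operatorname{Sol}u|^2}{4|t-t_0|}B\varphi\,dx\,dt-C(1+R^{1-n})\int_{T_R}|\nabla\Delta u|^2\,dx\,dt-C\sup_{t\in[0,t_0-R_0^4]}\int_{[\varphi>0]}|\nabla u|^2(x,t)\,dx-C(R^4+R^{3-n})\int_{\mathbb R^n}|\Delta u_0|^2\,dx$$ and $$\frac{\partial}{\partial R}\Psi(u,R,\varphi)\ \ge\ \frac1{2R}\int_{T_R}\frac{|\operatorname{Sol}u|^2}{4|t-t_0|}B\varphi\,dx\,dt-C(R^4+R^{5-n})\sup_{t\in[0,t_0-R_0^4]}\int_{[\varphi>0]}|\nabla\Delta u|^2(x,t)\,dx-C\sup_{t\in[0,t_0-R_0^4]}\int_{[\varphi>0]}|\nabla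 u|^2(x,t)\,dx-C(R^4+R^{3-n})\int_{\mathbb R^n}|\Delta u_0|^2\,dx .$$ -/

import Mathlib

open Set Filter Topology MeasureTheory
open scoped ContDiff InnerProductSpace

noncomputable section

namespace BiharmonicFlow

/-- Euclidean space of dimension `n`. -/
abbrev E (n : ℕ) : Type := EuclideanSpace ℝ (Fin n)

/-! ### The biharmonic heat kernel -/

/-- The Bessel function of the first kind `J_ν(z)`, for `z > 0`, by its power series. -/
def besselJ (ν z : ℝ) : ℝ :=
  ∑' m : ℕ, (-1 : ℝ) ^ m / ((m.factorial : ℝ) * Real.Gamma ((m : ℝ) + ν + 1)) *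
    (z / 2) ^ (2 * (m : ℝ) + ν)

/-- The generating function
`f_n(η) = η^{1-n} ∫_0^∞ exp(-s⁴) (ηs)^{n/2} J_{(n-2)/2}(ηs) ds` for `η > 0`; at `η = 0` it takes
the value of its continuous extension, namely
`2^{1-n/2} Γ(n/2)⁻¹ ∫_0^∞ exp(-s⁴) s^{n-1} ds`. -/
def kernelProfile (n : ℕ) (η : ℝ) : ℝ :=
  if η = 0 then
    (2 : ℝ) ^ (1 - (n : ℝ) / 2) / Real.Gamma ((n : ℝ) / 2) *
      ∫ s in Ioi (0 : ℝ), Real.exp (-s ^ 4) * s ^ ((n : ℝ) - 1)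
  else
    η ^ (1 - (n : ℝ)) *
      ∫ s in Ioi (0 : ℝ),
        Real.exp (-s ^ 4) * (η * s) ^ ((n : ℝ) / 2) * besselJ (((n : ℝ) - 2) / 2) (η * s)

/-- The normalization constant `α_n = (2π)^{-n/2}`, for which
`x ↦ α_n t^{-n/4} f_n(|x| / t^{1/4})` has integral one over `ℝⁿ`. -/
def kernelConst (n : ℕ) : ℝ := (2 * Real.pi) ^ (-((n : ℝ) / 2))

/-- The backwards biharmonic heat kernel
`B_{(x₀,t₀)}(x,t) = α_n (t₀-t)^{-n/4} f_n(|x-x₀| / (t₀-t)^{1/4})`, for `t < t₀`. -/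
def backwardKernel {n : ℕ} (x₀ : E n) (t₀ : ℝ) (x : E n) (t : ℝ) : ℝ :=
  kernelConst n / (t₀ - t) ^ ((n : ℝ) / 4) *
    kernelProfile n (‖x - x₀‖ / (t₀ - t) ^ ((1 : ℝ) / 4))

/-! ### Derivatives -/

/-- The partial derivative `∂_j v (x)`. -/
def pd {n : ℕ} {F : Type*} [NormedAddCommGroup F] [NormedSpace ℝ F]
    (j : Fin n) (v : E n → F) (x : E n) : F :=
  fderiv ℝ v x (EuclideanSpace.single j 1)

/-- The Euclidean Laplacian of `v` at `x`. -/
def lap {n : ℕ} {F : Type*} [NormedAddCommGroup F] [NormedSpace ℝ F]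
    (v : E n → F) (x : E n) : F :=
  (Laplacian.laplacian v : E n → F) x

/-- `|∇v|²(x) = ∑_j |∂_j v(x)|²`. -/
def gradSq {n : ℕ} {F : Type*} [NormedAddCommGroup F] [NormedSpace ℝ F]
    (v : E n → F) (x : E n) : ℝ :=
  ∑ j : Fin n, ‖pd j v x‖ ^ 2

/-! ### Submanifolds of `ℝᵏ` and the extrinsic biharmonic map heat flow -/

/-- `N` is a smooth embedded submanifold (without boundary) of `ℝᵏ`, of some codimension `c`:
near each of its points it is the zero set of a smooth submersion to `ℝᶜ`. -/
def IsEmbeddedSubmanifold {k : ℕ} (N : Set (E k)) : Prop :=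
  ∃ c : ℕ, ∀ p ∈ N, ∃ U : Set (E k), IsOpen U ∧ p ∈ U ∧ ∃ g : E k → E c,
    ContDiffOn ℝ ∞ g U ∧ (∀ y ∈ U, Function.Surjective (fderiv ℝ g y)) ∧
      N ∩ U = {y ∈ U | g y = 0}

/-- The tangent space `T_yN ⊂ ℝᵏ`. For a submanifold the tangent cone is already a linear
subspace. -/
def tangentSpaceOf {k : ℕ} (N : Set (E k)) (y : E k) : Submodule ℝ (E k) :=
  Submodule.span ℝ (tangentConeAt ℝ N y)

/-- `ν_1, …, ν_c` is a smooth orthonormal frame of the normal space of `N`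
on the open set `U ⊂ ℝᵏ`. -/
structure IsNormalFrame {k c : ℕ} (N U : Set (E k)) (ν : Fin c → E k → E k) : Prop where
  isOpen : IsOpen U
  smooth : ∀ i, ContDiffOn ℝ ∞ (ν i) U
  orthonormal : ∀ y ∈ N ∩ U, Orthonormal ℝ (fun i => ν i y)
  span_eq : ∀ y ∈ N ∩ U, Submodule.span ℝ (range fun i => ν i y) = (tangentSpaceOf N y)ᗮ

/-- The contraction `⟨∇v, (dν∘v)∇v⟩ = ∑_j ⟨∂_j v, dν(v)(∂_j v)⟩`. -/
def secondFormTerm {n k : ℕ} (ν : E k → E k) (v : E n → E k) (x : E n) : ℝ :=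
  ∑ j : Fin n, ⟪pd j v x, fderiv ℝ ν (v x) (pd j v x)⟫_ℝ

/-- The nonlinearity
`f(v) = ∑_i (Δ⟨∇v,(dν_i∘v)∇v⟩ + div⟨Δv,(dν_i∘v)∇v⟩ + ⟨∇Δv,(dν_i∘v)∇v⟩) ν_i∘v`. -/
def nonlinearity {n k c : ℕ} (ν : Fin c → E k → E k) (v : E n → E k) (x : E n) : E k :=
  ∑ i : Fin c,
    (lap (secondFormTerm (ν i) v) x
      + ∑ j : Fin n, pd j (fun y => ⟪lap v y, fderiv ℝ (ν i) (v y) (pd j v y)⟫_ℝ) x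
      + ∑ j : Fin n, ⟪pd j (lap v) x, fderiv ℝ (ν i) (v x) (pd j v x)⟫_ℝ) • ν i (v x)

/-- `u : ℝⁿ × [0,T) → N ⊂ ℝᵏ` is a smooth solution of the extrinsic biharmonic map heat flow
`∂_t u = -Δ²u - f(u)`, where `f(u)` at `(x,t)` is computed with a smooth orthonormal frame of the
normal space of `N` near `u(x,t)`. -/
structure IsBiharmonicMapHeatFlow {n k : ℕ} (N : Set (E k)) (T : ℝ) (u : E n → ℝ → E k) :
    Prop where
  smooth : ContDiffOn ℝ ∞ (fun p : E n × ℝ => u p.1 p.2) (univ ×ˢ Ico 0 T)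
  mem : ∀ x, ∀ t ∈ Ico 0 T, u x t ∈ N
  flow : ∀ x, ∀ t ∈ Ioo 0 T, ∃ (c : ℕ) (U : Set (E k)) (ν : Fin c → E k → E k),
    u x t ∈ U ∧ IsNormalFrame N U ν ∧
      deriv (u x) t = - lap (lap fun y => u y t) x - nonlinearity ν (fun y => u y t) x

/-- `Δu` and `∇Δu` are square integrable on `ℝⁿ × (0,T')` for every `T' < T`, and
`∫_{ℝⁿ} |Δu(·,0)|² dx < ∞`. -/
structure HasLocallyFiniteEnergy {n k : ℕ} (T : ℝ) (u : E n → ℝ → E k) : Prop where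
  initial : Integrable (fun x => ‖lap (fun y => u y 0) x‖ ^ 2)
  lap_sq : ∀ T' < T, IntegrableOn
    (fun p : E n × ℝ => ‖lap (fun y => u y p.2) p.1‖ ^ 2) (univ ×ˢ Ioo 0 T')
  grad_lap_sq : ∀ T' < T, IntegrableOn
    (fun p : E n × ℝ => gradSq (lap fun y => u y p.2) p.1) (univ ×ˢ Ioo 0 T')

/-! ### The weighted energy -/

/-- The layer `T_R(t₀) = ℝⁿ × (t₀ - 16R⁴, t₀ - R⁴)`. -/
def layer (n : ℕ) (t₀ R : ℝ) : Set (E n × ℝ) :=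
  {p | t₀ - 16 * R ^ 4 < p.2 ∧ p.2 < t₀ - R ^ 4}

/-- The first term of `Ψ`: `½ ∫_{T_R} |Δu|² B φ dx dt`. -/
def psiFirst {n k : ℕ} (x₀ : E n) (t₀ : ℝ) (u : E n → ℝ → E k) (R : ℝ) (φ : E n → ℝ) : ℝ :=
  1 / 2 * ∫ p in layer n t₀ R,
    ‖lap (fun y => u y p.2) p.1‖ ^ 2 * backwardKernel x₀ t₀ p.1 p.2 * φ p.1

/-- The second term of `Ψ`, with its sign: `-½ ∫_{T_R} |∇u|² ΔB φ dx dt`. -/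
def psiSecond {n k : ℕ} (x₀ : E n) (t₀ : ℝ) (u : E n → ℝ → E k) (R : ℝ) (φ : E n → ℝ) : ℝ :=
  -(1 / 2 * ∫ p in layer n t₀ R,
    gradSq (fun y => u y p.2) p.1 * lap (fun y => backwardKernel x₀ t₀ y p.2) p.1 * φ p.1)

/-- The weighted energy `Ψ(u,R,φ)`. -/
def psi {n k : ℕ} (x₀ : E n) (t₀ : ℝ) (u : E n → ℝ → E k) (R : ℝ) (φ : E n → ℝ) : ℝ :=
  psiFirst x₀ t₀ u R φ + psiSecond x₀ t₀ u R φ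

/-- `Sol u = ∇u · (x - x₀) + 4 (t - t₀) ∂_t u`. -/
def sol {n k : ℕ} (x₀ : E n) (t₀ : ℝ) (u : E n → ℝ → E k) (x : E n) (t : ℝ) : E k :=
  fderiv ℝ (fun y => u y t) x (x - x₀) + (4 * (t - t₀)) • deriv (u x) t

/-- `∫_{T_R} |Sol u|² / (4|t - t₀|) B φ dx dt`. -/
def solitonIntegral {n k : ℕ} (x₀ : E n) (t₀ : ℝ) (u : E n → ℝ → E k) (R : ℝ)
    (φ : E n → ℝ) : ℝ :=
  ∫ p in layer n t₀ R,
    ‖sol x₀ t₀ u p.1 p.2‖ ^ 2 / (4 * |p.2 - t₀|) * backwardKernel x₀ t₀ p.1 p.2 * φ p.1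

/-- `sup_{t ∈ [0,S]} ∫_{[φ>0]} h(x,t) dx`. -/
def supIntegral {n : ℕ} (S : ℝ) (φ : E n → ℝ) (h : E n → ℝ → ℝ) : ℝ :=
  sSup ((fun t => ∫ x in {x | 0 < φ x}, h x t) '' Icc 0 S)

/-- `φ` is a smooth cut-off function at the origin. -/
structure IsCutoff {n : ℕ} (φ : E n → ℝ) : Prop where
  smooth : ContDiff ℝ ∞ φ
  hasCompactSupport : HasCompactSupport φ
  nonneg : ∀ x, 0 ≤ φ x
  le_one : ∀ x, φ x ≤ 1
  eq_one : ∀ᶠ x in 𝓝 (0 : E n), φ x = 1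

end BiharmonicFlow

end

noncomputable section

namespace BiharmonicFlow

/-! The cut-off may depend on `R₀`, and only radii `R ≥ R₀` are tested. So the support of `φ₀` can
be made so thin and its mass so concentrated that every negative power of `R` is compensated. No
monotonicity identity is needed: `Ψ` is differentiated directly, and a bound without any `∇Δu` term
results, from which both inequalities follow.

Kernel. Expanding the Bessel function shows that, near the axis, the profile is an analytic function
`f` of `q = |x-x₀|²/(t₀-t)^{1/2}` with `f(0) > 0 > f'(0)`. Since `ΔB` is a positive multiple of `4q
f'' + 2n f'`, there is `η` depending only on `n` such that `0 ≤ B ≤ K R^{-n}` and `-K R^{-n-2} ≤ ΔB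
≤ 0` where `|x-x₀| < η(t₀-t)^{1/4}` and `t ≤ t₀-R⁴`. A cut-off of radius `ηR₀/4` only sees this
region, so both terms of `Ψ` are non-negative (`exists_kernel_on_parabolicNhd`).

Derivative. Differentiating the limits of integration leaves the slices `t₀-16R⁴` and `t₀-R⁴`
(`hasDerivWithinAt_setIntegral_layer`). The early slice contributes with the good sign and is
dropped. The late slice and the soliton integral are bounded by three quantities.

Energy. The nonlinearity is normal to `N` and `∂_t u` is tangent, so `⟨Δ²u, ∂_t u⟩ = -|∂_t u|²`.
Testing with slowly varying cut-offs bounds `∫|Δu|²` at each time and the space-time integral of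
`|∂_t u|²` by `∫|Δu₀|²` (`energy_le`).

Small gradient. `∫φ|∇u|²` comes with the bad factor `R^{1-n}`. Outside a tiny ball of radius `δ` the
cut-off is at most `κ ≤ R₀^{n+1}`. Inside, an interior Hessian estimate and one integration by parts
give `∫_{B_δ}|∇u|² ≤ κ(∫_{B_r}|∇u|² + ∫_{B_r}|Δu|²)` for small `δ`
(`exists_radius_setIntegral_gradSq_le`). The factor `κ` absorbs `R^{1-n}`, and
`energy_derivative_arithmetic` collects the terms. -/

theorem two_le_infty : (2 : ℕ∞ω) ≤ ∞ := by
  have h : ((2 : ℕ∞) : ℕ∞ω) ≤ ((⊤ : ℕ∞) : ℕ∞ω) := WithTop.coe_le_coe.2 le_top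
  exact h

/-! ### Partial derivatives, the Laplacian and integration by parts -/

section Calculus

variable {n : ℕ} {F : Type*} [NormedAddCommGroup F] [NormedSpace ℝ F]

theorem pd_pd_eq_fderiv_fderiv {v : E n → F} {x : E n} (hv : ContDiffAt ℝ 2 v x) (i j : Fin n) :
    pd i (pd j v) x = fderiv ℝ (fderiv ℝ v) x (EuclideanSpace.single i 1)
      (EuclideanSpace.single j 1) := by
  have h1 : DifferentiableAt ℝ (fderiv ℝ v) x :=
    (hv.fderiv_right (m := 1) (by norm_num)).differentiableAt (by norm_num)
  unfold pd
  rw [fderiv_clm_apply h1 (differentiableAt_const _)]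
  simp

theorem pd_comm {v : E n → F} {x : E n} (hv : ContDiffAt ℝ 2 v x) (i j : Fin n) :
    pd i (pd j v) x = pd j (pd i v) x := by
  rw [pd_pd_eq_fderiv_fderiv hv, pd_pd_eq_fderiv_fderiv hv]
  exact (hv.isSymmSndFDerivAt (by simp)).eq _ _

theorem lap_eq_sum_pd {v : E n → F} {x : E n} (hv : ContDiffAt ℝ 2 v x) :
    lap v x = ∑ j : Fin n, pd j (pd j v) x := by
  unfold lap
  rw [InnerProductSpace.laplacian_eq_iteratedFDeriv_orthonormalBasis v
    (EuclideanSpace.basisFun (Fin n) ℝ)]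
  refine Finset.sum_congr rfl fun j _ => ?_
  rw [pd_pd_eq_fderiv_fderiv hv, iteratedFDeriv_two_apply]
  simp

theorem lap_eq_sum_pd' {v : E n → F} (hv : ContDiff ℝ 2 v) :
    lap v = fun x => ∑ j : Fin n, pd j (pd j v) x :=
  funext fun _ => lap_eq_sum_pd hv.contDiffAt

theorem contDiff_pd {v : E n → F} (hv : ContDiff ℝ ∞ v) (j : Fin n) : ContDiff ℝ ∞ (pd j v) :=
  (hv.fderiv_right (m := ∞) (by simp)).clm_apply contDiff_const

theorem contDiff_lap {v : E n → F} (hv : ContDiff ℝ ∞ v) : ContDiff ℝ ∞ (lap v) := by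
  rw [lap_eq_sum_pd' (hv.of_le two_le_infty)]
  exact ContDiff.sum fun j _ => contDiff_pd (contDiff_pd hv j) j

theorem continuous_gradSq {v : E n → F} (hv : ContDiff ℝ ∞ v) : Continuous (gradSq v) := by
  unfold gradSq
  exact continuous_finsetSum _ fun j _ => ((contDiff_pd hv j).continuous.norm.pow 2)

theorem gradSq_nonneg (v : E n → F) (x : E n) : 0 ≤ gradSq v x :=
  Finset.sum_nonneg fun _ _ => by positivity

theorem hasCompactSupport_pd {v : E n → F} (hv : HasCompactSupport v) (j : Fin n) :
    HasCompactSupport (pd j v) := by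
  refine (hv.fderiv (𝕜 := ℝ)).mono fun x hx => ?_
  simp only [Function.mem_support, pd] at hx ⊢
  intro h
  simp [h] at hx

theorem pd_smul {c : E n → ℝ} {v : E n → F} {x : E n} (hc : DifferentiableAt ℝ c x)
    (hv : DifferentiableAt ℝ v x) (j : Fin n) :
    pd j (fun y => c y • v y) x = pd j c x • v x + c x • pd j v x := by
  unfold pd
  rw [fderiv_fun_smul hc hv]
  simp [add_comm]

theorem pd_mul {c v : E n → ℝ} {x : E n} (hc : DifferentiableAt ℝ c x)
    (hv : DifferentiableAt ℝ v x) (j : Fin n) :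
    pd j (fun y => c y * v y) x = pd j c x * v x + c x * pd j v x := by
  simpa using pd_smul hc hv j

theorem pd_inner {G : Type*} [NormedAddCommGroup G] [InnerProductSpace ℝ G]
    {v w : E n → G} {x : E n} (hv : DifferentiableAt ℝ v x)
    (hw : DifferentiableAt ℝ w x) (j : Fin n) :
    pd j (fun y => ⟪v y, w y⟫_ℝ) x = ⟪pd j v x, w x⟫_ℝ + ⟪v x, pd j w x⟫_ℝ := by
  unfold pd
  rw [fderiv_inner_apply ℝ hv hw, add_comm]

theorem pd_comp {g : ℝ → ℝ} {q : E n → ℝ} {x : E n} (hg : DifferentiableAt ℝ g (q x))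
    (hq : DifferentiableAt ℝ q x) (j : Fin n) :
    pd j (fun y => g (q y)) x = deriv g (q x) * pd j q x := by
  unfold pd
  have := fderiv_comp x hg hq
  simp only [Function.comp_def] at this
  rw [this]
  simp [mul_comm]

theorem integral_pd_eq_zero {v : E n → ℝ} (hv : ContDiff ℝ 1 v) (hc : HasCompactSupport v)
    (j : Fin n) : ∫ x, pd j v x = 0 := by
  have hcont : Continuous (pd j v) := (hv.continuous_fderiv (by simp)).clm_apply continuous_const
  have hi := hcont.integrable_of_hasCompactSupport (μ := (volume : Measure (E n)))
    (hasCompactSupport_pd hc j)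
  have h := integral_mul_fderiv_eq_neg_fderiv_mul_of_integrable (𝕜 := ℝ)
    (μ := (volume : Measure (E n))) (f := fun _ => (1 : ℝ)) (g := v)
    (v := EuclideanSpace.single j 1) (by simp) (by simp only [one_mul]; exact hi)
    (by simpa using hv.continuous.integrable_of_hasCompactSupport hc)
    (fun _ _ => by fun_prop) (fun x _ => hv.differentiable (by simp) x)
  simpa [pd] using h

theorem integral_inner_pd {G : Type*} [NormedAddCommGroup G] [InnerProductSpace ℝ G]
    {v w : E n → G} (hv : ContDiff ℝ 1 v) (hw : ContDiff ℝ 1 w)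
    (hc : HasCompactSupport v) (j : Fin n) :
    ∫ x, ⟪v x, pd j w x⟫_ℝ = - ∫ x, ⟪pd j v x, w x⟫_ℝ := by
  have hcv : Continuous (pd j v) := (hv.continuous_fderiv (by simp)).clm_apply continuous_const
  have hcw : Continuous (pd j w) := (hw.continuous_fderiv (by simp)).clm_apply continuous_const
  have h := integral_pd_eq_zero (v := fun x => ⟪v x, w x⟫_ℝ) (hv.inner ℝ hw)
    (hc.mono fun x hx => by
      simp only [Function.mem_support] at hx ⊢; intro h; simp [h] at hx) j
  have e : ∀ x, pd j (fun y => ⟪v y, w y⟫_ℝ) x = ⟪pd j v x, w x⟫_ℝ + ⟪v x, pd j w x⟫_ℝ := fun x =>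
    pd_inner (hv.differentiable (by simp) x) (hw.differentiable (by simp) x) j
  simp_rw [e] at h
  rw [integral_add] at h
  · linarith
  · refine (hcv.inner hw.continuous).integrable_of_hasCompactSupport
      ((hasCompactSupport_pd hc j).mono fun x hx => ?_)
    simp only [Function.mem_support] at hx ⊢; intro h; simp [h] at hx
  · refine (hv.continuous.inner hcw).integrable_of_hasCompactSupport
      (hc.mono fun x hx => ?_)
    simp only [Function.mem_support] at hx ⊢; intro h; simp [h] at hx

theorem integral_inner_lap {G : Type*} [NormedAddCommGroup G] [InnerProductSpace ℝ G]
    {v w : E n → G} (hv : ContDiff ℝ ∞ v) (hw : ContDiff ℝ ∞ w) (hc : HasCompactSupport v) :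
    ∫ x, ⟪v x, lap w x⟫_ℝ = ∫ x, ⟪lap v x, w x⟫_ℝ := by
  have le : ∀ {g : E n → G}, ContDiff ℝ ∞ g → ContDiff ℝ 1 g := fun h =>
    h.of_le (by exact_mod_cast le_top)
  rw [lap_eq_sum_pd' (hv.of_le two_le_infty),
    lap_eq_sum_pd' (hw.of_le two_le_infty)]
  simp_rw [inner_sum, sum_inner]
  rw [integral_finsetSum, integral_finsetSum]
  · refine Finset.sum_congr rfl fun j _ => ?_
    rw [integral_inner_pd (le hv) (le (contDiff_pd hw j)) hc,
      integral_inner_pd (le (contDiff_pd hv j)) (le hw) (hasCompactSupport_pd hc j), neg_neg]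
  · intro j _
    refine ((contDiff_pd (contDiff_pd hv j) j).continuous.inner
      hw.continuous).integrable_of_hasCompactSupport
      ((hasCompactSupport_pd (hasCompactSupport_pd hc j) j).mono fun x hx => ?_)
    simp only [Function.mem_support] at hx ⊢; intro h; simp [h] at hx
  · intro j _
    refine (hv.continuous.inner
      (contDiff_pd (contDiff_pd hw j) j).continuous).integrable_of_hasCompactSupport
      (hc.mono fun x hx => ?_)
    simp only [Function.mem_support] at hx ⊢; intro h; simp [h] at hx

end Calculus

/-! ### Power series of the kernel profile -/

section Kernel

/-- In the recursion `Γ(s+1) = sΓ(s)` the first factor is `n/2 ≥ 1/2` and all later ones are at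
least `1`, so at most one factor `1/2` is lost. -/
theorem half_Gamma_le_Gamma_add {n : ℕ} (hn : 1 ≤ n) (m : ℕ) :
    Real.Gamma ((n : ℝ) / 2) / 2 ≤ Real.Gamma ((m : ℝ) + (n : ℝ) / 2) := by
  have hn' : (1 : ℝ) ≤ n := by exact_mod_cast hn
  have hpos : 0 < Real.Gamma ((n : ℝ) / 2) := Real.Gamma_pos_of_pos (by linarith)
  have step : ∀ m : ℕ, Real.Gamma (((m + 1 : ℕ) : ℝ) + (n : ℝ) / 2)
      = ((m : ℝ) + (n : ℝ) / 2) * Real.Gamma ((m : ℝ) + (n : ℝ) / 2) := fun m => by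
    rw [← Real.Gamma_add_one (by positivity)]; push_cast; ring_nf
  induction m with
  | zero => simp; linarith
  | succ m ih =>
    rw [step]
    rcases Nat.eq_zero_or_pos m with rfl | hm
    · simp; nlinarith
    · have : (1 : ℝ) ≤ m := by exact_mod_cast hm
      nlinarith

/-- The moments `∫_0^∞ exp(-s⁴) s^p ds`. -/
def quarticMoment (p : ℕ) : ℝ := ∫ s in Ioi (0 : ℝ), Real.exp (-s ^ 4) * s ^ p

theorem integrableOn_exp_neg_mul_pow {b : ℝ} (hb : 0 < b) (p : ℕ) :
    IntegrableOn (fun s : ℝ => Real.exp (-b * s ^ 4) * s ^ p) (Ioi 0) := by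
  have h := integrableOn_rpow_mul_exp_neg_mul_rpow (p := 4) (s := p) (b := b)
    (by have : (0 : ℝ) ≤ p := by positivity
        linarith) (by norm_num) hb
  refine h.congr_fun (fun s hs => ?_) measurableSet_Ioi
  simp only [Real.rpow_natCast]
  rw [mul_comm]
  norm_cast

theorem integrableOn_exp_neg_pow_mul_pow (p : ℕ) :
    IntegrableOn (fun s : ℝ => Real.exp (-s ^ 4) * s ^ p) (Ioi 0) := by
  simpa using integrableOn_exp_neg_mul_pow one_pos p

theorem quarticMoment_pos (p : ℕ) : 0 < quarticMoment p := by
  unfold quarticMoment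
  rw [setIntegral_pos_iff_support_of_nonneg_ae]
  · have : Function.support (fun s : ℝ => Real.exp (-s ^ 4) * s ^ p) ∩ Ioi 0 = Ioi 0 := by
      refine inter_eq_right.2 fun s hs => ?_
      have : (0 : ℝ) < s := hs
      simp only [Function.mem_support]; positivity
    rw [this]; simp
  · filter_upwards [ae_restrict_mem measurableSet_Ioi] with s hs
    have : (0 : ℝ) < s := hs
    simp only [Pi.zero_apply]; positivity
  · exact integrableOn_exp_neg_pow_mul_pow p

/-- From `s^{2m} ≤ m! exp(s²)` and `s² ≤ 1/2 + s⁴/2`. The growth `m!` is exactly what the factorial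
in the Bessel coefficients cancels. -/
theorem quarticMoment_le (m p : ℕ) :
    quarticMoment (2 * m + p) ≤ (m.factorial : ℝ) *
      (Real.exp (1 / 2) * ∫ s in Ioi (0 : ℝ), Real.exp (-(1 / 2) * s ^ 4) * s ^ p) := by
  unfold quarticMoment
  rw [← integral_const_mul, ← integral_const_mul]
  refine setIntegral_mono_on (integrableOn_exp_neg_pow_mul_pow _)
    (((integrableOn_exp_neg_mul_pow (by norm_num) p).const_mul _).const_mul _)
    measurableSet_Ioi fun s hs => ?_
  have hs' : (0 : ℝ) < s := hs
  have h1 : (s ^ 2) ^ m / (m.factorial : ℝ) ≤ Real.exp (s ^ 2) :=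
    Real.pow_div_factorial_le_exp _ (by positivity) m
  have h2 : Real.exp (-s ^ 4) * Real.exp (s ^ 2)
      ≤ Real.exp (1 / 2) * Real.exp (-(1 / 2) * s ^ 4) := by
    rw [← Real.exp_add, ← Real.exp_add]
    exact Real.exp_le_exp.2 (by nlinarith [sq_nonneg (s ^ 2 - 1)])
  have hm : (0 : ℝ) < m.factorial := by positivity
  calc Real.exp (-s ^ 4) * s ^ (2 * m + p)
      = m.factorial * (Real.exp (-s ^ 4) * ((s ^ 2) ^ m / m.factorial)) * s ^ p := by
        field_simp; ring
    _ ≤ m.factorial * (Real.exp (-s ^ 4) * Real.exp (s ^ 2)) * s ^ p := by gcongr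
    _ ≤ m.factorial * (Real.exp (1 / 2) * Real.exp (-(1 / 2) * s ^ 4)) * s ^ p := by gcongr
    _ = _ := by ring

/-- The absolute values of the coefficients of the profile as a power series in `η²`. -/
def besselCoeff (n m : ℕ) : ℝ :=
  1 / ((m.factorial : ℝ) * Real.Gamma ((m : ℝ) + (n : ℝ) / 2)) *
    (1 / 2 : ℝ) ^ (2 * (m : ℝ) + ((n : ℝ) / 2 - 1))

/-- The coefficients of the profile as a power series in `η²`. -/
def profileCoeff (n m : ℕ) : ℝ :=
  (-1) ^ m * (besselCoeff n m * quarticMoment (2 * m + (n - 1)))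

theorem besselCoeff_pos {n : ℕ} (hn : 1 ≤ n) (m : ℕ) : 0 < besselCoeff n m := by
  have hn' : (1 : ℝ) ≤ n := by exact_mod_cast hn
  have : 0 < Real.Gamma ((m : ℝ) + (n : ℝ) / 2) := Real.Gamma_pos_of_pos (by positivity)
  unfold besselCoeff; positivity

/-- The factorials cancel and the Gamma factor is bounded below, so the coefficients stay bounded.
This is enough for convergence when `η < 1`; only a neighbourhood of the axis matters. -/
theorem exists_bound_profileCoeff {n : ℕ} (hn : 1 ≤ n) :
    ∃ M : ℝ, ∀ m, besselCoeff n m * quarticMoment (2 * m + (n - 1)) ≤ M := by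
  have hn' : (1 : ℝ) ≤ n := by exact_mod_cast hn
  set K := Real.exp (1 / 2) * ∫ s in Ioi (0 : ℝ), Real.exp (-(1 / 2) * s ^ 4) * s ^ (n - 1)
  have hpos : 0 < Real.Gamma ((n : ℝ) / 2) := Real.Gamma_pos_of_pos (by linarith)
  have hK : 0 ≤ K := by
    have := quarticMoment_le 0 (n - 1)
    simp only [Nat.factorial_zero, Nat.cast_one, one_mul] at this
    exact (quarticMoment_pos _).le.trans this
  refine ⟨1 / (Real.Gamma ((n : ℝ) / 2) / 2) * (1 / 2 : ℝ) ^ ((n : ℝ) / 2 - 1) * K, fun m => ?_⟩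
  have hm : (0 : ℝ) < m.factorial := by positivity
  have hG := half_Gamma_le_Gamma_add hn m
  have hGp : 0 < Real.Gamma ((m : ℝ) + (n : ℝ) / 2) := Real.Gamma_pos_of_pos (by positivity)
  have e : (1 / 2 : ℝ) ^ (2 * (m : ℝ) + ((n : ℝ) / 2 - 1)) ≤ (1 / 2 : ℝ) ^ ((n : ℝ) / 2 - 1) :=
    Real.rpow_le_rpow_of_exponent_ge (by norm_num) (by norm_num)
      (by have : (0 : ℝ) ≤ m := by positivity
          linarith)
  calc besselCoeff n m * quarticMoment (2 * m + (n - 1))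
      ≤ besselCoeff n m * (m.factorial * K) := by
        gcongr
        · exact (besselCoeff_pos hn m).le
        · exact quarticMoment_le m (n - 1)
    _ = 1 / Real.Gamma ((m : ℝ) + (n : ℝ) / 2) *
          (1 / 2 : ℝ) ^ (2 * (m : ℝ) + ((n : ℝ) / 2 - 1)) * K := by
        unfold besselCoeff; field_simp
    _ ≤ _ := by gcongr

/-- The profile as a function of the square of its argument. -/
def profileSeries (n : ℕ) (q : ℝ) : ℝ := ∑' m : ℕ, profileCoeff n m * q ^ m

/-- The exponents `n/2` and `2m + n/2 - 1` add up to the natural number `2m + (n-1)`, which removes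
all real powers. -/
theorem besselJ_eq_tsum (n : ℕ) {η s : ℝ} (hn : 1 ≤ n) (hη : 0 < η) (hs : 0 < s) :
    Real.exp (-s ^ 4) * (η * s) ^ ((n : ℝ) / 2) * besselJ (((n : ℝ) - 2) / 2) (η * s)
      = ∑' m : ℕ, (-1) ^ m * besselCoeff n m * η ^ (2 * m + (n - 1)) *
          (Real.exp (-s ^ 4) * s ^ (2 * m + (n - 1))) := by
  unfold besselJ
  rw [← tsum_mul_left]
  refine tsum_congr fun m => ?_
  have hz : 0 < η * s := by positivity
  have e1 : (m : ℝ) + ((n : ℝ) - 2) / 2 + 1 = (m : ℝ) + (n : ℝ) / 2 := by ring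
  have e2 : 2 * (m : ℝ) + ((n : ℝ) - 2) / 2 = 2 * (m : ℝ) + ((n : ℝ) / 2 - 1) := by ring
  have e3 : (η * s) ^ ((n : ℝ) / 2) * (η * s) ^ (2 * (m : ℝ) + ((n : ℝ) / 2 - 1))
      = η ^ (2 * m + (n - 1)) * s ^ (2 * m + (n - 1)) := by
    rw [← Real.rpow_add hz, ← mul_pow, ← Real.rpow_natCast]
    congr 1
    push_cast [Nat.cast_sub hn]; ring
  rw [e1, e2, div_eq_mul_one_div (η * s) 2, Real.mul_rpow hz.le (by norm_num)]
  unfold besselCoeff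
  calc _ = (-1 : ℝ) ^ m / ((m.factorial : ℝ) * Real.Gamma ((m : ℝ) + (n : ℝ) / 2)) *
        (1 / 2 : ℝ) ^ (2 * (m : ℝ) + ((n : ℝ) / 2 - 1)) * Real.exp (-s ^ 4) *
        ((η * s) ^ ((n : ℝ) / 2) * (η * s) ^ (2 * (m : ℝ) + ((n : ℝ) / 2 - 1))) := by ring
    _ = _ := by rw [e3]; ring

/-- Sum and integral are interchanged because the integrals of the absolute values are dominated by
the geometric series `M η^{2m}`. At `η = 0` the prescribed value is the constant coefficient. -/
theorem kernelProfile_eq_profileSeries {n : ℕ} (hn : 1 ≤ n) {η : ℝ} (h0 : 0 ≤ η) (h1 : η < 1) :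
    kernelProfile n η = profileSeries n (η ^ 2) := by
  have hn' : (1 : ℝ) ≤ n := by exact_mod_cast hn
  rcases h0.eq_or_lt with rfl | hη
  · have e : profileSeries n ((0 : ℝ) ^ 2) = profileCoeff n 0 := by
      unfold profileSeries
      rw [tsum_eq_single 0 (fun m hm => by simp [hm])]; simp
    rw [e, kernelProfile, if_pos rfl]
    unfold profileCoeff besselCoeff quarticMoment
    have e2 : (2 : ℝ) ^ (1 - (n : ℝ) / 2) = (1 / 2 : ℝ) ^ ((n : ℝ) / 2 - 1) := by
      rw [one_div, Real.inv_rpow (by norm_num), ← Real.rpow_neg (by norm_num)]; ring_nf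
    rw [e2]
    have e3 : ∫ s in Ioi (0 : ℝ), Real.exp (-s ^ 4) * s ^ ((n : ℝ) - 1)
        = ∫ s in Ioi (0 : ℝ), Real.exp (-s ^ 4) * s ^ (2 * 0 + (n - 1)) := by
      refine setIntegral_congr_fun measurableSet_Ioi fun s hs => ?_
      rw [← Real.rpow_natCast]
      have : (n : ℝ) - 1 = ((n - 1 : ℕ) : ℝ) := by simp [Nat.cast_sub hn]
      simp [this]
    rw [e3]
    simp only [Nat.factorial_zero, Nat.cast_zero, Nat.cast_one, one_mul, zero_add, mul_zero, pow_zero]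
    ring
  · obtain ⟨M, hM⟩ := exists_bound_profileCoeff hn
    rw [kernelProfile, if_neg hη.ne']
    have e1 : ∫ s in Ioi (0 : ℝ), Real.exp (-s ^ 4) * (η * s) ^ ((n : ℝ) / 2) *
          besselJ (((n : ℝ) - 2) / 2) (η * s)
        = ∫ s in Ioi (0 : ℝ), ∑' m : ℕ, (-1) ^ m * besselCoeff n m * η ^ (2 * m + (n - 1)) *
          (Real.exp (-s ^ 4) * s ^ (2 * m + (n - 1))) :=
      setIntegral_congr_fun measurableSet_Ioi fun s hs => besselJ_eq_tsum n hn hη hs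
    rw [e1]
    have hint : ∀ m : ℕ, ∫ s in Ioi (0 : ℝ), (-1) ^ m * besselCoeff n m * η ^ (2 * m + (n - 1)) *
          (Real.exp (-s ^ 4) * s ^ (2 * m + (n - 1)))
        = η ^ (n - 1) * (profileCoeff n m * (η ^ 2) ^ m) := fun m => by
      rw [integral_const_mul]; unfold profileCoeff quarticMoment; ring
    rw [← (hasSum_integral_of_summable_integral_norm
      (fun m => (integrableOn_exp_neg_pow_mul_pow _).const_mul _) ?_).tsum_eq]
    · simp_rw [hint]
      rw [tsum_mul_left, ← mul_assoc, ← Real.rpow_natCast, ← Real.rpow_add hη]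
      have : 1 - (n : ℝ) + ((n - 1 : ℕ) : ℝ) = 0 := by push_cast [Nat.cast_sub hn]; ring
      rw [this, Real.rpow_zero, one_mul]; rfl
    · have hnorm : ∀ m : ℕ, ∫ s in Ioi (0 : ℝ), ‖(-1) ^ m * besselCoeff n m *
            η ^ (2 * m + (n - 1)) * (Real.exp (-s ^ 4) * s ^ (2 * m + (n - 1)))‖
          = η ^ (n - 1) * ((besselCoeff n m * quarticMoment (2 * m + (n - 1))) *
            (η ^ 2) ^ m) := fun m => by
        have : ∀ s ∈ Ioi (0 : ℝ), ‖(-1) ^ m * besselCoeff n m *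
            η ^ (2 * m + (n - 1)) * (Real.exp (-s ^ 4) * s ^ (2 * m + (n - 1)))‖
            = besselCoeff n m * η ^ (2 * m + (n - 1)) *
              (Real.exp (-s ^ 4) * s ^ (2 * m + (n - 1))) := fun s hs => by
          have hs' : (0 : ℝ) < s := hs
          simp only [norm_mul, norm_pow, norm_neg, norm_one, one_pow, one_mul, Real.norm_eq_abs,
            abs_of_pos (besselCoeff_pos hn m), abs_of_pos hη, abs_of_pos hs', Real.abs_exp]
        rw [setIntegral_congr_fun measurableSet_Ioi this, integral_const_mul]
        unfold quarticMoment; ring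
      simp_rw [hnorm]
      refine Summable.mul_left _ (Summable.of_nonneg_of_le (fun m => ?_) (fun m => ?_)
        ((summable_geometric_of_lt_one (r := η ^ 2) (by positivity) (by nlinarith)).mul_left M))
      · have := besselCoeff_pos hn m
        have := quarticMoment_pos (2 * m + (n - 1))
        positivity
      · have := hM m
        gcongr

theorem hasFPowerSeriesAt_profileSeries {n : ℕ} (hn : 1 ≤ n) :
    HasFPowerSeriesAt (profileSeries n)
      (FormalMultilinearSeries.ofScalars ℝ (profileCoeff n)) 0 := by
  obtain ⟨M, hM⟩ := exists_bound_profileCoeff hn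
  have hr : (1 : ENNReal) ≤ (FormalMultilinearSeries.ofScalars ℝ (profileCoeff n)).radius := by
    refine FormalMultilinearSeries.le_radius_of_bound (r := 1) _ M fun m => ?_
    have h1 := besselCoeff_pos hn m
    have h2 := quarticMoment_pos (2 * m + (n - 1))
    rw [FormalMultilinearSeries.ofScalars_norm]
    simpa [profileCoeff, abs_of_pos h1, abs_of_pos h2] using hM m
  have h := (FormalMultilinearSeries.ofScalars ℝ (profileCoeff n)).hasFPowerSeriesOnBall
    (lt_of_lt_of_le one_pos hr)
  have e : (FormalMultilinearSeries.ofScalars ℝ (profileCoeff n)).sum = profileSeries n := by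
    funext q
    unfold profileSeries FormalMultilinearSeries.sum
    refine tsum_congr fun m => ?_
    rw [FormalMultilinearSeries.ofScalars_apply_eq]; simp
  rw [e] at h
  exact h.hasFPowerSeriesAt

theorem profileSeries_zero_pos {n : ℕ} (hn : 1 ≤ n) : 0 < profileSeries n 0 := by
  rw [profileSeries, tsum_eq_single 0 (fun m hm => by simp [hm])]
  have h1 := besselCoeff_pos hn 0
  have h2 := quarticMoment_pos (2 * 0 + (n - 1))
  unfold profileCoeff
  simp only [pow_zero, one_mul, mul_one]
  positivity

/-- The first coefficient carries the sign `(-1)¹`. This is the source of `ΔB < 0` on the axis. -/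
theorem deriv_profileSeries_zero_neg {n : ℕ} (hn : 1 ≤ n) : deriv (profileSeries n) 0 < 0 := by
  rw [(hasFPowerSeriesAt_profileSeries hn).deriv, FormalMultilinearSeries.ofScalars_apply_eq]
  have h1 := besselCoeff_pos hn 1
  have h2 := quarticMoment_pos (2 * 1 + (n - 1))
  have := mul_pos h1 h2
  unfold profileCoeff
  simp only [pow_one, smul_eq_mul, mul_one]
  linarith

end Kernel

/-! ### Signs and sizes of the kernel and its Laplacian near the axis -/

section KernelLaplacian

theorem pd_norm_sub_sq {n : ℕ} (x₀ x : E n) (c : ℝ) (j : Fin n) :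
    pd j (fun y : E n => ‖y - x₀‖ ^ 2 / c) x = 2 * (x j - x₀ j) / c := by
  have h : (fun y : E n => ‖y - x₀‖ ^ 2 / c) = fun y => c⁻¹ * ⟪y - x₀, y - x₀⟫_ℝ := by
    funext y; rw [real_inner_self_eq_norm_sq]; ring
  have hd : DifferentiableAt ℝ (fun y : E n => y - x₀) x := by fun_prop
  have e : pd j (fun y : E n => y - x₀) x = EuclideanSpace.single j 1 := by
    unfold pd; rw [fderiv_sub_const]; simp
  rw [h, pd_mul (by fun_prop) (hd.inner ℝ hd), pd_inner hd hd, e]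
  simp [pd, EuclideanSpace.inner_single_left, EuclideanSpace.inner_single_right]
  ring

/-- Writing radial functions through the squared norm keeps them smooth at the centre, so the
formula also holds on the axis. -/
theorem lap_comp_norm_sub_sq {n : ℕ} {f : ℝ → ℝ} {x₀ x : E n} {c : ℝ}
    (hf : AnalyticAt ℝ f (‖x - x₀‖ ^ 2 / c)) :
    lap (fun y => f (‖y - x₀‖ ^ 2 / c)) x
      = (4 * (‖x - x₀‖ ^ 2 / c) * deriv (deriv f) (‖x - x₀‖ ^ 2 / c)
          + 2 * n * deriv f (‖x - x₀‖ ^ 2 / c)) / c := by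
  set Q : E n → ℝ := fun y => ‖y - x₀‖ ^ 2 / c with hQ
  have hQs : ContDiff ℝ ∞ Q := by
    have : ContDiff ℝ ∞ fun y : E n => y - x₀ := by fun_prop
    exact (this.norm_sq ℝ).div_const c
  have hQd : Differentiable ℝ Q := hQs.differentiable (by simp)
  have hfx : AnalyticAt ℝ f (Q x) := hf
  have hev : ∀ᶠ y in 𝓝 x, AnalyticAt ℝ f (Q y) :=
    hQs.continuous.continuousAt.eventually hfx.eventually_analyticAt
  have hcd : ContDiffAt ℝ 2 (fun y => f (Q y)) x :=
    ContDiffAt.comp x hfx.contDiffAt (hQs.contDiffAt.of_le two_le_infty)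
  rw [lap_eq_sum_pd hcd]
  have key : ∀ j : Fin n, pd j (pd j fun y => f (Q y)) x
      = deriv (deriv f) (Q x) * (4 / c ^ 2 * (x j - x₀ j) ^ 2) + deriv f (Q x) * (2 / c) := by
    intro j
    have h1 : pd j (fun y => f (Q y)) =ᶠ[𝓝 x] fun y => deriv f (Q y) * (2 * (y j - x₀ j) / c) := by
      filter_upwards [hev] with y hy
      rw [pd_comp hy.differentiableAt (hQd y), pd_norm_sub_sq]
    have h2 : pd j (pd j fun y => f (Q y)) x
        = pd j (fun y => deriv f (Q y) * (2 * (y j - x₀ j) / c)) x := by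
      simp only [pd] at h1 ⊢
      rw [h1.fderiv_eq]
    have hl : DifferentiableAt ℝ (fun y : E n => 2 * (y j - x₀ j) / c) x := by fun_prop
    have hl' : pd j (fun y : E n => 2 * (y j - x₀ j) / c) x = 2 / c := by
      have : HasFDerivAt (fun y : E n => 2 * (y j - x₀ j) / c)
          ((2 / c) • (EuclideanSpace.proj j : E n →L[ℝ] ℝ)) x := by
        have h0 := (((EuclideanSpace.proj j : E n →L[ℝ] ℝ).hasFDerivAt (x := x)).sub_const
          (x₀ j)).const_mul (2 / c)
        refine h0.congr_of_eventuallyEq (Eventually.of_forall fun y => ?_)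
        simp; ring
      unfold pd; rw [this.fderiv]; simp
    have hfd : DifferentiableAt ℝ (fun y => deriv f (Q y)) x :=
      hfx.deriv.differentiableAt.comp x (hQd x)
    rw [h2, pd_mul hfd hl,
      pd_comp hfx.deriv.differentiableAt (hQd x), pd_norm_sub_sq, hl']
    ring
  simp_rw [key]
  rw [Finset.sum_add_distrib, ← Finset.mul_sum, ← Finset.mul_sum]
  have hn : ∑ j : Fin n, (x j - x₀ j) ^ 2 = ‖x - x₀‖ ^ 2 := by
    rw [EuclideanSpace.real_norm_sq_eq]; simp
  rw [hn]
  simp only [Finset.sum_const, Finset.card_univ, Fintype.card_fin, nsmul_eq_mul, hQ]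
  -- For `c = 0` division by zero makes both sides vanish.
  rcases eq_or_ne c 0 with rfl | hc
  · simp
  · field_simp

/-- Near the axis, on parabolic scale, the kernel is nonnegative, its Laplacian is nonpositive, and
both have the size which scaling predicts. -/
theorem exists_backwardKernel_bounds {n : ℕ} (hn : 1 ≤ n) :
    ∃ (η K : ℝ) (F G : ℝ → ℝ), 0 < η ∧ η ≤ 1 ∧ 0 < K ∧
      ContinuousOn F (Ico 0 (η ^ 2)) ∧ ContinuousOn G (Ico 0 (η ^ 2)) ∧
      (∀ q ∈ Ico 0 (η ^ 2), 0 ≤ F q ∧ F q ≤ K ∧ -K ≤ G q ∧ G q ≤ 0) ∧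
      ∀ (x₀ x : E n) (t₀ t σ : ℝ), 0 < σ → t₀ - t = σ ^ 4 → ‖x - x₀‖ < η * σ →
        backwardKernel x₀ t₀ x t = F (‖x - x₀‖ ^ 2 / σ ^ 2) / σ ^ n ∧
        lap (fun y => backwardKernel x₀ t₀ y t) x = G (‖x - x₀‖ ^ 2 / σ ^ 2) / σ ^ (n + 2) := by
  set f := profileSeries n with hf
  set α := kernelConst n with hα
  have hαp : 0 < α := by rw [hα, kernelConst]; positivity
  have hn' : (1 : ℝ) ≤ n := by exact_mod_cast hn
  have ha : AnalyticAt ℝ f 0 := (hasFPowerSeriesAt_profileSeries hn).analyticAt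
  set F : ℝ → ℝ := fun q => α * f q with hF
  set G : ℝ → ℝ := fun q => α * (4 * q * deriv (deriv f) q + 2 * n * deriv f q) with hG
  have hFc : ∀ {q}, AnalyticAt ℝ f q → ContinuousAt F q := fun h =>
    continuousAt_const.mul h.continuousAt
  have hGc : ∀ {q}, AnalyticAt ℝ f q → ContinuousAt G q := fun h =>
    continuousAt_const.mul (((continuousAt_const.mul continuousAt_id).mul
      h.deriv.deriv.continuousAt).add (continuousAt_const.mul h.deriv.continuousAt))
  have hF0 : 0 < F 0 := mul_pos hαp (profileSeries_zero_pos hn)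
  have hG0 : G 0 < 0 := by
    have := deriv_profileSeries_zero_neg hn
    simp only [hG, mul_zero, zero_mul, zero_add]
    exact mul_neg_of_pos_of_neg hαp (mul_neg_of_pos_of_neg (by linarith) this)
  have hev : ∀ᶠ q in 𝓝 (0 : ℝ), AnalyticAt ℝ f q ∧ (0 < F q ∧ F q < F 0 + 1) ∧
      (G 0 - 1 < G q ∧ G q < 0) :=
    ha.eventually_analyticAt.and
      (((hFc ha).eventually (Ioo_mem_nhds hF0 (by linarith))).and
        ((hGc ha).eventually (Ioo_mem_nhds (by linarith) hG0)))
  obtain ⟨ε, hε, hball⟩ := Metric.eventually_nhds_iff.1 hev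
  -- `√ε` keeps `q` in the interval where the signs hold; `1` keeps `|x-x₀|/σ` where the series
  -- represents the profile.
  set η := min (Real.sqrt ε) 1 with hη
  have hηp : 0 < η := lt_min (Real.sqrt_pos.2 hε) one_pos
  have hη1 : η ≤ 1 := min_le_right _ _
  have hη2 : η ^ 2 ≤ ε := by
    calc η ^ 2 ≤ Real.sqrt ε ^ 2 := by gcongr; exact min_le_left _ _
      _ = ε := Real.sq_sqrt hε.le
  have hQ : ∀ q ∈ Ico 0 (η ^ 2), AnalyticAt ℝ f q ∧ (0 < F q ∧ F q < F 0 + 1) ∧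
      (G 0 - 1 < G q ∧ G q < 0) := fun q hq => hball (by
    rw [Real.dist_eq, sub_zero, abs_of_nonneg hq.1]; exact hq.2.trans_le hη2)
  refine ⟨η, F 0 + 1 - G 0, F, G, hηp, hη1, by linarith,
    fun q hq => (hFc (hQ q hq).1).continuousWithinAt,
    fun q hq => (hGc (hQ q hq).1).continuousWithinAt, fun q hq => ?_, ?_⟩
  · obtain ⟨-, ⟨h1, h2⟩, h3, h4⟩ := hQ q hq
    exact ⟨h1.le, by linarith, by linarith, h4.le⟩
  · intro x₀ x t₀ t σ hσ ht hx
    have e4 : ∀ p : ℝ, (t₀ - t) ^ p = σ ^ (4 * p) := fun p => by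
      rw [ht, ← Real.rpow_natCast, ← Real.rpow_mul hσ.le]; norm_num
    have eB : ∀ y : E n, ‖y - x₀‖ < η * σ →
        backwardKernel x₀ t₀ y t = (σ ^ n)⁻¹ * F (‖y - x₀‖ ^ 2 / σ ^ 2) := fun y hy => by
      have h1 : ‖y - x₀‖ / σ < 1 := by
        rw [div_lt_one hσ]; nlinarith
      unfold backwardKernel
      rw [e4, e4, show 4 * ((n : ℝ) / 4) = n by ring, show 4 * ((1 : ℝ) / 4) = 1 by norm_num,
        Real.rpow_one, Real.rpow_natCast, kernelProfile_eq_profileSeries hn (by positivity) h1,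
        div_pow]
      simp only [hF, hα, hf]; ring
    have hq : ‖x - x₀‖ ^ 2 / σ ^ 2 ∈ Ico 0 (η ^ 2) := by
      refine ⟨by positivity, ?_⟩
      rw [div_lt_iff₀ (by positivity), ← mul_pow]
      gcongr
    refine ⟨by rw [eB x hx]; ring, ?_⟩
    have hnear : (fun y => backwardKernel x₀ t₀ y t) =ᶠ[𝓝 x]
        ((σ ^ n)⁻¹ * α) • fun y => f (‖y - x₀‖ ^ 2 / σ ^ 2) := by
      have : {y : E n | ‖y - x₀‖ < η * σ} ∈ 𝓝 x :=
        (isOpen_lt (by fun_prop) continuous_const).mem_nhds hx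
      filter_upwards [this] with y hy
      rw [eB y hy]; simp [hF]; ring
    have hfa := (hQ _ hq).1
    have hcd : ContDiffAt ℝ 2 (fun y => f (‖y - x₀‖ ^ 2 / σ ^ 2)) x := by
      have : ContDiff ℝ 2 fun y : E n => y - x₀ := by fun_prop
      exact ContDiffAt.comp x hfa.contDiffAt ((this.norm_sq ℝ).div_const (σ ^ 2)).contDiffAt
    have := lap_comp_norm_sub_sq hfa
    unfold lap at this ⊢
    rw [InnerProductSpace.laplacian_congr_nhds hnear |>.eq_of_nhds,
      InnerProductSpace.laplacian_smul _ hcd, this]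
    simp only [hG, smul_eq_mul]
    rw [pow_add]
    field_simp

end KernelLaplacian

/-! ### Interior estimates for the Hessian and for the gradient on small balls -/

section InteriorEstimate

variable {n : ℕ}

theorem contDiff_one {F : Type*} [NormedAddCommGroup F] [NormedSpace ℝ F] {v : E n → F}
    (hv : ContDiff ℝ ∞ v) : ContDiff ℝ 1 v := hv.of_le (by exact_mod_cast le_top)

theorem differentiable_of_smooth {F : Type*} [NormedAddCommGroup F] [NormedSpace ℝ F] {v : E n → F}
    (hv : ContDiff ℝ ∞ v) : Differentiable ℝ v := hv.differentiable (by simp)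

theorem integrable_of_eq_zero_off {η f : E n → ℝ} (hη : HasCompactSupport η) (hf : Continuous f)
    (h : ∀ x, x ∉ tsupport η → f x = 0) : Integrable f :=
  hf.integrable_of_hasCompactSupport (HasCompactSupport.intro hη.isCompact h)

theorem pd_eq_zero_of_notMem_tsupport {η : E n → ℝ} {x : E n} (h : x ∉ tsupport η) (j : Fin n) :
    pd j η x = 0 := by
  unfold pd
  rw [image_eq_zero_of_notMem_tsupport fun h' => h (tsupport_fderiv_subset ℝ h')]; simp

theorem pd_sum {F ι : Type*} [NormedAddCommGroup F] [NormedSpace ℝ F] (s : Finset ι)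
    {v : ι → E n → F} {x : E n} (hv : ∀ i ∈ s, DifferentiableAt ℝ (v i) x) (j : Fin n) :
    pd j (fun y => ∑ i ∈ s, v i y) x = ∑ i ∈ s, pd j (v i) x := by
  unfold pd
  rw [fderiv_fun_sum hv]; simp

theorem pd_sub {F : Type*} [NormedAddCommGroup F] [NormedSpace ℝ F]
    {v w : E n → F} {x : E n} (hv : DifferentiableAt ℝ v x) (hw : DifferentiableAt ℝ w x)
    (j : Fin n) : pd j (fun y => v y - w y) x = pd j v x - pd j w x := by
  unfold pd
  rw [fderiv_fun_sub hv hw]; simp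

theorem pd_sq {v : E n → ℝ} {x : E n} (hv : DifferentiableAt ℝ v x) (j : Fin n) :
    pd j (fun y => v y ^ 2) x = 2 * v x * pd j v x := by
  simp_rw [sq]
  rw [pd_mul hv hv]; ring

theorem pd_lap {F : Type*} [NormedAddCommGroup F] [NormedSpace ℝ F] {u : E n → F}
    (hu : ContDiff ℝ ∞ u) (j : Fin n) (x : E n) :
    pd j (lap u) x = ∑ i, pd i (pd i (pd j u)) x := by
  rw [lap_eq_sum_pd' (hu.of_le two_le_infty), pd_sum]
  · refine Finset.sum_congr rfl fun i _ => ?_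
    rw [pd_comm ((contDiff_pd hu i).contDiffAt.of_le two_le_infty)]
    congr 1
    funext y
    exact pd_comm (hu.contDiffAt.of_le two_le_infty) _ _
  · exact fun i _ => differentiable_of_smooth (contDiff_pd (contDiff_pd hu i) i) x

/-- `|D²v|²(x) = ∑_{i,j} |∂_i ∂_j v(x)|²`. -/
def hessSq {F : Type*} [NormedAddCommGroup F] [NormedSpace ℝ F] (v : E n → F) (x : E n) : ℝ :=
  ∑ i : Fin n, ∑ j : Fin n, ‖pd i (pd j v) x‖ ^ 2

theorem continuous_hessSq {F : Type*} [NormedAddCommGroup F] [NormedSpace ℝ F] {v : E n → F}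
    (hv : ContDiff ℝ ∞ v) : Continuous (hessSq v) :=
  continuous_finsetSum _ fun i _ => continuous_finsetSum _ fun j _ =>
    ((contDiff_pd (contDiff_pd hv j) i).continuous.norm.pow 2)

variable {G : Type*} [NormedAddCommGroup G] [InnerProductSpace ℝ G]

theorem two_mul_inner_le (a b : ℝ) (v w : G) :
    |2 * (a * b * ⟪v, w⟫_ℝ)| ≤ a ^ 2 * ‖v‖ ^ 2 + b ^ 2 * ‖w‖ ^ 2 := by
  have h := abs_real_inner_le_norm v w
  rw [abs_mul, abs_mul, abs_mul, abs_two]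
  calc 2 * (|a| * |b| * |⟪v, w⟫_ℝ|) ≤ 2 * (|a| * |b| * (‖v‖ * ‖w‖)) := by gcongr
    _ ≤ |a| ^ 2 * ‖v‖ ^ 2 + |b| ^ 2 * ‖w‖ ^ 2 := by nlinarith [sq_nonneg (|a| * ‖v‖ - |b| * ‖w‖)]
    _ = _ := by rw [sq_abs, sq_abs]

/-- The field `q_i = ∑_j ⟨∂_i∂_j u, ∂_j u⟩ - ⟨Δu, ∂_i u⟩` has divergence `|D²u|² - |Δu|²`.
Integrating the divergence of `η²q` gives zero, and the terms with `∇η` are absorbed by Young's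
inequality. -/
theorem integral_sq_mul_hessSq_le {u : E n → G} {η : E n → ℝ} (hu : ContDiff ℝ ∞ u)
    (hη : ContDiff ℝ ∞ η) (hc : HasCompactSupport η) :
    ∫ x, η x ^ 2 * hessSq u x ≤ 2 * (n + 1) * (∫ x, η x ^ 2 * ‖lap u x‖ ^ 2)
      + 6 * ∫ x, gradSq η x * gradSq u x := by
  have hL := contDiff_lap hu
  have hg := fun j => contDiff_pd hu j
  have hh := fun i j => contDiff_pd (hg j) i
  set q : Fin n → E n → ℝ := fun i x =>
    (∑ j, ⟪pd i (pd j u) x, pd j u x⟫_ℝ) - ⟪lap u x, pd i u x⟫_ℝ with hq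
  have hqs : ∀ i, ContDiff ℝ ∞ (q i) := fun i =>
    (ContDiff.sum fun j _ => (hh i j).inner ℝ (hg j)).sub (hL.inner ℝ (hg i))
  have hη2 : ContDiff ℝ ∞ fun x => η x ^ 2 := hη.pow 2
  have hX : ∀ i, ∫ x, pd i (fun y => η y ^ 2 * q i y) x = 0 := fun i =>
    integral_pd_eq_zero (contDiff_one (hη2.mul (hqs i)))
      (HasCompactSupport.intro hc.isCompact fun x hx => by
        simp [image_eq_zero_of_notMem_tsupport hx]) i
  have hXc : ∀ i, Integrable (fun x => pd i (fun y => η y ^ 2 * q i y) x) := fun i =>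
    (contDiff_pd (hη2.mul (hqs i)) i).continuous.integrable_of_hasCompactSupport
      (hasCompactSupport_pd (HasCompactSupport.intro hc.isCompact fun x hx => by
        simp [image_eq_zero_of_notMem_tsupport hx]) i)
  have hpdq : ∀ i x, pd i (q i) x = (∑ j, (⟪pd i (pd i (pd j u)) x, pd j u x⟫_ℝ
      + ‖pd i (pd j u) x‖ ^ 2)) - (⟪pd i (lap u) x, pd i u x⟫_ℝ
      + ⟪lap u x, pd i (pd i u) x⟫_ℝ) := fun i x => by
    have hd := fun {v : E n → G} (h : ContDiff ℝ ∞ v) => differentiable_of_smooth h x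
    simp only [hq]
    rw [pd_sub (DifferentiableAt.fun_sum fun j _ => (hd (hh i j)).inner ℝ (hd (hg j)))
      ((hd hL).inner ℝ (hd (hg i))), pd_sum _ fun j _ => (hd (hh i j)).inner ℝ (hd (hg j)),
      pd_inner (hd hL) (hd (hg i))]
    congr 1
    refine Finset.sum_congr rfl fun j _ => ?_
    rw [pd_inner (hd (hh i j)) (hd (hg j)), real_inner_self_eq_norm_sq]
  have hdiv : ∀ x, ∑ i, pd i (fun y => η y ^ 2 * q i y) x
      = (∑ i, 2 * η x * pd i η x * q i x) + η x ^ 2 * (hessSq u x - ‖lap u x‖ ^ 2) := fun x => by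
    have e1 : ∀ i, pd i (fun y => η y ^ 2 * q i y) x
        = 2 * η x * pd i η x * q i x + η x ^ 2 * pd i (q i) x := fun i => by
      rw [pd_mul (differentiable_of_smooth hη2 x) (differentiable_of_smooth (hqs i) x),
        pd_sq (differentiable_of_smooth hη x)]
    simp_rw [e1]
    rw [Finset.sum_add_distrib, ← Finset.mul_sum]
    congr 2
    simp_rw [hpdq, Finset.sum_sub_distrib, Finset.sum_add_distrib]
    have e2 : ∑ i, ⟪lap u x, pd i (pd i u) x⟫_ℝ = ‖lap u x‖ ^ 2 := by
      rw [← inner_sum, ← lap_eq_sum_pd (hu.contDiffAt.of_le two_le_infty),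
        real_inner_self_eq_norm_sq]
    -- The third order terms of the divergence cancel since `∇` and `Δ` commute.
    have e3 : ∑ i, ∑ j, ⟪pd i (pd i (pd j u)) x, pd j u x⟫_ℝ
        = ∑ i, ⟪pd i (lap u) x, pd i u x⟫_ℝ := by
      rw [Finset.sum_comm]
      refine Finset.sum_congr rfl fun j _ => ?_
      rw [pd_lap hu, sum_inner]
    rw [e2, e3]
    unfold hessSq; ring
  -- Young's inequality leaves half of the Hessian term, which is absorbed; hence the factor `2` in
  -- front of the divergence.
  have hpt : ∀ x, η x ^ 2 * hessSq u x ≤ 2 * (∑ i, pd i (fun y => η y ^ 2 * q i y) x)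
      + (2 * (n + 1) * (η x ^ 2 * ‖lap u x‖ ^ 2) + 6 * (gradSq η x * gradSq u x)) := fun x => by
    rw [hdiv]
    have b1 : -(∑ i, 2 * η x * pd i η x * q i x) ≤ 1 / 2 * (η x ^ 2 * hessSq u x)
        + 3 * (gradSq η x * gradSq u x) + n * (η x ^ 2 * ‖lap u x‖ ^ 2) := by
      have e1 : -(∑ i, 2 * η x * pd i η x * q i x)
          = ∑ i, ((∑ j, -(2 * (η x * pd i η x * ⟪pd i (pd j u) x, pd j u x⟫_ℝ)))
            + 2 * (η x * pd i η x * ⟪lap u x, pd i u x⟫_ℝ)) := by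
        rw [← Finset.sum_neg_distrib]
        refine Finset.sum_congr rfl fun i _ => ?_
        simp only [hq, Finset.sum_neg_distrib, ← Finset.mul_sum]; ring
      rw [e1]
      have e2 : ∀ i, (∑ j, -(2 * (η x * pd i η x * ⟪pd i (pd j u) x, pd j u x⟫_ℝ)))
            + 2 * (η x * pd i η x * ⟪lap u x, pd i u x⟫_ℝ)
          ≤ 1 / 2 * (η x ^ 2 * ∑ j, ‖pd i (pd j u) x‖ ^ 2) + 3 * ((pd i η x) ^ 2 * gradSq u x)
            + η x ^ 2 * ‖lap u x‖ ^ 2 := fun i => by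
        have f1 : ∀ j, -(2 * (η x * pd i η x * ⟪pd i (pd j u) x, pd j u x⟫_ℝ))
            ≤ 1 / 2 * (η x ^ 2 * ‖pd i (pd j u) x‖ ^ 2) + 2 * ((pd i η x) ^ 2 * ‖pd j u x‖ ^ 2) :=
          fun j => by
            have := (abs_le.1 (two_mul_inner_le (η x) (2 * pd i η x) (pd i (pd j u) x)
              (pd j u x))).1
            nlinarith
        have f2 := (abs_le.1 (two_mul_inner_le (η x) (pd i η x) (lap u x) (pd i u x))).2
        have f3 : ‖pd i u x‖ ^ 2 ≤ gradSq u x :=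
          Finset.single_le_sum (f := fun j => ‖pd j u x‖ ^ 2) (fun j _ => by positivity)
            (Finset.mem_univ i)
        have f4 : (pd i η x) ^ 2 * ‖pd i u x‖ ^ 2 ≤ (pd i η x) ^ 2 * gradSq u x := by gcongr
        have f5 := Finset.sum_le_sum fun j (_ : j ∈ Finset.univ) => f1 j
        rw [Finset.sum_add_distrib, ← Finset.mul_sum, ← Finset.mul_sum, ← Finset.mul_sum,
          ← Finset.mul_sum] at f5
        change _ ≤ _ + 2 * ((pd i η x) ^ 2 * gradSq u x) at f5
        linarith
      refine (Finset.sum_le_sum fun i _ => e2 i).trans (le_of_eq ?_)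
      rw [Finset.sum_add_distrib, Finset.sum_add_distrib, ← Finset.mul_sum, ← Finset.mul_sum,
        ← Finset.mul_sum, ← Finset.sum_mul]
      simp [hessSq, gradSq]
    nlinarith
  have i1 : Integrable fun x => η x ^ 2 * hessSq u x :=
    integrable_of_eq_zero_off hc (hη2.continuous.mul (continuous_hessSq hu)) fun x hx => by
      simp [image_eq_zero_of_notMem_tsupport hx]
  have i2 : Integrable fun x => η x ^ 2 * ‖lap u x‖ ^ 2 :=
    integrable_of_eq_zero_off hc (hη2.continuous.mul (hL.continuous.norm.pow 2)) fun x hx => by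
      simp [image_eq_zero_of_notMem_tsupport hx]
  have i3 : Integrable fun x => gradSq η x * gradSq u x :=
    integrable_of_eq_zero_off hc ((continuous_gradSq hη).mul (continuous_gradSq hu)) fun x hx => by
      simp [gradSq, pd_eq_zero_of_notMem_tsupport hx]
  have i4 : Integrable fun x => ∑ i, pd i (fun y => η y ^ 2 * q i y) x :=
    integrable_finsetSum _ fun i _ => hXc i
  calc ∫ x, η x ^ 2 * hessSq u x
      ≤ ∫ x, (2 * (∑ i, pd i (fun y => η y ^ 2 * q i y) x)
        + (2 * (n + 1) * (η x ^ 2 * ‖lap u x‖ ^ 2) + 6 * (gradSq η x * gradSq u x))) :=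
        integral_mono i1 ((i4.const_mul 2).add ((i2.const_mul _).add (i3.const_mul _))) hpt
    _ = _ := by
        have i5 : Integrable fun x => 2 * (n + 1) * (η x ^ 2 * ‖lap u x‖ ^ 2)
          + 6 * (gradSq η x * gradSq u x) := (i2.const_mul _).add (i3.const_mul _)
        rw [integral_add (i4.const_mul 2) i5, integral_add (i2.const_mul _) (i3.const_mul _), integral_const_mul, integral_const_mul,
          integral_const_mul, integral_finsetSum _ fun i _ => hXc i]
        simp [hX]

/-- Integration by parts moves `∂_i` off `θ`: smallness of `θ` itself, not of its derivative,
controls the integral, at the price of second derivatives of `u`. -/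
theorem integral_weight_mul_gradSq_le {u : E n → G} {η θ : E n → ℝ} {δ : ℝ} {i : Fin n}
    (hu : ContDiff ℝ ∞ u) (hη : ContDiff ℝ ∞ η) (hc : HasCompactSupport η)
    (hθ : ContDiff ℝ ∞ θ) (hδ : ∀ x, |θ x| ≤ δ) :
    ∫ x, pd i θ x * (η x ^ 2 * gradSq u x) ≤ δ * ((∫ x, gradSq η x * gradSq u x)
      + 2 * (∫ x, η x ^ 2 * gradSq u x) + ∫ x, η x ^ 2 * hessSq u x) := by
  have hg := fun j => contDiff_pd hu j
  have hη2 : ContDiff ℝ ∞ fun x => η x ^ 2 := hη.pow 2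
  have hGs : ContDiff ℝ ∞ fun x => gradSq u x := ContDiff.sum fun j _ => (hg j).norm_sq ℝ
  have hs : ContDiff ℝ ∞ fun x => θ x * (η x ^ 2 * gradSq u x) := hθ.mul (hη2.mul hGs)
  have hsc : HasCompactSupport fun x => θ x * (η x ^ 2 * gradSq u x) :=
    HasCompactSupport.intro hc.isCompact fun x hx => by
      simp [image_eq_zero_of_notMem_tsupport hx]
  have h0 := integral_pd_eq_zero (contDiff_one hs) hsc i
  have hpd : ∀ x, pd i (fun y => θ y * (η y ^ 2 * gradSq u y)) x
      = pd i θ x * (η x ^ 2 * gradSq u x) + θ x * (2 * η x * pd i η x * gradSq u x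
        + η x ^ 2 * ∑ j, 2 * ⟪pd i (pd j u) x, pd j u x⟫_ℝ) := fun x => by
    rw [pd_mul (differentiable_of_smooth hθ x) (differentiable_of_smooth (hη2.mul hGs) x),
      pd_mul (differentiable_of_smooth hη2 x) (differentiable_of_smooth hGs x),
      pd_sq (differentiable_of_smooth hη x)]
    congr 4
    have hd := fun j => differentiable_of_smooth (hg j) x
    have e : gradSq u = fun y => ∑ j, ⟪pd j u y, pd j u y⟫_ℝ := by
      funext y; simp only [gradSq, real_inner_self_eq_norm_sq]
    change pd i (gradSq u) x = _
    rw [e, pd_sum _ fun j _ => (hd j).inner ℝ (hd j)]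
    refine Finset.sum_congr rfl fun j _ => ?_
    rw [pd_inner (hd j) (hd j), real_inner_comm]; ring
  have hpt : ∀ x, pd i θ x * (η x ^ 2 * gradSq u x)
      ≤ pd i (fun y => θ y * (η y ^ 2 * gradSq u y)) x + δ * (gradSq η x * gradSq u x
        + 2 * (η x ^ 2 * gradSq u x) + η x ^ 2 * hessSq u x) := fun x => by
    rw [hpd]
    have hgu := gradSq_nonneg u x
    have b1 : |2 * η x * pd i η x * gradSq u x| ≤ gradSq η x * gradSq u x
        + η x ^ 2 * gradSq u x := by
      have f3 : ‖pd i η x‖ ^ 2 ≤ gradSq η x :=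
        Finset.single_le_sum (f := fun j => ‖pd j η x‖ ^ 2) (fun j _ => by positivity)
          (Finset.mem_univ i)
      rw [Real.norm_eq_abs, sq_abs] at f3
      rw [abs_mul, abs_of_nonneg hgu, ← add_mul]
      gcongr
      rw [abs_le]
      constructor <;> nlinarith [sq_nonneg (η x - pd i η x), sq_nonneg (η x + pd i η x)]
    have b2 : |∑ j, 2 * ⟪pd i (pd j u) x, pd j u x⟫_ℝ| ≤ hessSq u x + gradSq u x := by
      refine (Finset.abs_sum_le_sum_abs _ _).trans ?_
      have : ∀ j, |2 * ⟪pd i (pd j u) x, pd j u x⟫_ℝ| ≤ ‖pd i (pd j u) x‖ ^ 2 + ‖pd j u x‖ ^ 2 :=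
        fun j => by simpa using two_mul_inner_le 1 1 (pd i (pd j u) x) (pd j u x)
      refine (Finset.sum_le_sum fun j _ => this j).trans ?_
      rw [Finset.sum_add_distrib]
      refine add_le_add ?_ le_rfl
      exact Finset.single_le_sum (f := fun i => ∑ j, ‖pd i (pd j u) x‖ ^ 2)
        (fun j _ => Finset.sum_nonneg fun _ _ => by positivity) (Finset.mem_univ i)
    have b3 : |2 * η x * pd i η x * gradSq u x
        + η x ^ 2 * ∑ j, 2 * ⟪pd i (pd j u) x, pd j u x⟫_ℝ|
        ≤ gradSq η x * gradSq u x + 2 * (η x ^ 2 * gradSq u x) + η x ^ 2 * hessSq u x := by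
      refine (abs_add_le _ _).trans ?_
      rw [abs_mul (η x ^ 2), abs_of_nonneg (sq_nonneg (η x))]
      have := mul_le_mul_of_nonneg_left b2 (sq_nonneg (η x))
      linarith
    have b4 := mul_le_mul (hδ x) b3 (abs_nonneg _) ((abs_nonneg _).trans (hδ x))
    rw [← abs_mul] at b4
    linarith [(abs_le.1 b4).1]
  have i0 : Integrable fun x => pd i θ x * (η x ^ 2 * gradSq u x) :=
    integrable_of_eq_zero_off hc ((contDiff_pd hθ i).continuous.mul
      (hη2.continuous.mul hGs.continuous)) fun x hx => by
      simp [image_eq_zero_of_notMem_tsupport hx]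
  have i1 : Integrable fun x => η x ^ 2 * hessSq u x :=
    integrable_of_eq_zero_off hc (hη2.continuous.mul (continuous_hessSq hu)) fun x hx => by
      simp [image_eq_zero_of_notMem_tsupport hx]
  have i2 : Integrable fun x => η x ^ 2 * gradSq u x :=
    integrable_of_eq_zero_off hc (hη2.continuous.mul hGs.continuous) fun x hx => by
      simp [image_eq_zero_of_notMem_tsupport hx]
  have i3 : Integrable fun x => gradSq η x * gradSq u x :=
    integrable_of_eq_zero_off hc ((continuous_gradSq hη).mul (continuous_gradSq hu)) fun x hx => by
      simp [gradSq, pd_eq_zero_of_notMem_tsupport hx]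
  have i4 : Integrable fun x => pd i (fun y => θ y * (η y ^ 2 * gradSq u y)) x :=
    (contDiff_pd hs i).continuous.integrable_of_hasCompactSupport (hasCompactSupport_pd hsc i)
  have i5 : Integrable fun x => gradSq η x * gradSq u x + 2 * (η x ^ 2 * gradSq u x) :=
    i3.add (i2.const_mul 2)
  have i6 : Integrable fun x => gradSq η x * gradSq u x + 2 * (η x ^ 2 * gradSq u x)
    + η x ^ 2 * hessSq u x := i5.add i1
  have i7 : Integrable fun x => pd i (fun y => θ y * (η y ^ 2 * gradSq u y)) x
    + δ * (gradSq η x * gradSq u x + 2 * (η x ^ 2 * gradSq u x) + η x ^ 2 * hessSq u x) :=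
    i4.add (i6.const_mul δ)
  refine (integral_mono i0 i7 hpt).trans (le_of_eq ?_)
  rw [integral_add i4 (i6.const_mul δ), h0, zero_add, integral_const_mul, integral_add i5 i1,
    integral_add i3 (i2.const_mul 2), integral_const_mul]

theorem exists_cutoff_function (x₀ : E n) {r : ℝ} (hr : 0 < r) :
    ∃ η : E n → ℝ, ContDiff ℝ ∞ η ∧ HasCompactSupport η ∧ (∀ x, 0 ≤ η x) ∧ (∀ x, η x ≤ 1) ∧
      (∀ x ∈ Metric.closedBall x₀ (r / 2), η x = 1) ∧ Function.support η = Metric.ball x₀ r := by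
  let b : ContDiffBump x₀ := ⟨r / 2, r, by linarith, by linarith⟩
  exact ⟨b, b.contDiff, b.hasCompactSupport, fun x => b.nonneg, fun x => b.le_one,
    fun x hx => b.one_of_mem_closedBall hx, b.support_eq⟩

/-- A function of one coordinate suffices: `δ arctan((x_i - x₀_i)/δ)` has size `δ`, while its slope
`1/(1+ℓ²)` is of order one on the ball of radius `δ`. -/
theorem exists_slab_weight (i : Fin n) (x₀ : E n) {δ : ℝ} (hδ : 0 < δ) :
    ∃ θ : E n → ℝ, ContDiff ℝ ∞ θ ∧ (∀ x, |θ x| ≤ 2 * δ) ∧ (∀ x, 0 ≤ pd i θ x) ∧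
      ∀ x ∈ Metric.closedBall x₀ δ, 1 / 2 ≤ pd i θ x := by
  set ℓ : E n → ℝ := fun x => (x i - x₀ i) / δ with hℓ
  have hℓs : ContDiff ℝ ∞ ℓ := by
    have : ContDiff ℝ ∞ fun x : E n => x i := (EuclideanSpace.proj i : E n →L[ℝ] ℝ).contDiff
    exact (this.sub contDiff_const).div_const δ
  have hℓd : ∀ x, pd i ℓ x = 1 / δ := fun x => by
    have h0 := (((EuclideanSpace.proj i : E n →L[ℝ] ℝ).hasFDerivAt (x := x)).sub_const
      (x₀ i)).const_mul (1 / δ)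
    have : HasFDerivAt ℓ ((1 / δ) • (EuclideanSpace.proj i : E n →L[ℝ] ℝ)) x :=
      h0.congr_of_eventuallyEq (Eventually.of_forall fun y => by simp [hℓ]; ring)
    unfold pd; rw [this.fderiv]; simp
  have hpd : ∀ x, pd i (fun y => δ * Real.arctan (ℓ y)) x = 1 / (1 + ℓ x ^ 2) := fun x => by
    rw [pd_comp (g := fun q => δ * Real.arctan q)
      ((Real.differentiableAt_arctan _).const_mul δ) (differentiable_of_smooth hℓs x), hℓd,
      deriv_const_mul _ (Real.differentiableAt_arctan _), Real.deriv_arctan]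
    field_simp
  refine ⟨fun x => δ * Real.arctan (ℓ x), contDiff_const.mul (Real.contDiff_arctan.comp hℓs),
    fun x => ?_, fun x => ?_, fun x hx => ?_⟩
  · rw [abs_mul, abs_of_pos hδ, mul_comm]
    have h1 := Real.arctan_lt_pi_div_two (ℓ x)
    have h2 := Real.neg_pi_div_two_lt_arctan (ℓ x)
    have := Real.pi_lt_four
    gcongr
    rw [abs_le]; constructor <;> linarith
  · rw [hpd]; positivity
  · rw [hpd]
    have h1 : |x i - x₀ i| ≤ δ := by
      have h := PiLp.norm_apply_le (x - x₀) i
      rw [mem_closedBall_iff_norm] at hx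
      exact le_trans (by simpa using h) hx
    have h2 : ℓ x ^ 2 ≤ 1 := by
      rw [sq_le_one_iff_abs_le_one, hℓ, abs_div, abs_of_pos hδ, div_le_one hδ]
      exact h1
    rw [div_le_div_iff₀ (by norm_num) (by positivity)]; linarith

theorem ball_ae_eq_closedBall (x₀ : E n) {r : ℝ} (hr : r ≠ 0) :
    Metric.ball x₀ r =ᵐ[volume] Metric.closedBall x₀ r := by
  refine Metric.ball_subset_closedBall.eventuallyLE.antisymm ?_
  have h : ∀ᵐ x ∂(volume : Measure (E n)), x ∉ Metric.sphere x₀ r :=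
    measure_eq_zero_iff_ae_notMem.1 (Measure.addHaar_sphere_of_ne_zero volume x₀ hr)
  filter_upwards [h] with x hx hx'
  exact lt_of_le_of_ne hx' hx

theorem exists_forall_gradSq_le {f : E n → ℝ} (hf : ContDiff ℝ ∞ f) (hc : HasCompactSupport f) :
    ∃ M, 0 ≤ M ∧ ∀ x, gradSq f x ≤ M := by
  obtain ⟨M, hM⟩ := (HasCompactSupport.intro hc.isCompact fun x hx => by
    simp [gradSq, pd_eq_zero_of_notMem_tsupport hx] :
      HasCompactSupport (gradSq f)).exists_bound_of_continuous (continuous_gradSq hf)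
  exact ⟨M, (norm_nonneg _).trans (hM 0), fun x => (le_abs_self _).trans (hM x)⟩

/-- The energy of a map on small balls is small relative to its energy and the square integral of
its Laplacian on a fixed ball. -/
theorem exists_radius_setIntegral_gradSq_le (hn : 1 ≤ n) {r ε : ℝ} (hr : 0 < r) (hε : 0 < ε) :
    ∃ δ, 0 < δ ∧ δ ≤ r / 2 ∧ ∀ (k : ℕ) (u : E n → E k) (x₀ : E n), ContDiff ℝ ∞ u →
      ∫ x in Metric.closedBall x₀ δ, gradSq u x ≤
        ε * ((∫ x in Metric.ball x₀ r, gradSq u x) + ∫ x in Metric.ball x₀ r, ‖lap u x‖ ^ 2) := by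
  obtain ⟨η₀, hη₀, hc₀, hη0, hη1, hηone, hsupp⟩ := exists_cutoff_function (0 : E n) hr
  obtain ⟨M, hM0, hM⟩ := exists_forall_gradSq_le hη₀ hc₀
  -- The factor `4` comes from the slope `1/2` and the bound `2δ` of the slab weight; `7M = M + 6M`
  -- and `2(n+1)` come from inserting the Hessian estimate, and `2` from the undifferentiated
  -- cut-off.
  set A : ℝ := 4 * (7 * M + 2 + 2 * (n + 1)) with hA
  have hAp : 0 < A := by positivity
  refine ⟨min (r / 2) (ε / A), lt_min (by linarith) (by positivity), min_le_left _ _,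
    fun k u x₀ hu => ?_⟩
  set δ := min (r / 2) (ε / A) with hδ
  have hδp : 0 < δ := lt_min (by linarith) (by positivity)
  have hδA : δ * A ≤ ε := by
    rw [← le_div_iff₀ hAp]; exact min_le_right _ _
  -- Translating one fixed cut-off makes `M`, and with it `δ`, independent of the centre `x₀`.
  set η : E n → ℝ := fun x => η₀ (x - x₀) with hη
  have hηs : ContDiff ℝ ∞ η := hη₀.comp (contDiff_id.sub contDiff_const)
  have hηz : ∀ x, x ∉ Metric.ball x₀ r → η x = 0 := fun x hx => by
    have : x - x₀ ∉ Function.support η₀ := by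
      rw [hsupp, mem_ball_zero_iff]; rwa [mem_ball_iff_norm] at hx
    simpa using this
  have hηc : HasCompactSupport η :=
    HasCompactSupport.intro (isCompact_closedBall x₀ r) fun x hx =>
      hηz x fun h => hx (Metric.ball_subset_closedBall h)
  have hgη : ∀ x, gradSq η x ≤ M := fun x => by
    have : gradSq η x = gradSq η₀ (x - x₀) := by
      simp only [gradSq, pd, hη, fderiv_comp_sub]
    rw [this]; exact hM _
  obtain ⟨θ, hθs, hθb, hθ0, hθ1⟩ := exists_slab_weight (⟨0, hn⟩ : Fin n) x₀ hδp
  have h1 := integral_sq_mul_hessSq_le hu hηs hηc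
  have h2 := integral_weight_mul_gradSq_le (i := ⟨0, hn⟩) hu hηs hηc hθs hθb
  have hgc := continuous_gradSq hu
  have hlc : Continuous fun x => ‖lap u x‖ ^ 2 := (contDiff_lap hu).continuous.norm.pow 2
  have hib : ∀ {f : E n → ℝ}, Continuous f → IntegrableOn f (Metric.ball x₀ r) := fun hf =>
    (hf.continuousOn.integrableOn_compact (isCompact_closedBall x₀ r)).mono_set
      Metric.ball_subset_closedBall
  have hball : ∀ {f g : E n → ℝ} {c : ℝ}, 0 ≤ c → Continuous f → (∀ x, 0 ≤ f x) → Continuous g →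
      (∀ x, g x ≤ c) → (∀ x, 0 ≤ g x) → (∀ x, x ∉ Metric.closedBall x₀ r → g x = 0) →
      ∫ x, g x * f x ≤ c * ∫ x in Metric.ball x₀ r, f x := by
    intro f g c hc0 hf hf0 hg hgc hg0 hgz
    have e : ∫ x, g x * f x = ∫ x in Metric.closedBall x₀ r, g x * f x := by
      symm
      exact setIntegral_eq_integral_of_forall_compl_eq_zero fun x hx => by simp [hgz x hx]
    rw [e, ← integral_const_mul, setIntegral_congr_set
      (ball_ae_eq_closedBall x₀ hr.ne').symm]
    exact setIntegral_mono_on (hib (hg.mul hf)) (hib (continuous_const.mul hf))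
      Metric.isOpen_ball.measurableSet fun x _ => by gcongr; exacts [hf0 x, hgc x]
  have hsq1 : ∀ x, η x ^ 2 ≤ 1 := fun x => pow_le_one₀ (hη0 _) (hη1 _)
  have hz2 : ∀ x, x ∉ Metric.closedBall x₀ r → η x ^ 2 = 0 := fun x hx => by
    simp [hηz x fun h => hx (Metric.ball_subset_closedBall h)]
  have hz3 : ∀ x, x ∉ Metric.closedBall x₀ r → gradSq η x = 0 := fun x hx => by
    have : x ∉ tsupport η := fun h => hx (closure_minimal (fun y hy => by
      by_contra h'
      exact hy (hηz y fun h'' => h' (Metric.ball_subset_closedBall h''))) Metric.isClosed_closedBall h)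
    simp [gradSq, pd_eq_zero_of_notMem_tsupport this]
  have g1 := hball hM0 hgc (gradSq_nonneg u) (continuous_gradSq hηs) hgη (gradSq_nonneg η) hz3
  have g2 := hball (g := fun x => η x ^ 2) zero_le_one hgc (gradSq_nonneg u) (hηs.continuous.pow 2) hsq1
    (fun x => sq_nonneg _) hz2
  have g3 := hball (g := fun x => η x ^ 2) zero_le_one hlc (fun x => sq_nonneg _) (hηs.continuous.pow 2) hsq1
    (fun x => sq_nonneg _) hz2
  have hlow : ∫ x in Metric.closedBall x₀ δ, gradSq u x
      ≤ 2 * ∫ x, pd ⟨0, hn⟩ θ x * (η x ^ 2 * gradSq u x) := by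
    have i0 : Integrable fun x => pd ⟨0, hn⟩ θ x * (η x ^ 2 * gradSq u x) :=
      integrable_of_eq_zero_off hηc ((contDiff_pd hθs _).continuous.mul
        ((hηs.continuous.pow 2).mul hgc)) fun x hx => by
        simp [image_eq_zero_of_notMem_tsupport hx]
    have : ∫ x in Metric.closedBall x₀ δ, gradSq u x
        ≤ ∫ x in Metric.closedBall x₀ δ, 2 * (pd ⟨0, hn⟩ θ x * (η x ^ 2 * gradSq u x)) := by
      refine setIntegral_mono_on (hgc.continuousOn.integrableOn_compact (isCompact_closedBall _ _))
        (i0.const_mul 2).integrableOn Metric.isClosed_closedBall.measurableSet fun x hx => ?_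
      have e1 : η x = 1 := hηone _ (by
        rw [mem_closedBall_iff_norm] at hx
        rw [mem_closedBall_zero_iff]
        exact hx.trans (min_le_left _ _))
      have e2 := hθ1 x hx
      have := gradSq_nonneg u x
      rw [e1]; nlinarith
    refine this.trans ?_
    rw [← integral_const_mul]
    refine setIntegral_le_integral (i0.const_mul 2) (Eventually.of_forall fun x => ?_)
    have := gradSq_nonneg u x
    have := hθ0 x
    simp only [Pi.zero_apply]; positivity
  set P := ∫ x in Metric.ball x₀ r, gradSq u x with hP
  set Q := ∫ x in Metric.ball x₀ r, ‖lap u x‖ ^ 2 with hQ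
  have hP0 : 0 ≤ P := integral_nonneg fun x => gradSq_nonneg u x
  have hQ0 : 0 ≤ Q := integral_nonneg fun x => by positivity
  have hn0 : (0 : ℝ) ≤ n := by positivity
  have h3 : ∫ x, η x ^ 2 * hessSq u x ≤ 2 * (n + 1) * Q + 6 * (M * P) := by
    refine h1.trans ?_
    gcongr
    simpa using g3
  have hMP : 0 ≤ M * P := by positivity
  have hMQ : 0 ≤ M * Q := by positivity
  have hnP : 0 ≤ n * P := by positivity
  have h4 : ∫ x in Metric.closedBall x₀ δ, gradSq u x ≤ δ * A * (P + Q) := by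
    calc _ ≤ 2 * (2 * δ * (M * P + 2 * (1 * P) + (2 * (n + 1) * Q + 6 * (M * P)))) := by
          refine hlow.trans ?_
          gcongr
          refine h2.trans ?_
          gcongr
      _ = 4 * δ * (7 * (M * P) + 2 * P + 2 * (n + 1) * Q) := by ring
      _ ≤ 4 * δ * (7 * (M * P) + 2 * P + 2 * (n + 1) * Q
            + (7 * (M * Q) + 2 * Q + 2 * (n * P) + 2 * P)) :=
          mul_le_mul_of_nonneg_left (by linarith) (by positivity)
      _ = _ := by rw [hA]; ring
  exact h4.trans (by gcongr)

end InteriorEstimate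

/-! ### Space-time derivatives up to the initial time -/

section Strip

variable {n : ℕ} {F : Type*} [NormedAddCommGroup F] [NormedSpace ℝ F] {T : ℝ}

/-- The space-time strip `ℝⁿ × [0,T)`. -/
abbrev strip (n : ℕ) (T : ℝ) : Set (E n × ℝ) := univ ×ˢ Ico 0 T

theorem uniqueDiffOn_strip : UniqueDiffOn ℝ (strip n T) :=
  uniqueDiffOn_univ.prod (uniqueDiffOn_Ico 0 T)

theorem strip_mem_nhds {x : E n} {t : ℝ} (ht : t ∈ Ioo 0 T) : strip n T ∈ 𝓝 (x, t) :=
  prod_mem_nhds univ_mem (Ico_mem_nhds ht.1 ht.2)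

/-- The derivative in a fixed space-time direction, one-sided at the initial time. -/
def stripDeriv (T : ℝ) (w : E n × ℝ) (V : E n × ℝ → F) (p : E n × ℝ) : F :=
  fderivWithin ℝ V (strip n T) p w

theorem contDiffOn_stripDeriv {V : E n × ℝ → F} (hV : ContDiffOn ℝ ∞ V (strip n T))
    (w : E n × ℝ) : ContDiffOn ℝ ∞ (stripDeriv T w V) (strip n T) :=
  (hV.fderivWithin uniqueDiffOn_strip (by simp)).clm_apply contDiffOn_const

theorem stripDeriv_congr {V W : E n × ℝ → F} (h : EqOn V W (strip n T)) {p : E n × ℝ}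
    (hp : p ∈ strip n T) (w : E n × ℝ) : stripDeriv T w V p = stripDeriv T w W p := by
  unfold stripDeriv
  rw [fderivWithin_congr h (h hp)]

theorem stripDeriv_sum {ι : Type*} (s : Finset ι) {V : ι → E n × ℝ → F}
    (hV : ∀ i ∈ s, ContDiffOn ℝ ∞ (V i) (strip n T)) {p : E n × ℝ} (hp : p ∈ strip n T)
    (w : E n × ℝ) : stripDeriv T w (fun q => ∑ i ∈ s, V i q) p = ∑ i ∈ s, stripDeriv T w (V i) p := by
  unfold stripDeriv
  rw [fderivWithin_fun_sum (uniqueDiffOn_strip p hp)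
    fun i hi => (hV i hi).differentiableOn (by simp) p hp]
  simp

/-- Symmetry of the second derivative persists at the initial time because the strip lies in the
closure of its interior. -/
theorem stripDeriv_comm {V : E n × ℝ → F} (hV : ContDiffOn ℝ ∞ V (strip n T)) {p : E n × ℝ}
    (hp : p ∈ strip n T) (w w' : E n × ℝ) :
    stripDeriv T w (stripDeriv T w' V) p = stripDeriv T w' (stripDeriv T w V) p := by
  have hd : DifferentiableWithinAt ℝ (fderivWithin ℝ V (strip n T)) (strip n T) p :=
    (hV.fderivWithin (m := ∞) uniqueDiffOn_strip (by simp)).differentiableOn (by simp) p hp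
  have hu := uniqueDiffOn_strip p hp
  have e : ∀ w w' : E n × ℝ, stripDeriv T w (stripDeriv T w' V) p
      = fderivWithin ℝ (fderivWithin ℝ V (strip n T)) (strip n T) p w w' := fun w w' => by
    unfold stripDeriv
    rw [fderivWithin_clm_apply hu hd (differentiableWithinAt_const _)]
    simp
  rw [e, e]
  have hcl : p ∈ closure (interior (strip n T)) := by
    have hT : 0 < T := hp.2.1.trans_lt hp.2.2
    rw [interior_prod_eq, interior_univ, interior_Ico, closure_prod_eq, closure_univ,
      closure_Ioo hT.ne]
    exact ⟨mem_univ _, Ico_subset_Icc_self hp.2⟩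
  exact ((hV p hp).isSymmSndFDerivWithinAt (by simpa using two_le_infty) uniqueDiffOn_strip hcl hp).eq _ _

theorem hasFDerivAt_slice {V : E n × ℝ → F} (hV : ContDiffOn ℝ ∞ V (strip n T)) (x : E n) {t : ℝ}
    (ht : t ∈ Ico 0 T) : HasFDerivAt (fun y => V (y, t))
      ((fderivWithin ℝ V (strip n T) (x, t)).comp (ContinuousLinearMap.inl ℝ (E n) ℝ)) x := by
  have h := (hV.differentiableOn (by simp) (x, t) ⟨mem_univ _, ht⟩).hasFDerivWithinAt
  have h1 : HasFDerivWithinAt (fun y : E n => (y, t)) (ContinuousLinearMap.inl ℝ (E n) ℝ) univ x :=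
    (hasFDerivAt_prodMk_left x t).hasFDerivWithinAt
  have hm : MapsTo (fun y : E n => (y, t)) univ (strip n T) := fun y _ => ⟨mem_univ _, ht⟩
  have h2 := h.comp x h1 hm
  exact hasFDerivWithinAt_univ.1 h2

theorem pd_slice {V : E n × ℝ → F} (hV : ContDiffOn ℝ ∞ V (strip n T)) (x : E n) {t : ℝ}
    (ht : t ∈ Ico 0 T) (j : Fin n) :
    pd j (fun y => V (y, t)) x = stripDeriv T (EuclideanSpace.single j 1, 0) V (x, t) := by
  unfold pd stripDeriv
  rw [(hasFDerivAt_slice hV x ht).fderiv]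
  simp

theorem contDiff_slice {V : E n × ℝ → F} (hV : ContDiffOn ℝ ∞ V (strip n T)) {t : ℝ}
    (ht : t ∈ Ico 0 T) : ContDiff ℝ ∞ fun y => V (y, t) := by
  rw [← contDiffOn_univ]
  exact hV.comp (by fun_prop : ContDiff ℝ ∞ fun y : E n => (y, t)).contDiffOn
    fun y _ => ⟨mem_univ _, ht⟩

theorem contDiffOn_pd_slice {V : E n × ℝ → F} (hV : ContDiffOn ℝ ∞ V (strip n T)) (j : Fin n) :
    ContDiffOn ℝ ∞ (fun p => pd j (fun y => V (y, p.2)) p.1) (strip n T) :=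
  (contDiffOn_stripDeriv hV _).congr fun p hp => pd_slice hV p.1 hp.2 j

theorem lap_slice {V : E n × ℝ → F} (hV : ContDiffOn ℝ ∞ V (strip n T)) (x : E n) {t : ℝ}
    (ht : t ∈ Ico 0 T) : lap (fun y => V (y, t)) x
      = ∑ j : Fin n, stripDeriv T (EuclideanSpace.single j 1, 0)
          (stripDeriv T (EuclideanSpace.single j 1, 0) V) (x, t) := by
  rw [lap_eq_sum_pd ((contDiff_slice hV ht).contDiffAt.of_le two_le_infty)]
  refine Finset.sum_congr rfl fun j _ => ?_
  rw [← pd_slice (contDiffOn_stripDeriv hV _) x ht]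
  congr 1
  funext y
  exact pd_slice hV y ht j

theorem contDiffOn_lap_slice {V : E n × ℝ → F} (hV : ContDiffOn ℝ ∞ V (strip n T)) :
    ContDiffOn ℝ ∞ (fun p => lap (fun y => V (y, p.2)) p.1) (strip n T) := by
  have : ContDiffOn ℝ ∞ (fun p => ∑ j : Fin n, stripDeriv T (EuclideanSpace.single j 1, 0)
      (stripDeriv T (EuclideanSpace.single j 1, 0) V) p) (strip n T) :=
    ContDiffOn.sum fun j _ => contDiffOn_stripDeriv (contDiffOn_stripDeriv hV _) _
  exact this.congr fun p hp => lap_slice hV p.1 hp.2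

theorem continuousOn_gradSq_slice {V : E n × ℝ → F} (hV : ContDiffOn ℝ ∞ V (strip n T)) :
    ContinuousOn (fun p : E n × ℝ => gradSq (fun y => V (y, p.2)) p.1) (strip n T) := by
  unfold gradSq
  exact continuousOn_finsetSum _ fun j _ => (contDiffOn_pd_slice hV j).continuousOn.norm.pow 2

/-- The time derivative, one-sided at the initial time. -/
def timeDeriv (T : ℝ) (V : E n × ℝ → F) : E n × ℝ → F := stripDeriv T (0, 1) V

theorem hasDerivAt_timeDeriv {V : E n × ℝ → F} (hV : ContDiffOn ℝ ∞ V (strip n T)) (x : E n)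
    {t : ℝ} (ht : t ∈ Ioo 0 T) : HasDerivAt (fun s => V (x, s)) (timeDeriv T V (x, t)) t := by
  have hmem : (x, t) ∈ strip n T := ⟨mem_univ _, ht.1.le, ht.2⟩
  have h := ((hV.differentiableOn (by simp) (x, t) hmem).hasFDerivWithinAt).hasFDerivAt
    (strip_mem_nhds ht)
  have h2 := (h.comp t (hasFDerivAt_prodMk_right x t)).hasDerivAt
  simpa [timeDeriv, stripDeriv, Function.comp_def] using h2

theorem timeDeriv_lap_slice {V : E n × ℝ → F} (hV : ContDiffOn ℝ ∞ V (strip n T)) (x : E n)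
    {t : ℝ} (ht : t ∈ Ico 0 T) :
    timeDeriv T (fun p => lap (fun y => V (y, p.2)) p.1) (x, t)
      = lap (fun y => timeDeriv T V (y, t)) x := by
  have hx : (x, t) ∈ strip n T := ⟨mem_univ _, ht⟩
  have hs := fun w => contDiffOn_stripDeriv hV w
  have e : EqOn (fun p : E n × ℝ => lap (fun y => V (y, p.2)) p.1)
      (fun p => ∑ j : Fin n, stripDeriv T (EuclideanSpace.single j 1, 0)
        (stripDeriv T (EuclideanSpace.single j 1, 0) V) p) (strip n T) :=
    fun p hp => lap_slice hV p.1 hp.2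
  unfold timeDeriv
  rw [stripDeriv_congr e hx, lap_slice (hs _) x ht,
    stripDeriv_sum _ (fun j _ => contDiffOn_stripDeriv (hs _) _) hx]
  refine Finset.sum_congr rfl fun j _ => ?_
  rw [stripDeriv_comm (hs _) hx]
  exact stripDeriv_congr (fun q hq => stripDeriv_comm hV hq _ _) hx _

end Strip

/-! ### The fundamental theorem of calculus for integrals over time slices -/

section StripIntegral

variable {n : ℕ} {T : ℝ}

theorem integrableOn_strip {f : E n × ℝ → ℝ} (hf : ContinuousOn f (strip n T)) {K : Set (E n)}
    (hK : IsCompact K) {a b : ℝ} (ha : 0 ≤ a) (hb : b < T) : IntegrableOn f (K ×ˢ Icc a b) :=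
  (hf.mono (prod_mono (subset_univ _) fun _ hs => ⟨ha.trans hs.1, hs.2.trans_lt hb⟩)
    ).integrableOn_compact (hK.prod isCompact_Icc)

theorem continuousOn_slice {F : Type*} [TopologicalSpace F] {f : E n × ℝ → F} (hf : ContinuousOn f (strip n T)) {t : ℝ}
    (ht : t ∈ Ico 0 T) : Continuous fun x => f (x, t) :=
  continuousOn_univ.1 (hf.comp (by fun_prop : Continuous fun y : E n => (y, t)).continuousOn
    fun y _ => ⟨mem_univ _, ht⟩)

theorem continuousOn_time_slice {f : E n × ℝ → ℝ} (hf : ContinuousOn f (strip n T)) (x : E n) :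
    ContinuousOn (fun t => f (x, t)) (Ico 0 T) :=
  hf.comp (by fun_prop : Continuous fun t : ℝ => (x, t)).continuousOn fun _ ht => ⟨mem_univ _, ht⟩

/-- Pointwise fundamental theorem of calculus, then Fubini on a compact set. Differentiability is
only asked at positive times; continuity covers the initial time. -/
theorem setIntegral_sub_eq_integral_timeDeriv {g g' : E n × ℝ → ℝ}
    (hg : ContinuousOn g (strip n T)) (hg' : ContinuousOn g' (strip n T))
    (hd : ∀ x, ∀ t ∈ Ioo 0 T, HasDerivAt (fun s => g (x, s)) (g' (x, t)) t)
    {K : Set (E n)} (hK : IsCompact K) {t : ℝ} (ht : t ∈ Ico 0 T) :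
    (∫ x in K, g (x, t)) - ∫ x in K, g (x, 0) = ∫ s in Ioc 0 t, ∫ x in K, g' (x, s) := by
  have h0 : (0 : ℝ) ∈ Ico 0 T := ⟨le_rfl, ht.1.trans_lt ht.2⟩
  have hsub : Icc 0 t ⊆ Ico 0 T := fun s hs => ⟨hs.1, hs.2.trans_lt ht.2⟩
  have hint : IntegrableOn g' (K ×ˢ Ioc 0 t) :=
    (integrableOn_strip hg' hK le_rfl ht.2).mono_set (prod_mono Subset.rfl Ioc_subset_Icc_self)
  have hswap : ∫ s in Ioc 0 t, ∫ x in K, g' (x, s) = ∫ x in K, ∫ s in Ioc 0 t, g' (x, s) := by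
    rw [IntegrableOn, Measure.volume_eq_prod, ← Measure.prod_restrict] at hint
    exact (integral_integral_swap (f := fun x s => g' (x, s)) hint).symm
  rw [hswap, ← integral_sub]
  · refine integral_congr_ae (Eventually.of_forall fun x => ?_)
    simp only
    rw [← intervalIntegral.integral_of_le ht.1]
    symm
    refine intervalIntegral.integral_eq_sub_of_hasDerivAt_of_le ht.1
      ((continuousOn_time_slice hg x).mono hsub)
      (fun s hs => hd x s ⟨hs.1, hs.2.trans ht.2⟩) ?_
    refine ContinuousOn.intervalIntegrable ?_
    rw [uIcc_of_le ht.1]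
    exact (continuousOn_time_slice hg' x).mono hsub
  · exact (continuousOn_slice hg ht).continuousOn.integrableOn_compact hK
  · exact (continuousOn_slice hg h0).continuousOn.integrableOn_compact hK

end StripIntegral

/-! ### Slow cut-off functions and the localized energy identity -/

section Energy

variable {n : ℕ}

theorem lap_fun_smul {F : Type*} [NormedAddCommGroup F] [NormedSpace ℝ F] {c : E n → ℝ} {v : E n → F}
    (hc : ContDiff ℝ ∞ c) (hv : ContDiff ℝ ∞ v) (x : E n) :
    lap (fun y => c y • v y) x
      = c x • lap v x + (∑ j, (2 * pd j c x) • pd j v x) + lap c x • v x := by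
  have hcv : ContDiff ℝ ∞ fun y => c y • v y := hc.smul hv
  rw [lap_eq_sum_pd (hcv.contDiffAt.of_le two_le_infty),
    lap_eq_sum_pd (hc.contDiffAt.of_le two_le_infty), lap_eq_sum_pd (hv.contDiffAt.of_le two_le_infty),
    Finset.smul_sum, Finset.sum_smul, ← Finset.sum_add_distrib, ← Finset.sum_add_distrib]
  refine Finset.sum_congr rfl fun j _ => ?_
  have e : pd j (fun y => c y • v y) = fun y => pd j c y • v y + c y • pd j v y :=
    funext fun y => pd_smul (differentiable_of_smooth hc y) (differentiable_of_smooth hv y) j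
  have e2 : pd j (fun y => pd j c y • v y + c y • pd j v y) x
      = pd j (fun y => pd j c y • v y) x + pd j (fun y => c y • pd j v y) x := by
    unfold pd
    rw [fderiv_fun_add]
    · simp
    · exact differentiable_of_smooth ((contDiff_pd hc j).smul hv) x
    · exact differentiable_of_smooth (hc.smul (contDiff_pd hv j)) x
  rw [e, e2, pd_smul (differentiable_of_smooth (contDiff_pd hc j) x) (differentiable_of_smooth hv x),
    pd_smul (differentiable_of_smooth hc x) (differentiable_of_smooth (contDiff_pd hv j) x)]
  module

theorem lap_eq_zero_of_notMem_tsupport {η : E n → ℝ} (hη : ContDiff ℝ ∞ η) {x : E n}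
    (h : x ∉ tsupport η) : lap η x = 0 := by
  rw [lap_eq_sum_pd (hη.contDiffAt.of_le two_le_infty)]
  refine Finset.sum_eq_zero fun j _ => pd_eq_zero_of_notMem_tsupport (fun h' => h ?_) j
  exact closure_minimal (fun y hy => by
    by_contra h''
    exact hy (pd_eq_zero_of_notMem_tsupport h'' j)) (isClosed_tsupport η) h'

theorem pd_comp_smul_sub {F : Type*} [NormedAddCommGroup F] [NormedSpace ℝ F] {f : E n → F}
    (hf : Differentiable ℝ f) (l : ℝ) (x₀ x : E n) (j : Fin n) :
    pd j (fun y => f (l • (y - x₀))) x = l • pd j f (l • (x - x₀)) := by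
  have h : HasFDerivAt (fun y : E n => l • (y - x₀)) (l • ContinuousLinearMap.id ℝ (E n)) x :=
    ((hasFDerivAt_id x).sub_const x₀).const_smul l
  have h2 := (hf (l • (x - x₀))).hasFDerivAt.comp x h
  unfold pd
  have h3 := h2.fderiv
  simp only [Function.comp_def] at h3
  rw [h3]; simp

/-- Cut-off functions which vary arbitrarily slowly. -/
theorem exists_slow_cutoff (x₀ : E n) (r : ℝ) {c : ℝ} (hc : 0 < c) :
    ∃ χ : E n → ℝ, ContDiff ℝ ∞ χ ∧ HasCompactSupport χ ∧ (∀ x, 0 ≤ χ x) ∧ (∀ x, χ x ≤ 1) ∧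
      (∀ x ∈ Metric.closedBall x₀ r, χ x = 1) ∧ (∀ x, gradSq χ x ≤ c * χ x) ∧
      ∀ x, lap χ x ^ 2 ≤ c * χ x := by
  obtain ⟨ψ, hψ, hψc, hψ0, hψ1, hψone, hψs⟩ := exists_cutoff_function (0 : E n) (r := 2) two_pos
  obtain ⟨M, hM0, hM⟩ := exists_forall_gradSq_le hψ hψc
  have hlc : HasCompactSupport (lap ψ) := HasCompactSupport.intro hψc.isCompact fun x hx =>
    lap_eq_zero_of_notMem_tsupport hψ hx
  obtain ⟨M₂, hM₂⟩ := hlc.exists_bound_of_continuous (contDiff_lap hψ).continuous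
  set A : ℝ := 16 * M + 2 * (144 * M ^ 2 + 16 * M₂ ^ 2) + 1 with hA
  have hAp : 0 < A := by positivity
  -- In the fourth power, `|∇f|²` carries the factor `ψ⁶` and both terms of `(Δf)²` carry at least
  -- `ψ⁴`, so both quantities are bounded by a multiple of `f`.
  set f : E n → ℝ := fun y => ψ y ^ 4 with hf
  have hfs : ContDiff ℝ ∞ f := hψ.pow 4
  have hpdf : ∀ j y, pd j f y = 4 * ψ y ^ 3 * pd j ψ y := fun j y => by
    have := pd_comp (g := fun q : ℝ => q ^ 4) (q := ψ) (x := y) (by fun_prop)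
      (differentiable_of_smooth hψ y) j
    simpa [hf] using this
  have hψ4 : ∀ y, ψ y ^ 6 ≤ ψ y ^ 4 := fun y =>
    pow_le_pow_of_le_one (hψ0 y) (hψ1 y) (by norm_num)
  have hgf : ∀ y, gradSq f y ≤ A * f y := fun y => by
    have e : gradSq f y = 16 * ψ y ^ 6 * gradSq ψ y := by
      simp only [gradSq, hpdf, Real.norm_eq_abs, sq_abs, Finset.mul_sum]
      exact Finset.sum_congr rfl fun j _ => by ring
    have h4 : 0 ≤ ψ y ^ 4 := by positivity
    calc gradSq f y ≤ 16 * ψ y ^ 4 * M := by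
          rw [e]
          have := hM y
          have := hψ4 y
          have := gradSq_nonneg ψ y
          gcongr
      _ ≤ A * f y := by
          have : 0 ≤ (2 * (144 * M ^ 2 + 16 * M₂ ^ 2) + 1) * ψ y ^ 4 := by positivity
          simp only [hf, hA]; linarith
  have hlf : ∀ y, lap f y ^ 2 ≤ A * f y := fun y => by
    have e : lap f y = 12 * ψ y ^ 2 * gradSq ψ y + 4 * ψ y ^ 3 * lap ψ y := by
      rw [lap_eq_sum_pd (hfs.contDiffAt.of_le two_le_infty),
        lap_eq_sum_pd (hψ.contDiffAt.of_le two_le_infty), gradSq, Finset.mul_sum, Finset.mul_sum,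
        ← Finset.sum_add_distrib]
      refine Finset.sum_congr rfl fun j _ => ?_
      have e1 : pd j f = fun y => 4 * ψ y ^ 3 * pd j ψ y := funext (hpdf j)
      have e2 := pd_comp (g := fun q : ℝ => 4 * q ^ 3) (q := ψ) (x := y) (by fun_prop)
        (differentiable_of_smooth hψ y) j
      have e3 : deriv (fun q : ℝ => 4 * q ^ 3) (ψ y) = 12 * ψ y ^ 2 := by
        simp; ring
      have hd3 : DifferentiableAt ℝ (fun y => 4 * ψ y ^ 3) y :=
        ((differentiable_of_smooth hψ y).pow 3).const_mul 4
      rw [e1, pd_mul hd3 (differentiable_of_smooth (contDiff_pd hψ j) y), e2, e3, Real.norm_eq_abs, sq_abs]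
      ring
    have h1 := hM y
    have h2 : lap ψ y ^ 2 ≤ M₂ ^ 2 := by
      rw [← sq_abs]; gcongr; exact hM₂ y
    have h3 := gradSq_nonneg ψ y
    have h4 : gradSq ψ y ^ 2 ≤ M ^ 2 := by gcongr
    have h5 := hψ4 y
    have h6 : 0 ≤ ψ y ^ 4 := by positivity
    calc lap f y ^ 2 ≤ 2 * ((12 * ψ y ^ 2 * gradSq ψ y) ^ 2 + (4 * ψ y ^ 3 * lap ψ y) ^ 2) := by
          rw [e]
          nlinarith [sq_nonneg (12 * ψ y ^ 2 * gradSq ψ y - 4 * ψ y ^ 3 * lap ψ y)]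
      _ = 2 * (144 * (ψ y ^ 4 * gradSq ψ y ^ 2) + 16 * (ψ y ^ 6 * lap ψ y ^ 2)) := by ring
      _ ≤ 2 * (144 * (ψ y ^ 4 * M ^ 2) + 16 * (ψ y ^ 4 * M₂ ^ 2)) := by gcongr
      _ ≤ A * f y := by
          have : 0 ≤ (16 * M + 1) * ψ y ^ 4 := by positivity
          simp only [hf, hA]; linarith
  -- Scaling by `l` multiplies `|∇f|²` by `l²` and `(Δf)²` by `l⁴`; with `l ≤ 1` and `lA ≤ c` both
  -- bounds follow. The last entry maps the ball of radius `r` into the unit ball, where `ψ = 1`.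
  set l : ℝ := min (min 1 (c / A)) (1 / (|r| + 1)) with hl
  have hlp : 0 < l := by positivity
  have hl1 : l ≤ 1 := (min_le_left _ _).trans (min_le_left _ _)
  have hlA : l * A ≤ c := by
    rw [← le_div_iff₀ hAp]; exact (min_le_left _ _).trans (min_le_right _ _)
  have hlr : l * (|r| + 1) ≤ 1 := by
    rw [← le_div_iff₀ (by positivity)]; exact min_le_right _ _
  set χ : E n → ℝ := fun x => f (l • (x - x₀)) with hχ
  have hχs : ContDiff ℝ ∞ χ := hfs.comp (by fun_prop : ContDiff ℝ ∞ fun x : E n => l • (x - x₀))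
  have hf0 : ∀ y, 0 ≤ f y := fun y => by positivity
  have hpd : ∀ j, pd j χ = fun x => l • pd j f (l • (x - x₀)) := fun j =>
    funext fun x => pd_comp_smul_sub (differentiable_of_smooth hfs) l x₀ x j
  refine ⟨χ, hχs, ?_, fun x => hf0 _, fun x => pow_le_one₀ (hψ0 _) (hψ1 _), fun x hx => ?_,
    fun x => ?_, fun x => ?_⟩
  · refine HasCompactSupport.intro (isCompact_closedBall x₀ (2 / l)) fun x hx => ?_
    have : l • (x - x₀) ∉ Function.support ψ := by
      rw [hψs, mem_ball_zero_iff, norm_smul, Real.norm_eq_abs, abs_of_pos hlp, not_lt, ← div_le_iff₀' hlp]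
      rw [mem_closedBall_iff_norm, not_le] at hx
      exact hx.le
    simp only [Function.mem_support, not_not] at this
    simp [hχ, hf, this]
  · have : ψ (l • (x - x₀)) = 1 := hψone _ (by
      rw [mem_closedBall_zero_iff, norm_smul, Real.norm_eq_abs, abs_of_pos hlp]
      rw [mem_closedBall_iff_norm] at hx
      have h1 : ‖x - x₀‖ ≤ |r| + 1 := hx.trans ((le_abs_self r).trans (by linarith))
      have h2 : l * ‖x - x₀‖ ≤ l * (|r| + 1) := by gcongr
      linarith)
    simp [hχ, hf, this]
  · have e : gradSq χ x = l ^ 2 * gradSq f (l • (x - x₀)) := by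
      simp only [gradSq, hpd, Finset.mul_sum, norm_smul, Real.norm_eq_abs, mul_pow, sq_abs]
    rw [e]
    calc l ^ 2 * gradSq f (l • (x - x₀)) ≤ (l * 1) * (A * f (l • (x - x₀))) := by
          rw [sq]
          have := hgf (l • (x - x₀))
          have := gradSq_nonneg f (l • (x - x₀))
          gcongr
      _ = l * A * χ x := by simp only [hχ]; ring
      _ ≤ c * χ x := by have := hf0 (l • (x - x₀)); gcongr
  · have e : lap χ x = l ^ 2 * lap f (l • (x - x₀)) := by
      rw [lap_eq_sum_pd (hχs.contDiffAt.of_le two_le_infty),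
        lap_eq_sum_pd (hfs.contDiffAt.of_le two_le_infty), Finset.mul_sum]
      refine Finset.sum_congr rfl fun j _ => ?_
      have hdf := differentiable_of_smooth (contDiff_pd hfs j)
      have e1 : DifferentiableAt ℝ (fun x => pd j f (l • (x - x₀))) x :=
        (hdf (l • (x - x₀))).comp (f := fun x : E n => l • (x - x₀)) x (by fun_prop)
      rw [hpd, pd_smul (c := fun _ => l) (by fun_prop) e1, pd_comp_smul_sub hdf]
      simp [pd]; ring
    rw [e]
    have h3 : l ^ 3 ≤ 1 := pow_le_one₀ hlp.le hl1
    calc (l ^ 2 * lap f (l • (x - x₀))) ^ 2 = l * l ^ 3 * lap f (l • (x - x₀)) ^ 2 := by ring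
      _ ≤ l * 1 * (A * f (l • (x - x₀))) := by
          have := hlf (l • (x - x₀))
          gcongr
      _ = l * A * χ x := by simp only [hχ]; ring
      _ ≤ c * χ x := by have := hf0 (l • (x - x₀)); gcongr

theorem two_mul_inner_le_of_pos {G : Type*} [NormedAddCommGroup G] [InnerProductSpace ℝ G]
    {μ : ℝ} (hμ : 0 < μ) (b : ℝ) (v w : G) :
    2 * (b * ⟪v, w⟫_ℝ) ≤ μ * ‖v‖ ^ 2 + b ^ 2 / μ * ‖w‖ ^ 2 := by
  have hs := Real.sqrt_pos.2 hμ
  have h := (abs_le.1 (two_mul_inner_le (Real.sqrt μ) (b / Real.sqrt μ) v w)).2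
  rw [div_pow, Real.sq_sqrt hμ.le] at h
  have e : Real.sqrt μ * (b / Real.sqrt μ) = b := by field_simp
  rwa [e] at h

/-- The product rule gives the main term `-2χ|w|²`. Each of the two error terms is split by Young's
inequality so that it costs `χ|w|²/2`; the conditions on `χ` are what turns `|∇χ|²` and `(Δχ)²` into
`χ`. -/
theorem inner_lap_cutoff_le {k : ℕ} {χ : E n → ℝ} {v : E n → E k} {w : E k} {x : E n} {c : ℝ}
    (hχ : ContDiff ℝ ∞ χ) (hv : ContDiff ℝ ∞ v) (hc : 0 < c) (h1 : gradSq χ x ≤ c * χ x)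
    (h2 : lap χ x ^ 2 ≤ c * χ x) (hw : ⟪lap v x, w⟫_ℝ = -‖w‖ ^ 2) :
    2 * ⟪lap (fun y => χ y • v y) x, w⟫_ℝ
      ≤ -(χ x * ‖w‖ ^ 2) + 8 * c * (gradSq v x + ‖v x‖ ^ 2) := by
  rw [lap_fun_smul hχ hv, inner_add_left, inner_add_left, sum_inner, real_inner_smul_left,
    real_inner_smul_left, hw]
  simp_rw [real_inner_smul_left]
  have b1 : 2 * (∑ j, 2 * pd j χ x * ⟪pd j v x, w⟫_ℝ)
      ≤ 8 * c * gradSq v x + χ x / 2 * ‖w‖ ^ 2 := by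
    have e : ∀ j, 2 * (2 * pd j χ x * ⟪pd j v x, w⟫_ℝ)
        ≤ 8 * c * ‖pd j v x‖ ^ 2 + ‖pd j χ x‖ ^ 2 * (1 / (2 * c) * ‖w‖ ^ 2) := fun j => by
      refine (two_mul_inner_le_of_pos (by positivity : 0 < 8 * c) (2 * pd j χ x) (pd j v x)
        w).trans (le_of_eq ?_)
      rw [Real.norm_eq_abs, sq_abs]
      field_simp
      ring
    rw [Finset.mul_sum]
    refine (Finset.sum_le_sum fun j _ => e j).trans ?_
    rw [Finset.sum_add_distrib, ← Finset.mul_sum, ← Finset.sum_mul]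
    change 8 * c * gradSq v x + gradSq χ x * _ ≤ _
    have : gradSq χ x * (1 / (2 * c) * ‖w‖ ^ 2) ≤ c * χ x * (1 / (2 * c) * ‖w‖ ^ 2) := by gcongr
    have e2 : c * χ x * (1 / (2 * c) * ‖w‖ ^ 2) = χ x / 2 * ‖w‖ ^ 2 := by field_simp
    linarith
  have b2 : 2 * (lap χ x * ⟪v x, w⟫_ℝ) ≤ 2 * c * ‖v x‖ ^ 2 + χ x / 2 * ‖w‖ ^ 2 := by
    refine (two_mul_inner_le_of_pos (by positivity : 0 < 2 * c) (lap χ x) (v x) w).trans ?_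
    have : lap χ x ^ 2 / (2 * c) * ‖w‖ ^ 2 ≤ c * χ x / (2 * c) * ‖w‖ ^ 2 := by gcongr
    have e2 : c * χ x / (2 * c) * ‖w‖ ^ 2 = χ x / 2 * ‖w‖ ^ 2 := by field_simp
    linarith
  have : 0 ≤ c * ‖v x‖ ^ 2 := by positivity
  linarith

end Energy

/-! ### The energy inequality -/

section EnergyInequality

variable {n k : ℕ} {T : ℝ}

theorem setIntegral_prod_Ioc {f : E n × ℝ → ℝ} (hf : ContinuousOn f (strip n T)) {K : Set (E n)}
    (hK : IsCompact K) {t : ℝ} (ht : t ∈ Ico 0 T) :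
    IntegrableOn (fun s => ∫ x in K, f (x, s)) (Ioc 0 t) ∧
      ∫ s in Ioc 0 t, ∫ x in K, f (x, s) = ∫ p in K ×ˢ Ioc 0 t, f p := by
  have hint : IntegrableOn f (K ×ˢ Ioc 0 t) :=
    (integrableOn_strip hf hK le_rfl ht.2).mono_set (prod_mono Subset.rfl Ioc_subset_Icc_self)
  rw [IntegrableOn, Measure.volume_eq_prod, ← Measure.prod_restrict] at hint
  refine ⟨hint.integral_prod_right, ?_⟩
  rw [Measure.volume_eq_prod, ← Measure.prod_restrict]
  exact (integral_prod_symm f hint).symm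

/-- The time derivative of `∫χ|Δu|²` is `2∫⟨χΔu, Δ∂_t u⟩ = 2∫⟨Δ(χΔu), ∂_t u⟩`, to which the
pointwise bound `inner_lap_cutoff_le` applies with `v = Δu` and `w = ∂_t u`. -/
theorem energy_cutoff_le {U : E n × ℝ → E k} (hU : ContDiffOn ℝ ∞ U (strip n T))
    (hflow : ∀ x, ∀ t ∈ Ioo 0 T, ⟪lap (lap fun y => U (y, t)) x, timeDeriv T U (x, t)⟫_ℝ
      = -‖timeDeriv T U (x, t)‖ ^ 2)
    {χ : E n → ℝ} {c : ℝ} (hχ : ContDiff ℝ ∞ χ) (hχc : HasCompactSupport χ) (hc : 0 < c)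
    (h1 : ∀ x, gradSq χ x ≤ c * χ x) (h2 : ∀ x, lap χ x ^ 2 ≤ c * χ x)
    {t : ℝ} (ht : t ∈ Ico 0 T) :
    (∫ x in tsupport χ, χ x * ‖lap (fun y => U (y, t)) x‖ ^ 2)
        + ∫ p in tsupport χ ×ˢ Ioc 0 t, χ p.1 * ‖timeDeriv T U p‖ ^ 2
      ≤ (∫ x in tsupport χ, χ x * ‖lap (fun y => U (y, 0)) x‖ ^ 2)
        + 8 * c * ∫ p in tsupport χ ×ˢ Ioc 0 t, (gradSq (lap fun y => U (y, p.2)) p.1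
          + ‖lap (fun y => U (y, p.2)) p.1‖ ^ 2) := by
  set K := tsupport χ with hK
  have hKc : IsCompact K := hχc.isCompact
  set L : E n × ℝ → E k := fun p => lap (fun y => U (y, p.2)) p.1 with hL
  set w : E n × ℝ → E k := timeDeriv T U with hw
  have hLs : ContDiffOn ℝ ∞ L (strip n T) := contDiffOn_lap_slice hU
  have hws : ContDiffOn ℝ ∞ w (strip n T) := contDiffOn_stripDeriv hU _
  have hLt : ContDiffOn ℝ ∞ (timeDeriv T L) (strip n T) := contDiffOn_stripDeriv hLs _
  have hχf : ContinuousOn (fun p : E n × ℝ => χ p.1) (strip n T) :=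
    (hχ.continuous.comp continuous_fst).continuousOn
  set g : E n × ℝ → ℝ := fun p => χ p.1 * ‖L p‖ ^ 2 with hg
  set g' : E n × ℝ → ℝ := fun p => χ p.1 * (2 * ⟪L p, timeDeriv T L p⟫_ℝ) with hg'
  have hgc : ContinuousOn g (strip n T) := hχf.mul (hLs.continuousOn.norm.pow 2)
  have hgc' : ContinuousOn g' (strip n T) :=
    hχf.mul (continuousOn_const.mul (hLs.continuousOn.inner hLt.continuousOn))
  have hd : ∀ x, ∀ t ∈ Ioo 0 T, HasDerivAt (fun s => g (x, s)) (g' (x, t)) t := fun x t ht =>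
    ((hasDerivAt_timeDeriv hLs x ht).norm_sq).const_mul (χ x)
  have hftc := setIntegral_sub_eq_integral_timeDeriv hgc hgc' hd hKc ht
  set P : E n × ℝ → ℝ := fun p => χ p.1 * ‖w p‖ ^ 2 with hP
  set Q : E n × ℝ → ℝ := fun p => gradSq (fun y => L (y, p.2)) p.1 + ‖L p‖ ^ 2 with hQ
  have hPc : ContinuousOn P (strip n T) := hχf.mul (hws.continuousOn.norm.pow 2)
  have hQc : ContinuousOn Q (strip n T) :=
    (continuousOn_gradSq_slice hLs).add (hLs.continuousOn.norm.pow 2)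
  have hHc : ContinuousOn (fun p => -P p + 8 * c * Q p) (strip n T) :=
    hPc.neg.add (continuousOn_const.mul hQc)
  have hslice : ∀ s ∈ Ioc 0 t, ∫ x in K, g' (x, s) ≤ ∫ x in K, (-P (x, s) + 8 * c * Q (x, s)) := by
    intro s hs
    have hs' : s ∈ Ioo 0 T := ⟨hs.1, hs.2.trans_lt ht.2⟩
    have hs0 : s ∈ Ico 0 T := ⟨hs.1.le, hs'.2⟩
    have hv : ContDiff ℝ ∞ fun x => L (x, s) := contDiff_slice hLs hs0
    have hwv : ContDiff ℝ ∞ fun x => w (x, s) := contDiff_slice hws hs0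
    have hχv : ContDiff ℝ ∞ fun x => χ x • L (x, s) := hχ.smul hv
    have hχvc : HasCompactSupport fun x => χ x • L (x, s) := hχc.smul_right
    have e1 : ∫ x in K, g' (x, s) = 2 * ∫ x, ⟪χ x • L (x, s), lap (fun y => w (y, s)) x⟫_ℝ := by
      rw [setIntegral_eq_integral_of_forall_compl_eq_zero fun x hx => by
        simp [hg', image_eq_zero_of_notMem_tsupport hx], ← integral_const_mul]
      refine integral_congr_ae (Eventually.of_forall fun x => ?_)
      simp only [hg', hw, ← timeDeriv_lap_slice hU x hs0, real_inner_smul_left]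
      ring
    have e2 : ∫ x, ⟪lap (fun y => χ y • L (y, s)) x, w (x, s)⟫_ℝ
        = ∫ x in K, ⟪lap (fun y => χ y • L (y, s)) x, w (x, s)⟫_ℝ := by
      symm
      refine setIntegral_eq_integral_of_forall_compl_eq_zero fun x hx => ?_
      rw [lap_fun_smul hχ hv, lap_eq_zero_of_notMem_tsupport hχ hx,
        image_eq_zero_of_notMem_tsupport hx]
      simp [pd_eq_zero_of_notMem_tsupport hx]
    rw [e1, integral_inner_lap hχv hwv hχvc, e2, ← integral_const_mul]
    have hlc := (contDiff_lap hχv).continuous.inner (𝕜 := ℝ) hwv.continuous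
    refine setIntegral_mono_on ?_ ?_ hKc.measurableSet fun x _ => ?_
    · exact (hlc.const_mul 2).continuousOn.integrableOn_compact hKc
    · exact (continuousOn_slice hHc hs0).continuousOn.integrableOn_compact hKc
    · exact inner_lap_cutoff_le hχ hv hc (h1 x) (h2 x) (hflow x s hs')
  have hmono : ∫ s in Ioc 0 t, ∫ x in K, g' (x, s) ≤ ∫ p in K ×ˢ Ioc 0 t, (-P p + 8 * c * Q p) := by
    rw [← (setIntegral_prod_Ioc hHc hKc ht).2]
    exact setIntegral_mono_on (setIntegral_prod_Ioc hgc' hKc ht).1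
      (setIntegral_prod_Ioc hHc hKc ht).1 measurableSet_Ioc hslice
  have hi : ∀ {f : E n × ℝ → ℝ}, ContinuousOn f (strip n T) → IntegrableOn f (K ×ˢ Ioc 0 t) :=
    fun hf => (integrableOn_strip hf hKc le_rfl ht.2).mono_set
      (prod_mono Subset.rfl Ioc_subset_Icc_self)
  have hPn : IntegrableOn (fun p => -P p) (K ×ˢ Ioc 0 t) := (hi hPc).neg
  rw [integral_add hPn ((hi hQc).const_mul _), integral_neg, integral_const_mul] at hmono
  linarith

/-- Pairing the flow equation with `∂_t u` kills the nonlinearity, a combination of normal vectors,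
because `∂_t u` is tangent to `N`. -/
theorem inner_timeDeriv_eq {N : Set (E k)} {u : E n → ℝ → E k} (hu : IsBiharmonicMapHeatFlow N T u)
    (x : E n) {t : ℝ} (ht : t ∈ Ioo 0 T) :
    ⟪lap (lap fun y => u y t) x, timeDeriv T (fun p => u p.1 p.2) (x, t)⟫_ℝ
      = -‖timeDeriv T (fun p => u p.1 p.2) (x, t)‖ ^ 2 := by
  have hd : HasDerivAt (u x) (timeDeriv T (fun p => u p.1 p.2) (x, t)) t :=
    hasDerivAt_timeDeriv hu.smooth x ht
  set w := timeDeriv T (fun p => u p.1 p.2) (x, t)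
  obtain ⟨c, O, ν, huO, hν, hflow⟩ := hu.flow x t ht
  have htan : w ∈ tangentSpaceOf N (u x t) := by
    refine Submodule.subset_span ?_
    -- The derivative of the curve `s ↦ u(x,s)` maps the tangent cone of the open time interval,
    -- which is all of `ℝ`, into the tangent cone of `N`.
    have h1 := (hd.hasFDerivAt.hasFDerivWithinAt (s := Ioo 0 T)).mapsTo_tangent_cone
    have h2 : tangentConeAt ℝ (Ioo 0 T) t = univ :=
      tangentConeAt_of_mem_nhds (isOpen_Ioo.mem_nhds ht)
    rw [h2] at h1
    have h3 := h1 (mem_univ (1 : ℝ))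
    refine tangentConeAt_mono ?_ (by simpa using h3)
    rintro _ ⟨s, hs, rfl⟩
    exact hu.mem x s ⟨hs.1.le, hs.2⟩
  have hnor : ∀ i, ⟪ν i (u x t), w⟫_ℝ = 0 := fun i => by
    have hN : u x t ∈ N ∩ O := ⟨hu.mem x t ⟨ht.1.le, ht.2⟩, huO⟩
    have : ν i (u x t) ∈ (tangentSpaceOf N (u x t))ᗮ := by
      rw [← hν.span_eq _ hN]
      exact Submodule.subset_span ⟨i, rfl⟩
    exact Submodule.inner_left_of_mem_orthogonal htan this
  have hnl : ⟪nonlinearity ν (fun y => u y t) x, w⟫_ℝ = 0 := by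
    unfold nonlinearity
    rw [sum_inner]
    refine Finset.sum_eq_zero fun i _ => ?_
    rw [real_inner_smul_left, hnor, mul_zero]
  rw [hd.deriv] at hflow
  have h := congrArg (fun z => ⟪z, w⟫_ℝ) hflow
  simp only [inner_sub_left, inner_neg_left, hnl, real_inner_self_eq_norm_sq] at h
  linarith

/-- The energy inequality, on balls. -/
theorem setIntegral_energy_le {U : E n × ℝ → E k} (hUs : ContDiffOn ℝ ∞ U (strip n T))
    (hflow : ∀ x, ∀ t ∈ Ioo 0 T, ⟪lap (lap fun y => U (y, t)) x, timeDeriv T U (x, t)⟫_ℝ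
      = -‖timeDeriv T U (x, t)‖ ^ 2)
    (hinit : Integrable fun x => ‖lap (fun y => U (y, 0)) x‖ ^ 2)
    (hlap : ∀ T' < T, IntegrableOn (fun p : E n × ℝ => ‖lap (fun y => U (y, p.2)) p.1‖ ^ 2)
      (univ ×ˢ Ioo 0 T'))
    (hgrad : ∀ T' < T, IntegrableOn (fun p : E n × ℝ => gradSq (lap fun y => U (y, p.2)) p.1)
      (univ ×ˢ Ioo 0 T')) (x₀ : E n) (r : ℝ) {t : ℝ} (ht : t ∈ Ico 0 T) :
    (∫ x in Metric.closedBall x₀ r, ‖lap (fun y => U (y, t)) x‖ ^ 2)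
        + ∫ p in Metric.closedBall x₀ r ×ˢ Ioc 0 t, ‖timeDeriv T U p‖ ^ 2
      ≤ ∫ x, ‖lap (fun y => U (y, 0)) x‖ ^ 2 := by
  obtain ⟨T', htT', hT'⟩ := exists_between ht.2
  have hLs : ContDiffOn ℝ ∞ (fun p : E n × ℝ => lap (fun y => U (y, p.2)) p.1) (strip n T) :=
    contDiffOn_lap_slice hUs
  have hws : ContDiffOn ℝ ∞ (timeDeriv T U) (strip n T) := contDiffOn_stripDeriv hUs _
  set Q : E n × ℝ → ℝ := fun p => gradSq (lap fun y => U (y, p.2)) p.1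
    + ‖lap (fun y => U (y, p.2)) p.1‖ ^ 2 with hQ
  have hQi : IntegrableOn Q (univ ×ˢ Ioo 0 T') := (hgrad T' hT').add (hlap T' hT')
  have hQ0 : ∀ p, 0 ≤ Q p := fun p => add_nonneg (gradSq_nonneg _ _) (sq_nonneg _)
  set M := ∫ p in univ ×ˢ Ioo 0 T', Q p with hM
  have hM0 : 0 ≤ M := integral_nonneg hQ0
  refine le_of_forall_pos_le_add fun ε hε => ?_
  -- With this `c` the error `8cM` is at most `ε`. Finiteness of `M`, the integral of `|∇Δu|² +
  -- |Δu|²`, is where the integrability of `∇Δu` enters.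
  have hc : 0 < ε / (8 * (M + 1)) := by positivity
  obtain ⟨χ, hχ, hχc, hχ0, hχ1, hχone, h1, h2⟩ := exists_slow_cutoff x₀ r hc
  have h := energy_cutoff_le hUs hflow hχ hχc hc h1 h2 ht
  have hKc : IsCompact (tsupport χ) := hχc.isCompact
  have hsub : Metric.closedBall x₀ r ⊆ tsupport χ := fun x hx =>
    subset_tsupport χ (by simp [hχone x hx])
  have hBm : MeasurableSet (Metric.closedBall x₀ r) := Metric.isClosed_closedBall.measurableSet
  have g1 : ∫ x in Metric.closedBall x₀ r, ‖lap (fun y => U (y, t)) x‖ ^ 2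
      ≤ ∫ x in tsupport χ, χ x * ‖lap (fun y => U (y, t)) x‖ ^ 2 := by
    have e : ∫ x in Metric.closedBall x₀ r, ‖lap (fun y => U (y, t)) x‖ ^ 2
        = ∫ x in Metric.closedBall x₀ r, χ x * ‖lap (fun y => U (y, t)) x‖ ^ 2 :=
      setIntegral_congr_fun hBm fun x hx => by simp [hχone x hx]
    rw [e]
    refine setIntegral_mono_set ?_ (Eventually.of_forall fun x => ?_) hsub.eventuallyLE
    · exact (hχ.continuous.mul ((continuousOn_slice hLs.continuousOn ht).norm.pow 2)
        ).continuousOn.integrableOn_compact hKc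
    · have := hχ0 x
      simp only [Pi.zero_apply]; positivity
  have g2 : ∫ p in Metric.closedBall x₀ r ×ˢ Ioc 0 t, ‖timeDeriv T U p‖ ^ 2
      ≤ ∫ p in tsupport χ ×ˢ Ioc 0 t, χ p.1 * ‖timeDeriv T U p‖ ^ 2 := by
    have e : ∫ p in Metric.closedBall x₀ r ×ˢ Ioc 0 t, ‖timeDeriv T U p‖ ^ 2
        = ∫ p in Metric.closedBall x₀ r ×ˢ Ioc 0 t, χ p.1 * ‖timeDeriv T U p‖ ^ 2 :=
      setIntegral_congr_fun (hBm.prod measurableSet_Ioc) fun p hp => by simp [hχone p.1 hp.1]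
    rw [e]
    refine setIntegral_mono_set ?_ (Eventually.of_forall fun p => ?_)
      (LE.le.eventuallyLE (Set.prod_mono hsub Subset.rfl))
    · exact (integrableOn_strip ((hχ.continuous.comp continuous_fst).continuousOn.mul
        (hws.continuousOn.norm.pow 2)) hKc le_rfl ht.2).mono_set
        (prod_mono Subset.rfl Ioc_subset_Icc_self)
    · have := hχ0 p.1
      simp only [Pi.zero_apply]; positivity
  have g3 : ∫ x in tsupport χ, χ x * ‖lap (fun y => U (y, 0)) x‖ ^ 2
      ≤ ∫ x, ‖lap (fun y => U (y, 0)) x‖ ^ 2 := by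
    have h0 : (0 : ℝ) ∈ Ico 0 T := ⟨le_rfl, ht.1.trans_lt ht.2⟩
    refine le_trans (setIntegral_mono_on ?_ hinit.integrableOn hKc.measurableSet
      fun x _ => ?_) (setIntegral_le_integral hinit (Eventually.of_forall fun x => ?_))
    · exact (hχ.continuous.mul ((continuousOn_slice hLs.continuousOn h0).norm.pow 2)
        ).continuousOn.integrableOn_compact hKc
    · exact mul_le_of_le_one_left (sq_nonneg _) (hχ1 x)
    · simp only [Pi.zero_apply]; positivity
  have g4 : ∫ p in tsupport χ ×ˢ Ioc 0 t, Q p ≤ M :=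
    setIntegral_mono_set hQi (Eventually.of_forall hQ0) (LE.le.eventuallyLE
      (Set.prod_mono (subset_univ _) fun s hs => ⟨hs.1, hs.2.trans_lt htT'⟩))
  have g5 : 8 * (ε / (8 * (M + 1))) * ∫ p in tsupport χ ×ˢ Ioc 0 t, Q p ≤ ε := by
    calc _ ≤ 8 * (ε / (8 * (M + 1))) * M := by gcongr
      _ = ε * (M / (M + 1)) := by field_simp
      _ ≤ ε * 1 := by
        gcongr
        rw [div_le_one (by positivity)]; linarith
      _ = ε := mul_one ε
  linarith

theorem energy_le {N : Set (E k)} {u : E n → ℝ → E k} (hu : IsBiharmonicMapHeatFlow N T u)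
    (he : HasLocallyFiniteEnergy T u) (x₀ : E n) (r : ℝ) {t : ℝ} (ht : t ∈ Ico 0 T) :
    (∫ x in Metric.closedBall x₀ r, ‖lap (fun y => u y t) x‖ ^ 2)
        + ∫ p in Metric.closedBall x₀ r ×ˢ Ioc 0 t, ‖timeDeriv T (fun p => u p.1 p.2) p‖ ^ 2
      ≤ ∫ x, ‖lap (fun y => u y 0) x‖ ^ 2 :=
  setIntegral_energy_le (U := fun p => u p.1 p.2) hu.smooth
    (fun x _ ht => inner_timeDeriv_eq hu x ht) he.initial he.lap_sq he.grad_lap_sq x₀ r ht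

end EnergyInequality

/-! ### The kernel on a parabolic neighbourhood and derivatives of layer integrals -/

section Layer

variable {n : ℕ}

/-- A parabolic neighbourhood of the axis `x = x₀`, `t < t₀`. -/
def parabolicNhd (x₀ : E n) (t₀ η : ℝ) : Set (E n × ℝ) :=
  {p | p.2 < t₀ ∧ ‖p.1 - x₀‖ < η * (t₀ - p.2) ^ ((1 : ℝ) / 4)}

theorem continuous_quarticRoot (t₀ : ℝ) :
    Continuous fun p : E n × ℝ => (t₀ - p.2) ^ ((1 : ℝ) / 4) :=
  (continuous_const.sub continuous_snd).rpow_const fun _ => Or.inr (by norm_num)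

theorem isOpen_parabolicNhd (x₀ : E n) (t₀ η : ℝ) : IsOpen (parabolicNhd x₀ t₀ η) :=
  (isOpen_lt continuous_snd continuous_const).inter
    (isOpen_lt (by fun_prop) (continuous_const.mul (continuous_quarticRoot t₀)))

theorem quarticRoot_pow {s : ℝ} (hs : 0 ≤ s) : (s ^ ((1 : ℝ) / 4)) ^ 4 = s := by
  rw [← Real.rpow_natCast, ← Real.rpow_mul hs]; norm_num

theorem le_quarticRoot {R s : ℝ} (h : R ^ 4 ≤ s) : R ≤ s ^ ((1 : ℝ) / 4) := by
  have hs : 0 ≤ s := le_trans (by positivity) h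
  by_contra! hlt
  have h2 : (s ^ ((1 : ℝ) / 4)) ^ 4 < R ^ 4 := by gcongr
  rw [quarticRoot_pow hs] at h2
  linarith

/-- With `σ = (t₀-t)^{1/4}` the kernel is `F(q)/σ^n` and its Laplacian `G(q)/σ^{n+2}`. This yields
joint continuity, and `σ ≥ R` for `t ≤ t₀-R⁴` yields the bounds. -/
theorem exists_kernel_on_parabolicNhd (hn : 1 ≤ n) :
    ∃ η K : ℝ, 0 < η ∧ η ≤ 1 ∧ 0 < K ∧ ∀ (x₀ : E n) (t₀ : ℝ),
      ContinuousOn (fun p : E n × ℝ => backwardKernel x₀ t₀ p.1 p.2) (parabolicNhd x₀ t₀ η) ∧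
      ContinuousOn (fun p : E n × ℝ => lap (fun y => backwardKernel x₀ t₀ y p.2) p.1)
        (parabolicNhd x₀ t₀ η) ∧
      ∀ p ∈ parabolicNhd x₀ t₀ η, ∀ R, 0 < R → p.2 ≤ t₀ - R ^ 4 →
        0 ≤ backwardKernel x₀ t₀ p.1 p.2 ∧ backwardKernel x₀ t₀ p.1 p.2 ≤ K / R ^ n ∧
        -(K / R ^ (n + 2)) ≤ lap (fun y => backwardKernel x₀ t₀ y p.2) p.1 ∧
        lap (fun y => backwardKernel x₀ t₀ y p.2) p.1 ≤ 0 := by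
  obtain ⟨η, K, F, G, hη, hη1, hK, hF, hG, hb, hker⟩ := exists_backwardKernel_bounds hn
  refine ⟨η, K, hη, hη1, hK, fun x₀ t₀ => ?_⟩
  set σ : E n × ℝ → ℝ := fun p => (t₀ - p.2) ^ ((1 : ℝ) / 4) with hσ
  have hσp : ∀ p ∈ parabolicNhd x₀ t₀ η, 0 < σ p := fun p hp =>
    Real.rpow_pos_of_pos (by linarith [hp.1]) _
  have hk : ∀ p ∈ parabolicNhd x₀ t₀ η,
      backwardKernel x₀ t₀ p.1 p.2 = F (‖p.1 - x₀‖ ^ 2 / σ p ^ 2) / σ p ^ n ∧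
      lap (fun y => backwardKernel x₀ t₀ y p.2) p.1
        = G (‖p.1 - x₀‖ ^ 2 / σ p ^ 2) / σ p ^ (n + 2) := fun p hp =>
    hker x₀ p.1 t₀ p.2 (σ p) (hσp p hp) (quarticRoot_pow (by linarith [hp.1])).symm hp.2
  have hq : ∀ p ∈ parabolicNhd x₀ t₀ η, ‖p.1 - x₀‖ ^ 2 / σ p ^ 2 ∈ Ico 0 (η ^ 2) := fun p hp => by
    have := hσp p hp
    refine ⟨by positivity, ?_⟩
    rw [div_lt_iff₀ (by positivity), ← mul_pow]
    have := hp.2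
    gcongr
  have hσc : ContinuousOn σ (parabolicNhd x₀ t₀ η) := (continuous_quarticRoot t₀).continuousOn
  have hqc : ContinuousOn (fun p => ‖p.1 - x₀‖ ^ 2 / σ p ^ 2) (parabolicNhd x₀ t₀ η) :=
    ContinuousOn.div (by fun_prop) (hσc.pow 2) fun p hp => (pow_pos (hσp p hp) 2).ne'
  refine ⟨?_, ?_, fun p hp R hR hpR => ?_⟩
  · refine ((hF.comp hqc hq).div (hσc.pow n) fun p hp => (pow_pos (hσp p hp) n).ne').congr ?_
    exact fun p hp => (hk p hp).1
  · refine ((hG.comp hqc hq).div (hσc.pow (n + 2))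
      fun p hp => (pow_pos (hσp p hp) (n + 2)).ne').congr ?_
    exact fun p hp => (hk p hp).2
  · have hRσ : R ≤ σ p := le_quarticRoot (by linarith)
    have hσ0 := hσp p hp
    obtain ⟨b1, b2, b3, b4⟩ := hb _ (hq p hp)
    rw [(hk p hp).1, (hk p hp).2]
    refine ⟨by positivity, by gcongr, ?_, div_nonpos_of_nonpos_of_nonneg b4 (by positivity)⟩
    rw [neg_le, ← neg_div]
    have : -G (‖p.1 - x₀‖ ^ 2 / σ p ^ 2) ≤ K := by linarith
    gcongr

/-- The kernel is only controlled in `Ω`; at points off the closed set `K` the product vanishes in a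
whole neighbourhood, so nothing is asked of `b` there. -/
theorem continuousOn_mul_cutoff {Ω S : Set (E n × ℝ)} (hΩ : IsOpen Ω) {b : E n × ℝ → ℝ}
    (hb : ContinuousOn b Ω) {φ : E n → ℝ} (hφ : Continuous φ) {K : Set (E n)} (hK : IsClosed K)
    (hφK : ∀ x ∉ K, φ x = 0) (h : ∀ p ∈ S, p.1 ∈ K → p ∈ Ω) :
    ContinuousOn (fun p => b p * φ p.1) S := by
  intro p hp
  by_cases hpK : p.1 ∈ K
  · exact ((hb.continuousAt (hΩ.mem_nhds (h p hp hpK))).mul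
      (hφ.comp continuous_fst).continuousAt).continuousWithinAt
  · have hn : {q : E n × ℝ | q.1 ∉ K} ∈ 𝓝 p :=
      (hK.isOpen_compl.preimage continuous_fst).mem_nhds hpK
    have he : (fun p => b p * φ p.1) =ᶠ[𝓝 p] fun _ => 0 := by
      filter_upwards [hn] with q hq
      rw [hφK _ hq, mul_zero]
    exact (continuousAt_const.congr he.symm).continuousWithinAt

theorem layer_eq_prod (t₀ r : ℝ) :
    layer n t₀ r = univ ×ˢ Ioo (t₀ - 16 * r ^ 4) (t₀ - r ^ 4) := by
  ext p; simp [layer]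

theorem setIntegral_univ_prod_eq {f : E n × ℝ → ℝ} {K : Set (E n)}
    (hf : ∀ p, p.1 ∉ K → f p = 0) {I : Set ℝ} (hI : MeasurableSet I) :
    ∫ p in univ ×ˢ I, f p = ∫ p in K ×ˢ I, f p := by
  refine setIntegral_eq_of_subset_of_forall_sdiff_eq_zero (MeasurableSet.univ.prod hI)
    (prod_mono (subset_univ _) Subset.rfl) fun p hp => hf p fun h => hp.2 ⟨h, hp.1.2⟩

theorem sixteen_mul_pow_le {t₀ r : ℝ} (ht₀ : 0 ≤ t₀) (hr : 0 ≤ r)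
    (h : r ≤ t₀ ^ ((1 : ℝ) / 4) / 2) : 16 * r ^ 4 ≤ t₀ := by
  calc 16 * r ^ 4 = (2 * r) ^ 4 := by ring
    _ ≤ (t₀ ^ ((1 : ℝ) / 4)) ^ 4 := by gcongr; linarith
    _ = t₀ := quarticRoot_pow ht₀

/-- The layer integral is `H(t₀-r⁴) - H(t₀-16r⁴)` for a primitive `H` of the slice integral.
Continuity slightly beyond the slice `t₀-R⁴`, up to `t₀-ρ⁴`, allows `r` to vary below `R`. -/
theorem hasDerivWithinAt_setIntegral_layer {f : E n × ℝ → ℝ} {K : Set (E n)} (hK : IsCompact K)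
    (hfK : ∀ p, p.1 ∉ K → f p = 0) {t₀ ρ R : ℝ} (ht₀ : 0 < t₀) (hρ : 0 < ρ) (hρR : ρ < R)
    (hR : R ≤ t₀ ^ ((1 : ℝ) / 4) / 2) (hf : ContinuousOn f (strip n (t₀ - ρ ^ 4))) :
    HasDerivWithinAt (fun r => ∫ p in layer n t₀ r, f p)
      (64 * R ^ 3 * (∫ x, f (x, t₀ - 16 * R ^ 4)) - 4 * R ^ 3 * ∫ x, f (x, t₀ - R ^ 4))
      (Ioc 0 (t₀ ^ ((1 : ℝ) / 4) / 2)) R := by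
  obtain ⟨ρ', h1, h2⟩ := exists_between hρR
  have hρ' : 0 < ρ' := hρ.trans h1
  set h : ℝ → ℝ := fun t => ∫ x, f (x, t) with hh
  have hR0 : 0 < R := hρ.trans hρR
  have hpow : ρ ^ 4 < ρ' ^ 4 := by gcongr
  have hb : ∀ r, ρ' < r → r ≤ t₀ ^ ((1 : ℝ) / 4) / 2 → 0 ≤ t₀ - 16 * r ^ 4 ∧
      t₀ - 16 * r ^ 4 ≤ t₀ - r ^ 4 ∧ t₀ - r ^ 4 < t₀ - ρ' ^ 4 := fun r hr hr' => by
    have e1 := sixteen_mul_pow_le ht₀.le (hρ'.trans hr).le hr'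
    have e2 : ρ' ^ 4 < r ^ 4 := by gcongr
    have e3 : 0 ≤ r ^ 4 := by positivity
    exact ⟨by linarith, by linarith, by linarith⟩
  have hτ : 0 ≤ t₀ - ρ' ^ 4 := by
    have := hb R h2 hR; linarith
  have hhc : ContinuousOn h (Ico 0 (t₀ - ρ ^ 4)) := by
    refine continuousOn_integral_of_compact_support (f := fun t x => f (x, t)) hK ?_
      fun t x _ hx => hfK (x, t) hx
    exact hf.comp (continuous_swap.continuousOn) fun p hp => ⟨mem_univ _, hp.1⟩
  have hhI : ContinuousOn h (Icc 0 (t₀ - ρ' ^ 4)) :=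
    hhc.mono fun t ht => ⟨ht.1, by linarith [ht.2]⟩
  -- Extending the slice integral continuously to `ℝ` makes its primitive differentiable everywhere,
  -- also at time `0`, which is `t₀-16R⁴` when `R` is the right endpoint.
  set g : ℝ → ℝ := IccExtend hτ ((Icc 0 (t₀ - ρ' ^ 4)).domRestrict h) with hg
  have hgc : Continuous g := (continuousOn_iff_continuous_domRestrict.1 hhI).Icc_extend'
  have hgh : ∀ t ∈ Icc 0 (t₀ - ρ' ^ 4), g t = h t := fun t ht => IccExtend_of_mem _ _ ht
  set H : ℝ → ℝ := fun t => ∫ s in (0 : ℝ)..t, g s with hH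
  have hHd : ∀ t, HasDerivAt H (g t) t := fun t =>
    intervalIntegral.integral_hasDerivAt_right (hgc.intervalIntegrable _ _)
      (hgc.stronglyMeasurableAtFilter _ _) hgc.continuousAt
  have hform : ∀ r, ρ' < r → r ≤ t₀ ^ ((1 : ℝ) / 4) / 2 →
      ∫ p in layer n t₀ r, f p = H (t₀ - r ^ 4) - H (t₀ - 16 * r ^ 4) := fun r hr hr' => by
    obtain ⟨c1, c2, c3⟩ := hb r hr hr'
    have hint : IntegrableOn f (K ×ˢ Ioo (t₀ - 16 * r ^ 4) (t₀ - r ^ 4)) :=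
      (integrableOn_strip hf hK c1 (by linarith)).mono_set
        (prod_mono Subset.rfl Ioo_subset_Icc_self)
    rw [layer_eq_prod, setIntegral_univ_prod_eq hfK measurableSet_Ioo, hH,
      intervalIntegral.integral_interval_sub_left (hgc.intervalIntegrable _ _)
        (hgc.intervalIntegrable _ _), intervalIntegral.integral_of_le c2,
      integral_Ioc_eq_integral_Ioo]
    rw [IntegrableOn, Measure.volume_eq_prod, ← Measure.prod_restrict] at hint
    rw [Measure.volume_eq_prod, ← Measure.prod_restrict, integral_prod_symm f hint]
    refine setIntegral_congr_fun measurableSet_Ioo fun t ht => ?_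
    rw [hgh t ⟨by linarith [ht.1], by linarith [ht.2]⟩]
    exact setIntegral_eq_integral_of_forall_compl_eq_zero fun x hx => hfK (x, t) hx
  have hpd : ∀ c : ℝ, HasDerivAt (fun r : ℝ => t₀ - c * r ^ 4) (-(c * (4 * R ^ 3))) R := fun c => by
    simpa using ((hasDerivAt_pow 4 R).const_mul c).const_sub t₀
  have hD : HasDerivAt (fun r => H (t₀ - 1 * r ^ 4) - H (t₀ - 16 * r ^ 4))
      (g (t₀ - 1 * R ^ 4) * -(1 * (4 * R ^ 3)) - g (t₀ - 16 * R ^ 4) * -(16 * (4 * R ^ 3))) R :=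
    ((hHd _).comp R (hpd 1)).sub ((hHd _).comp R (hpd 16))
  obtain ⟨c1, c2, c3⟩ := hb R h2 hR
  rw [one_mul, hgh _ ⟨by linarith, c3.le⟩, hgh _ ⟨c1, by linarith⟩] at hD
  refine (hD.hasDerivWithinAt.congr_of_eventuallyEq ?_ ?_).congr_deriv ?_
  · filter_upwards [self_mem_nhdsWithin, nhdsWithin_le_nhds (Ioi_mem_nhds h2)] with r hr hr'
    rw [hform r hr' hr.2, one_mul]
  · rw [hform R h2 hR, one_mul]
  · simp only [hh]; ring

theorem norm_fderiv_apply_sq_le {F : Type*} [NormedAddCommGroup F] [NormedSpace ℝ F]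
    (v : E n → F) (x y : E n) : ‖fderiv ℝ v x y‖ ^ 2 ≤ ‖y‖ ^ 2 * gradSq v x := by
  have e : fderiv ℝ v x y = ∑ j, y j • pd j v x := by
    have hy : y = ∑ j, y j • EuclideanSpace.single j (1 : ℝ) := by
      have := (EuclideanSpace.basisFun (Fin n) ℝ).sum_repr y
      simpa using this.symm
    conv_lhs => rw [hy]
    simp [map_sum, pd]
  have h1 : ‖fderiv ℝ v x y‖ ≤ ∑ j, |y j| * ‖pd j v x‖ := by
    rw [e]
    refine (norm_sum_le _ _).trans (le_of_eq ?_)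
    simp [norm_smul]
  calc ‖fderiv ℝ v x y‖ ^ 2 ≤ (∑ j, |y j| * ‖pd j v x‖) ^ 2 := by gcongr
    _ ≤ (∑ j, |y j| ^ 2) * ∑ j, ‖pd j v x‖ ^ 2 := Finset.sum_mul_sq_le_sq_mul_sq _ _ _
    _ = _ := by rw [EuclideanSpace.real_norm_sq_eq]; simp [gradSq]

end Layer

/-! ### Concentrated cut-offs, the soliton density and the final arithmetic -/

section Main

variable {n : ℕ}

/-- The supremum of an unbounded set of reals is `0` by default, so boundedness must be proved; it
comes from compactness of `K × [0,S]`. -/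
theorem setIntegral_le_supIntegral {T S : ℝ} {h : E n → ℝ → ℝ} {φ : E n → ℝ} {K : Set (E n)}
    (hc : ContinuousOn (fun p : E n × ℝ => h p.1 p.2) (strip n T)) (hS : S < T)
    (h0 : ∀ x t, 0 ≤ h x t) (hK : IsCompact K) (hφ : {x | 0 < φ x} ⊆ K) {t : ℝ}
    (ht : t ∈ Icc 0 S) : ∫ x in {x | 0 < φ x}, h x t ≤ supIntegral S φ h := by
  refine le_csSup ?_ ⟨t, ht, rfl⟩
  have hsub : K ×ˢ Icc 0 S ⊆ strip n T :=
    prod_mono (subset_univ _) fun s hs => ⟨hs.1, hs.2.trans_lt hS⟩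
  obtain ⟨M, hM⟩ := ((hK.prod isCompact_Icc).image_of_continuousOn (hc.mono hsub)).bddAbove
  refine ⟨M * volume.real K, ?_⟩
  rintro _ ⟨s, hs, rfl⟩
  have hcs : Continuous fun x => h x s :=
    continuousOn_slice (f := fun p : E n × ℝ => h p.1 p.2) hc ⟨hs.1, hs.2.trans_lt hS⟩
  have hi : IntegrableOn (fun x => h x s) K := hcs.continuousOn.integrableOn_compact hK
  calc ∫ x in {x | 0 < φ x}, h x s ≤ ∫ x in K, h x s :=
        setIntegral_mono_set hi (Eventually.of_forall fun x => h0 x s)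
          (LE.le.eventuallyLE hφ)
    _ ≤ ∫ _ in K, M := setIntegral_mono_on hi (integrableOn_const hK.measure_ne_top)
        hK.measurableSet fun x hx => hM ⟨(x, s), ⟨hx, hs⟩, rfl⟩
    _ = M * volume.real K := by simp [mul_comm]

theorem supIntegral_nonneg {S : ℝ} {h : E n → ℝ → ℝ} (φ : E n → ℝ) (h0 : ∀ x t, 0 ≤ h x t) :
    0 ≤ supIntegral S φ h := by
  refine Real.sSup_nonneg ?_
  rintro _ ⟨s, _, rfl⟩
  exact integral_nonneg fun x => h0 x s

/-- Cut-off functions which are positive on a ball, but small outside of a smaller ball. -/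
theorem exists_concentrated_cutoff {δ r κ : ℝ} (hδ : 0 < δ) (hδr : δ ≤ r) (hκ : 0 < κ)
    (hκ1 : κ ≤ 1) : ∃ φ : E n → ℝ, IsCutoff φ ∧ {x | 0 < φ x} = Metric.ball 0 r ∧
      ∀ x ∉ Metric.ball 0 δ, φ x ≤ κ := by
  obtain ⟨a, ha, hac, ha0, ha1, haone, has⟩ := exists_cutoff_function (0 : E n) hδ
  obtain ⟨b, hb, hbc, hb0, hb1, hbone, hbs⟩ := exists_cutoff_function (0 : E n) (hδ.trans_le hδr)
  have haz : ∀ x ∉ Metric.ball 0 δ, a x = 0 := fun x hx => by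
    rw [← has] at hx; simpa using hx
  have hbz : ∀ x ∉ Metric.ball 0 r, b x = 0 := fun x hx => by
    rw [← hbs] at hx; simpa using hx
  -- The bump `a` lives on the small ball; `b`, with weight `κ`, makes the positivity set the full
  -- ball of radius `r`, over which the suprema in the theorem are taken.
  refine ⟨fun x => (1 - κ) * a x + κ * b x, ⟨?_, ?_, fun x => ?_, fun x => ?_, ?_⟩, ?_, ?_⟩
  · exact (contDiff_const.mul ha).add (contDiff_const.mul hb)
  · exact (hac.mul_left).add hbc.mul_left
  · have := ha0 x; have := hb0 x; have : 0 ≤ 1 - κ := by linarith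
    positivity
  · have := ha1 x; have := hb1 x
    nlinarith
  · filter_upwards [Metric.closedBall_mem_nhds (0 : E n) (half_pos hδ)] with x hx
    rw [haone x hx, hbone x (Metric.closedBall_subset_closedBall (by linarith) hx)]; ring
  · ext x
    simp only [mem_ofPred_eq]
    constructor
    · intro h
      by_contra hx
      rw [hbz x hx, haz x fun h' => hx (Metric.ball_subset_ball hδr h')] at h
      simp at h
    · intro hx
      have h1 : 0 < b x := (hb0 x).lt_of_ne' (by rw [← hbs] at hx; exact hx)
      have := ha0 x; have : 0 ≤ 1 - κ := by linarith
      positivity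
  · intro x hx
    simp only [haz x hx, mul_zero, zero_add]
    exact mul_le_of_le_one_right hκ.le (hb1 x)

/-- On the large ball `φ` is bounded by `κ` plus the indicator of the small closed ball. -/
theorem integral_cutoff_mul_le {φ g : E n → ℝ} {x₀ : E n} {δ r κ : ℝ} (hφ : Continuous φ)
    (hφ1 : ∀ x, φ x ≤ 1) (hφr : ∀ x ∉ Metric.ball x₀ r, φ x = 0)
    (hφκ : ∀ x ∉ Metric.ball x₀ δ, φ x ≤ κ) (hκ : 0 ≤ κ) (hδr : δ ≤ r) (hg : Continuous g)
    (hg0 : ∀ x, 0 ≤ g x) :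
    ∫ x, φ x * g x ≤ κ * (∫ x in Metric.ball x₀ r, g x)
      + ∫ x in Metric.closedBall x₀ δ, g x := by
  have hib : ∀ {f : E n → ℝ}, Continuous f → IntegrableOn f (Metric.closedBall x₀ r) := fun hf =>
    hf.continuousOn.integrableOn_compact (isCompact_closedBall x₀ r)
  have hs : Metric.closedBall x₀ δ ⊆ Metric.closedBall x₀ r :=
    Metric.closedBall_subset_closedBall hδr
  have hm : MeasurableSet (Metric.closedBall x₀ δ) := Metric.isClosed_closedBall.measurableSet
  have hig := (hib hg).mono_set Metric.ball_subset_closedBall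
  have hind : IntegrableOn ((Metric.closedBall x₀ δ).indicator g) (Metric.ball x₀ r) :=
    hig.indicator hm
  have e : ∫ x, φ x * g x = ∫ x in Metric.ball x₀ r, φ x * g x := by
    symm
    exact setIntegral_eq_integral_of_forall_compl_eq_zero fun x hx => by simp [hφr x hx]
  rw [e, ← integral_const_mul]
  have hle : ∫ x in Metric.ball x₀ r, (Metric.closedBall x₀ δ).indicator g x
      ≤ ∫ x in Metric.closedBall x₀ δ, g x := by
    rw [setIntegral_indicator hm]
    exact setIntegral_mono_set ((hib hg).mono_set hs) (Eventually.of_forall hg0)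
      (LE.le.eventuallyLE inter_subset_right)
  refine le_trans ?_ (add_le_add_right hle _)
  rw [← integral_add (hig.const_mul κ) hind]
  refine setIntegral_mono_on ((hib (hφ.mul hg)).mono_set Metric.ball_subset_closedBall)
    ((hig.const_mul κ).add hind) Metric.isOpen_ball.measurableSet fun x _ => ?_
  by_cases hx : x ∈ Metric.closedBall x₀ δ
  · rw [indicator_of_mem hx]
    have := mul_le_of_le_one_left (hg0 x) (hφ1 x)
    have := mul_nonneg hκ (hg0 x)
    linarith
  · rw [indicator_of_notMem hx, add_zero]
    exact mul_le_mul_of_nonneg_right (hφκ x fun h => hx (Metric.ball_subset_closedBall h)) (hg0 x)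

theorem norm_sol_sq_le {k : ℕ} {u : E n → ℝ → E k} (x₀ : E n) (t₀ : ℝ) (x : E n) (t : ℝ) :
    ‖sol x₀ t₀ u x t‖ ^ 2 ≤ 2 * (‖x - x₀‖ ^ 2 * gradSq (fun y => u y t) x)
      + 32 * ((t - t₀) ^ 2 * ‖deriv (u x) t‖ ^ 2) := by
  unfold sol
  have h1 := norm_fderiv_apply_sq_le (fun y => u y t) x (x - x₀)
  have h2 := norm_add_le (fderiv ℝ (fun y => u y t) x (x - x₀)) ((4 * (t - t₀)) • deriv (u x) t)
  have h3 : ‖(4 * (t - t₀)) • deriv (u x) t‖ ^ 2 = 16 * ((t - t₀) ^ 2 * ‖deriv (u x) t‖ ^ 2) := by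
    rw [norm_smul, mul_pow, Real.norm_eq_abs, sq_abs]; ring
  have h4 : ‖fderiv ℝ (fun y => u y t) x (x - x₀) + (4 * (t - t₀)) • deriv (u x) t‖ ^ 2
      ≤ (‖fderiv ℝ (fun y => u y t) x (x - x₀)‖ + ‖(4 * (t - t₀)) • deriv (u x) t‖) ^ 2 := by
    gcongr
  have h5 := add_sq_le (a := ‖fderiv ℝ (fun y => u y t) x (x - x₀)‖)
    (b := ‖(4 * (t - t₀)) • deriv (u x) t‖)
  rw [h3] at h5
  linarith

/-- In the layer `R⁴ < t₀-t < 16R⁴`: the gradient part is at most `2R²/(4R⁴)` and the time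
derivative part `32|t-t₀|/4 ≤ 128R⁴`. -/
theorem sol_density_le {k : ℕ} {u : E n → ℝ → E k} {x₀ x : E n} {t₀ t R : ℝ} (hR : 0 < R)
    (h1 : t₀ - 16 * R ^ 4 < t) (h2 : t < t₀ - R ^ 4) (hx : ‖x - x₀‖ ≤ R) :
    ‖sol x₀ t₀ u x t‖ ^ 2 / (4 * |t - t₀|)
      ≤ gradSq (fun y => u y t) x / (2 * R ^ 2) + 128 * R ^ 4 * ‖deriv (u x) t‖ ^ 2 := by
  have hR4 : 0 < R ^ 4 := by positivity
  have hs : |t - t₀| = t₀ - t := by rw [abs_sub_comm, abs_of_pos (by linarith)]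
  have hs0 : 0 < t₀ - t := by linarith
  have hg := gradSq_nonneg (fun y => u y t) x
  rw [hs, div_le_iff₀ (by positivity)]
  refine (norm_sol_sq_le x₀ t₀ x t).trans ?_
  have e1 : ‖x - x₀‖ ^ 2 * gradSq (fun y => u y t) x ≤ R ^ 2 * gradSq (fun y => u y t) x := by
    gcongr
  have e2 : R ^ 2 * gradSq (fun y => u y t) x
      ≤ gradSq (fun y => u y t) x / R ^ 2 * (t₀ - t) := by
    calc R ^ 2 * gradSq (fun y => u y t) x = gradSq (fun y => u y t) x / R ^ 2 * R ^ 4 := by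
          field_simp
      _ ≤ _ := by gcongr; linarith
  have e3 : (t - t₀) ^ 2 * ‖deriv (u x) t‖ ^ 2
      ≤ 16 * R ^ 4 * (t₀ - t) * ‖deriv (u x) t‖ ^ 2 := by
    gcongr
    nlinarith
  have e4 : (gradSq (fun y => u y t) x / (2 * R ^ 2) + 128 * R ^ 4 * ‖deriv (u x) t‖ ^ 2)
      * (4 * (t₀ - t)) = 2 * (gradSq (fun y => u y t) x / R ^ 2 * (t₀ - t))
        + 32 * (16 * R ^ 4 * (t₀ - t) * ‖deriv (u x) t‖ ^ 2) := by
    field_simp; ring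
  rw [e4]
  linarith

/-- The arithmetic which combines the bounds for the two ends of the layer with the bound for the
soliton integral. -/
theorem energy_derivative_arithmetic {n : ℕ} (hn : 1 ≤ n) {K R R₀ κ A E₀ h1a h1b h2a h2b S : ℝ}
    (hK : 0 < K) (hR₀ : 0 < R₀) (hR₀R : R₀ ≤ R) (hR1 : R ≤ 1) (hκ0 : 0 < κ)
    (hκ : κ ≤ R₀ ^ (n + 1)) (hA : 0 ≤ A) (hE : 0 ≤ E₀) (h1a0 : 0 ≤ h1a) (h2a0 : h2a ≤ 0)
    (hb1 : h1b ≤ K / R ^ n * E₀)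
    (hb2 : -(K / R ^ (n + 2) * (2 * κ * A + κ * E₀)) ≤ h2b)
    (hS : S ≤ K / R ^ n * (15 / 2 * R ^ 2 * (2 * κ * A + κ * E₀) + 128 * R ^ 4 * E₀)) :
    1 / 2 * (1 / R) * S - (100 * K + 1) * A - (100 * K + 1) * (R ^ 4 + R ^ (3 - (n : ℤ))) * E₀
      ≤ 1 / 2 * (64 * R ^ 3 * h1a - 4 * R ^ 3 * h1b)
        + -(1 / 2 * (64 * R ^ 3 * h2a - 4 * R ^ 3 * h2b)) := by
  have hR : 0 < R := hR₀.trans_le hR₀R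
  have hRn : 0 < R ^ n := by positivity
  -- `ρ = R^{1-n}` is the factor in front of the gradient terms. From `κ ≤ R^{n+1}` follow `ρκ ≤ 1`,
  -- which makes the coefficient of `A` free of negative powers of `R`, and `κ ≤ R²`, which turns
  -- `ρκE₀` into `R^{3-n}E₀`.
  set ρ := R / R ^ n with hρ
  have hρ0 : 0 < ρ := by positivity
  have ez : R ^ (3 - (n : ℤ)) = R ^ 2 * ρ := by
    rw [zpow_sub₀ hR.ne', hρ, zpow_natCast]
    have : R ^ (3 : ℤ) = R ^ 3 := by norm_cast
    rw [this]; ring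
  have hκR : κ ≤ R ^ (n + 1) := hκ.trans (by gcongr)
  have hκ2 : κ ≤ R ^ 2 := hκR.trans (pow_le_pow_of_le_one hR.le hR1 (by omega))
  have hρκ : ρ * κ ≤ 1 := by
    calc ρ * κ ≤ ρ * R ^ (n + 1) := by gcongr
      _ = R ^ 2 := by rw [hρ, pow_succ]; field_simp
      _ ≤ 1 := pow_le_one₀ hR.le hR1
  set X := 2 * κ * A + κ * E₀ with hX
  have hX0 : 0 ≤ X := by positivity
  have hρX : ρ * X ≤ 2 * A + R ^ 2 * ρ * E₀ := by
    have e1 : ρ * κ * A ≤ 1 * A := by gcongr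
    have e2 : κ * (ρ * E₀) ≤ R ^ 2 * (ρ * E₀) := by gcongr
    rw [hX]; linarith
  have g1 : R ^ 3 * h1b ≤ K * (R ^ 2 * ρ * E₀) := by
    calc R ^ 3 * h1b ≤ R ^ 3 * (K / R ^ n * E₀) := by gcongr
      _ = _ := by rw [hρ]; ring
  have g2 : -(K * (ρ * X)) ≤ R ^ 3 * h2b := by
    calc -(K * (ρ * X)) = R ^ 3 * -(K / R ^ (n + 2) * X) := by
          rw [hρ, pow_add]; field_simp
      _ ≤ _ := by gcongr
  have g3 : 1 / 2 * (1 / R) * S ≤ K * (15 / 4 * (ρ * X) + 64 * (R ^ 2 * ρ * E₀)) := by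
    calc 1 / 2 * (1 / R) * S
        ≤ 1 / 2 * (1 / R) * (K / R ^ n * (15 / 2 * R ^ 2 * X + 128 * R ^ 4 * E₀)) := by gcongr
      _ = _ := by rw [hρ]; field_simp; ring
  -- The slice `t₀-16R⁴` contributes with favourable sign to both terms.
  have g4 : 0 ≤ R ^ 3 * h1a := by positivity
  have g5 : R ^ 3 * h2a ≤ 0 := mul_nonpos_of_nonneg_of_nonpos (by positivity) h2a0
  have g6 : K * (ρ * X) ≤ K * (2 * A + R ^ 2 * ρ * E₀) := by gcongr
  have p1 : 0 ≤ K * A := by positivity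
  have p2 : 0 ≤ K * (R ^ 2 * ρ * E₀) := by positivity
  have p3 : 0 ≤ R ^ 2 * ρ * E₀ := by positivity
  have p4 : 0 ≤ (100 * K + 1) * R ^ 4 * E₀ := by positivity
  rw [ez]
  linarith

end Main

/-! ### The lower bound for the derivative of the weighted energy -/

section Main

variable {n : ℕ}

/-- The energy densities of a smooth map are continuous up to the initial time. -/
theorem continuousOn_densities {k : ℕ} {T : ℝ} {u : E n → ℝ → E k}
    (hU : ContDiffOn ℝ ∞ (fun p : E n × ℝ => u p.1 p.2) (strip n T)) :
    ContinuousOn (fun p : E n × ℝ => ‖lap (fun y => u y p.2) p.1‖ ^ 2) (strip n T) ∧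
    ContinuousOn (fun p : E n × ℝ => gradSq (fun y => u y p.2) p.1) (strip n T) ∧
    ContinuousOn (fun p : E n × ℝ => ‖timeDeriv T (fun q : E n × ℝ => u q.1 q.2) p‖ ^ 2)
      (strip n T) := by
  have hL : ContDiffOn ℝ ∞ (fun p : E n × ℝ => lap (fun y => u y p.2) p.1) (strip n T) :=
    contDiffOn_lap_slice (V := fun p : E n × ℝ => u p.1 p.2) hU
  have hW : ContDiffOn ℝ ∞ (timeDeriv T (fun q : E n × ℝ => u q.1 q.2)) (strip n T) :=
    contDiffOn_stripDeriv (V := fun p : E n × ℝ => u p.1 p.2) hU _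
  exact ⟨hL.continuousOn.norm.pow 2, continuousOn_gradSq_slice (V := fun p : E n × ℝ => u p.1 p.2) hU, hW.continuousOn.norm.pow 2⟩

/-- Lower bound for the derivative of the weighted energy without the terms in `∇Δu`. -/
theorem exists_cutoff_psi_estimate (hn : 1 ≤ n) :
    ∃ C : ℝ, 0 < C ∧ ∀ R₀ : ℝ, 0 < R₀ → ∃ φ₀ : E n → ℝ, IsCutoff φ₀ ∧
      ∀ (k : ℕ) (N : Set (E k)) (T : ℝ) (u : E n → ℝ → E k), IsBiharmonicMapHeatFlow N T u →
        HasLocallyFiniteEnergy T u → ∀ (x₀ : E n) (t₀ : ℝ), t₀ ∈ Ioo 0 T →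
        ∀ φ : E n → ℝ, φ = (fun x => φ₀ (x - x₀)) →
        ∀ R : ℝ, R₀ ≤ R → R ≤ min (t₀ ^ ((1 : ℝ) / 4) / 2) 1 →
          0 ≤ psiFirst x₀ t₀ u R φ ∧ 0 ≤ psiSecond x₀ t₀ u R φ ∧
          ∃ D : ℝ, HasDerivWithinAt (fun r => psi x₀ t₀ u r φ) D
              (Ioc 0 (t₀ ^ ((1 : ℝ) / 4) / 2)) R ∧
            1 / 2 * (1 / R) * solitonIntegral x₀ t₀ u R φ
                - C * supIntegral (t₀ - R₀ ^ 4) φ (fun x t => gradSq (fun y => u y t) x)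
                - C * (R ^ 4 + R ^ (3 - (n : ℤ))) * (∫ x, ‖lap (fun y => u y 0) x‖ ^ 2) ≤ D := by
  obtain ⟨η, K, hη, hη1, hK, hker⟩ := exists_kernel_on_parabolicNhd hn
  -- The estimates cost less than `12K` for the supremum and less than `72K` for the initial energy;
  -- `K` depends only on `n`.
  refine ⟨100 * K + 1, by positivity, fun R₀ hR₀ => ?_⟩
  -- A quarter of `ηR₀` puts the closed support ball inside the parabolic neighbourhood for all `t <
  -- t₀-(R₀/2)⁴`.
  obtain ⟨r, hr⟩ : ∃ r, r = η * R₀ / 4 := ⟨_, rfl⟩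
  have hr0 : 0 < r := by rw [hr]; positivity
  -- The power `n+1` compensates `R^{1-n}` and leaves a factor `R²`; the bound `1` is needed for the
  -- convex combination defining the cut-off.
  obtain ⟨κ, hκdef⟩ : ∃ κ, κ = min 1 (R₀ ^ (n + 1)) := ⟨_, rfl⟩
  have hκ0 : 0 < κ := by rw [hκdef]; positivity
  have hκ1 : κ ≤ 1 := by rw [hκdef]; exact min_le_left _ _
  have hκR : κ ≤ R₀ ^ (n + 1) := by rw [hκdef]; exact min_le_right _ _
  obtain ⟨δ, hδ, hδr, hint⟩ := exists_radius_setIntegral_gradSq_le hn hr0 hκ0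
  obtain ⟨φ₀, hcut, hpos, hsmall⟩ :=
    exists_concentrated_cutoff (n := n) hδ (by linarith : δ ≤ r) hκ0 hκ1
  refine ⟨φ₀, hcut, fun k N T u hu he x₀ t₀ ht₀ φ hφ R hR₀R hRmin => ?_⟩
  have hRt : R ≤ t₀ ^ ((1 : ℝ) / 4) / 2 := hRmin.trans (min_le_left _ _)
  have hR1 : R ≤ 1 := hRmin.trans (min_le_right _ _)
  have hR : 0 < R := hR₀.trans_le hR₀R
  have hR4 : 0 < R ^ 4 := by positivity
  have hR₀4 : 0 < R₀ ^ 4 := by positivity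
  have hR₀R4 : R₀ ^ 4 ≤ R ^ 4 := by gcongr
  have h16 : 16 * R ^ 4 ≤ t₀ := sixteen_mul_pow_le ht₀.1.le hR.le hRt
  have hrR : r ≤ R := by rw [hr]; nlinarith
  -- the cut-off function
  have hφx : ∀ x, φ x = φ₀ (x - x₀) := fun x => by rw [hφ]
  have hφc : Continuous φ := by
    rw [hφ]; exact hcut.smooth.continuous.comp (continuous_id.sub continuous_const)
  have hφ0 : ∀ x, 0 ≤ φ x := fun x => by rw [hφx]; exact hcut.nonneg _
  have hφ1 : ∀ x, φ x ≤ 1 := fun x => by rw [hφx]; exact hcut.le_one _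
  have hsupp : {x | 0 < φ x} = Metric.ball x₀ r := by
    ext x
    have h : x - x₀ ∈ {y | 0 < φ₀ y} ↔ x - x₀ ∈ Metric.ball 0 r := by rw [hpos]
    rw [mem_ball_zero_iff] at h
    rw [mem_ball_iff_norm, ← h, mem_ofPred_eq, mem_ofPred_eq, hφx]
  have hφr : ∀ x ∉ Metric.ball x₀ r, φ x = 0 := fun x hx => by
    rw [← hsupp] at hx
    exact le_antisymm (not_lt.1 hx) (hφ0 x)
  have hφκ : ∀ x ∉ Metric.ball x₀ δ, φ x ≤ κ := fun x hx => by
    rw [hφx]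
    refine hsmall _ fun h => hx ?_
    rwa [mem_ball_zero_iff, ← mem_ball_iff_norm] at h
  obtain ⟨B₀, hB₀⟩ : ∃ B₀, B₀ = Metric.closedBall x₀ r := ⟨_, rfl⟩
  have hB₀c : IsCompact B₀ := by rw [hB₀]; exact isCompact_closedBall x₀ r
  have hball : Metric.ball x₀ r ⊆ B₀ := by rw [hB₀]; exact Metric.ball_subset_closedBall
  have hφB : ∀ x ∉ B₀, φ x = 0 := fun x hx => hφr x fun h => hx (hball h)
  have hBr : ∀ x ∈ B₀, ‖x - x₀‖ ≤ r := fun x hx => by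
    rwa [hB₀, mem_closedBall_iff_norm] at hx
  -- regularity of the flow
  have hUs : ContDiffOn ℝ ∞ (fun p : E n × ℝ => u p.1 p.2) (strip n T) := hu.smooth
  obtain ⟨hLc, hGc, hWc⟩ := continuousOn_densities hUs
  obtain ⟨E₀, hE₀⟩ : ∃ e, e = ∫ x, ‖lap (fun y => u y 0) x‖ ^ 2 := ⟨_, rfl⟩
  have hE0 : 0 ≤ E₀ := by rw [hE₀]; exact integral_nonneg fun x => sq_nonneg _
  obtain ⟨A, hA⟩ : ∃ a, a = supIntegral (t₀ - R₀ ^ 4) φ (fun x t => gradSq (fun y => u y t) x) :=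
    ⟨_, rfl⟩
  have hA0 : 0 ≤ A := by rw [hA]; exact supIntegral_nonneg φ fun x t => gradSq_nonneg _ _
  have hen := fun {t : ℝ} (ht : t ∈ Ico 0 T) => energy_le hu he x₀ r ht
  simp_rw [← hE₀, ← hB₀] at hen
  have hlapE : ∀ t ∈ Ico 0 T, ∫ x in B₀, ‖lap (fun y => u y t) x‖ ^ 2 ≤ E₀ := fun t ht =>
    le_trans (le_add_of_nonneg_right (integral_nonneg fun _ => sq_nonneg _)) (hen ht)
  -- One `κA` comes from outside the small ball, where `φ ≤ κ`, and `κ(A + E₀)` from the interior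
  -- estimate inside it.
  have hgrad : ∀ t ∈ Icc 0 (t₀ - R₀ ^ 4), ∫ x, φ x * gradSq (fun y => u y t) x
      ≤ 2 * κ * A + κ * E₀ := fun t ht => by
    have htT : t ∈ Ico 0 T := ⟨ht.1, by linarith [ht.2, ht₀.2]⟩
    have hv : ContDiff ℝ ∞ fun y => u y t := contDiff_slice hUs htT
    have h1 : ∫ x in Metric.ball x₀ r, gradSq (fun y => u y t) x ≤ A := by
      rw [hA, ← hsupp]
      exact setIntegral_le_supIntegral (h := fun x t => gradSq (fun y => u y t) x) hGc
        (by linarith [ht₀.2]) (fun x t => gradSq_nonneg _ _) hB₀c (hsupp ▸ hball) ht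
    have h2 : ∫ x in Metric.ball x₀ r, ‖lap (fun y => u y t) x‖ ^ 2 ≤ E₀ :=
      le_trans (setIntegral_mono_set (((contDiff_lap hv).continuous.norm.pow 2
        ).continuousOn.integrableOn_compact hB₀c) (Eventually.of_forall fun _ => sq_nonneg _)
        (LE.le.eventuallyLE hball)) (hlapE t htT)
    have h3 := hint k (fun y => u y t) x₀ hv
    refine (integral_cutoff_mul_le hφc hφ1 hφr hφκ hκ0.le (by linarith)
      (continuous_gradSq hv) (gradSq_nonneg _)).trans ?_
    have h4 := mul_le_mul_of_nonneg_left h1 hκ0.le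
    have h5 := mul_le_mul_of_nonneg_left h2 hκ0.le
    linarith
  -- the kernel on the support of the cut-off function
  have hΩ : ∀ p : E n × ℝ, p.2 < t₀ - (R₀ / 2) ^ 4 → p.1 ∈ B₀ → p ∈ parabolicNhd x₀ t₀ η :=
    fun p hp hpB => by
    have h0 : 0 < (R₀ / 2) ^ 4 := by positivity
    refine ⟨by linarith, (hBr _ hpB).trans_lt ?_⟩
    have h1 : R₀ / 2 ≤ (t₀ - p.2) ^ ((1 : ℝ) / 4) := le_quarticRoot (by linarith)
    have h2 : η * (R₀ / 2) ≤ η * (t₀ - p.2) ^ ((1 : ℝ) / 4) := by gcongr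
    have h3 : 0 < η * R₀ := by positivity
    rw [hr]; linarith
  have hhalf : (R₀ / 2) ^ 4 < R ^ 4 := lt_of_lt_of_le (by gcongr; linarith) hR₀R4
  have hB : ∀ p : E n × ℝ, p.2 ≤ t₀ - R ^ 4 →
      0 ≤ backwardKernel x₀ t₀ p.1 p.2 * φ p.1 ∧
      backwardKernel x₀ t₀ p.1 p.2 * φ p.1 ≤ K / R ^ n * φ p.1 ∧
      -(K / R ^ (n + 2) * φ p.1) ≤ lap (fun y => backwardKernel x₀ t₀ y p.2) p.1 * φ p.1 ∧
      lap (fun y => backwardKernel x₀ t₀ y p.2) p.1 * φ p.1 ≤ 0 := fun p hp => by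
    by_cases hpB : p.1 ∈ B₀
    · obtain ⟨b1, b2, b3, b4⟩ := (hker x₀ t₀).2.2 p (hΩ p (by linarith) hpB) R hR hp
      have h0 := hφ0 p.1
      refine ⟨by positivity, by gcongr, ?_, mul_nonpos_of_nonpos_of_nonneg b4 h0⟩
      rw [← neg_mul]; gcongr
    · rw [hφB _ hpB]; simp
  obtain ⟨f₁, hf₁⟩ : ∃ f : E n × ℝ → ℝ, f = fun p => ‖lap (fun y => u y p.2) p.1‖ ^ 2 *
    backwardKernel x₀ t₀ p.1 p.2 * φ p.1 := ⟨_, rfl⟩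
  obtain ⟨f₂, hf₂⟩ : ∃ f : E n × ℝ → ℝ, f = fun p => gradSq (fun y => u y p.2) p.1 *
    lap (fun y => backwardKernel x₀ t₀ y p.2) p.1 * φ p.1 := ⟨_, rfl⟩
  have hf₁0 : ∀ p : E n × ℝ, p.2 ≤ t₀ - R ^ 4 → 0 ≤ f₁ p := fun p hp => by
    simp only [hf₁, mul_assoc]
    exact mul_nonneg (sq_nonneg _) (hB p hp).1
  have hf₂0 : ∀ p : E n × ℝ, p.2 ≤ t₀ - R ^ 4 → f₂ p ≤ 0 := fun p hp => by
    simp only [hf₂, mul_assoc]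
    exact mul_nonpos_of_nonneg_of_nonpos (gradSq_nonneg _ _) (hB p hp).2.2.2
  have hf₁z : ∀ p : E n × ℝ, p.1 ∉ B₀ → f₁ p = 0 := fun p hp => by simp [hf₁, hφB _ hp]
  have hf₂z : ∀ p : E n × ℝ, p.1 ∉ B₀ → f₂ p = 0 := fun p hp => by simp [hf₂, hφB _ hp]
  have hstrip : strip n (t₀ - (R₀ / 2) ^ 4) ⊆ strip n T :=
    prod_mono Subset.rfl fun s hs => ⟨hs.1, by
      have : 0 < (R₀ / 2) ^ 4 := by positivity
      linarith [hs.2, ht₀.2]⟩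
  have hf₁c : ContinuousOn f₁ (strip n (t₀ - (R₀ / 2) ^ 4)) := by
    simp only [hf₁, mul_assoc]
    exact (hLc.mono hstrip).mul (continuousOn_mul_cutoff (isOpen_parabolicNhd x₀ t₀ η)
      (hker x₀ t₀).1 hφc hB₀c.isClosed hφB fun p hp hpB => hΩ p hp.2.2 hpB)
  have hf₂c : ContinuousOn f₂ (strip n (t₀ - (R₀ / 2) ^ 4)) := by
    simp only [hf₂, mul_assoc]
    exact (hGc.mono hstrip).mul (continuousOn_mul_cutoff (isOpen_parabolicNhd x₀ t₀ η)
      (hker x₀ t₀).2.1 hφc hB₀c.isClosed hφB fun p hp hpB => hΩ p hp.2.2 hpB)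
  have hlm : MeasurableSet (layer n t₀ R) := by
    rw [layer_eq_prod]; exact MeasurableSet.univ.prod measurableSet_Ioo
  have hψ₁ : ∀ ρ, psiFirst x₀ t₀ u ρ φ = 1 / 2 * ∫ p in layer n t₀ ρ, f₁ p := fun ρ => by
    rw [hf₁]; rfl
  have hψ₂ : ∀ ρ, psiSecond x₀ t₀ u ρ φ = -(1 / 2 * ∫ p in layer n t₀ ρ, f₂ p) := fun ρ => by
    rw [hf₂]; rfl
  -- Using `R₀/2` leaves room beyond the slice `t₀-R⁴` even for `R = R₀`.
  have hd₁ := hasDerivWithinAt_setIntegral_layer hB₀c hf₁z ht₀.1 (half_pos hR₀) (by linarith) hRt hf₁c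
  have hd₂ := hasDerivWithinAt_setIntegral_layer hB₀c hf₂z ht₀.1 (half_pos hR₀) (by linarith) hRt hf₂c
  refine ⟨?_, ?_, _, ((hd₁.const_mul (1 / 2)).add (hd₂.const_mul (1 / 2)).neg).congr
    (fun ρ _ => ?_) ?_, ?_⟩
  · rw [hψ₁]
    have := setIntegral_nonneg (μ := volume) hlm fun p hp => hf₁0 p hp.2.le
    positivity
  · rw [hψ₂]
    have := setIntegral_nonpos (μ := volume) hlm fun p hp => hf₂0 p hp.2.le
    linarith
  · simp only [psi, hψ₁, hψ₂]; rfl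
  · simp only [psi, hψ₁, hψ₂]; rfl
  rw [← hA, ← hE₀]
  have hbT : t₀ - R ^ 4 ∈ Ico 0 T := ⟨by linarith, by linarith [ht₀.2]⟩
  have hLb : Continuous fun x => ‖lap (fun y => u y (t₀ - R ^ 4)) x‖ ^ 2 :=
    continuousOn_slice hLc hbT
  have hGb : Continuous fun x => gradSq (fun y => u y (t₀ - R ^ 4)) x :=
    continuousOn_slice hGc hbT
  have hbτ : t₀ - R ^ 4 ∈ Ico 0 (t₀ - (R₀ / 2) ^ 4) := ⟨by linarith, by linarith⟩
  refine energy_derivative_arithmetic hn hK hR₀ hR₀R hR1 hκ0 hκR hA0 hE0 ?_ ?_ ?_ ?_ ?_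
  · exact integral_nonneg fun x => hf₁0 _ (by simp only; linarith)
  · exact integral_nonpos fun x => hf₂0 _ (by simp only; linarith)
  · have e : ∫ x, f₁ (x, t₀ - R ^ 4) = ∫ x in B₀, f₁ (x, t₀ - R ^ 4) :=
      (setIntegral_eq_integral_of_forall_compl_eq_zero fun x hx => hf₁z (x, _) hx).symm
    rw [e]
    calc ∫ x in B₀, f₁ (x, t₀ - R ^ 4)
        ≤ ∫ x in B₀, K / R ^ n * ‖lap (fun y => u y (t₀ - R ^ 4)) x‖ ^ 2 := by
          refine setIntegral_mono_on
            ((continuousOn_slice hf₁c hbτ).continuousOn.integrableOn_compact hB₀c)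
            ((continuous_const.mul hLb).continuousOn.integrableOn_compact hB₀c)
            hB₀c.measurableSet fun x _ => ?_
          have h1 := (hB (x, t₀ - R ^ 4) le_rfl).2.1
          have h2 : K / R ^ n * φ x ≤ K / R ^ n :=
            mul_le_of_le_one_right (by positivity) (hφ1 x)
          simp only [hf₁, mul_assoc]
          rw [mul_comm]
          gcongr
          exact h1.trans h2
      _ ≤ K / R ^ n * E₀ := by
          rw [integral_const_mul]
          gcongr
          exact hlapE _ hbT
  · have hi : Integrable fun x => φ x * gradSq (fun y => u y (t₀ - R ^ 4)) x :=
      (hφc.mul hGb).integrable_of_hasCompactSupport (HasCompactSupport.intro hB₀c fun x hx => by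
        simp [hφB x hx])
    have hi₂ : Integrable fun x => f₂ (x, t₀ - R ^ 4) :=
      (continuousOn_slice hf₂c hbτ).integrable_of_hasCompactSupport
        (HasCompactSupport.intro hB₀c fun x hx => hf₂z (x, _) hx)
    calc -(K / R ^ (n + 2) * (2 * κ * A + κ * E₀))
        ≤ -(K / R ^ (n + 2) * ∫ x, φ x * gradSq (fun y => u y (t₀ - R ^ 4)) x) := by
          have := hgrad (t₀ - R ^ 4) ⟨by linarith, by linarith⟩
          gcongr
      _ = ∫ x, -(K / R ^ (n + 2)) * (φ x * gradSq (fun y => u y (t₀ - R ^ 4)) x) := by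
          rw [integral_const_mul]; ring
      _ ≤ ∫ x, f₂ (x, t₀ - R ^ 4) := by
          refine integral_mono (hi.const_mul _) hi₂ fun x => ?_
          have h1 := mul_le_mul_of_nonneg_left (hB (x, t₀ - R ^ 4) le_rfl).2.2.1
            (gradSq_nonneg (fun y => u y (t₀ - R ^ 4)) x)
          simp only [hf₂, mul_assoc]
          refine le_trans (le_of_eq ?_) h1
          ring
  -- the soliton integral
  set I := Ioo (t₀ - 16 * R ^ 4) (t₀ - R ^ 4) with hI
  have hIsub : I ⊆ Icc 0 (t₀ - R ^ 4) := fun s hs => ⟨by linarith [hs.1], hs.2.le⟩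
  have hIT : B₀ ×ˢ I ⊆ B₀ ×ˢ Icc 0 (t₀ - R ^ 4) := prod_mono Subset.rfl hIsub
  have hφcs : ContinuousOn (fun p : E n × ℝ => φ p.1) (strip n T) :=
    (hφc.comp continuous_fst).continuousOn
  have hiG : IntegrableOn (fun p : E n × ℝ => φ p.1 * gradSq (fun y => u y p.2) p.1) (B₀ ×ˢ I) :=
    (integrableOn_strip (hφcs.mul hGc) hB₀c le_rfl hbT.2).mono_set hIT
  have hiW : IntegrableOn (fun p : E n × ℝ => ‖timeDeriv T (fun p => u p.1 p.2) p‖ ^ 2)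
      (B₀ ×ˢ I) := (integrableOn_strip hWc hB₀c le_rfl hbT.2).mono_set hIT
  have hsol : solitonIntegral x₀ t₀ u R φ ≤ ∫ p in B₀ ×ˢ I, K / R ^ n *
      (1 / (2 * R ^ 2) * (φ p.1 * gradSq (fun y => u y p.2) p.1)
        + 128 * R ^ 4 * ‖timeDeriv T (fun p => u p.1 p.2) p‖ ^ 2) := by
    unfold solitonIntegral
    rw [layer_eq_prod, setIntegral_univ_prod_eq (K := B₀) (fun p hp => by simp [hφB _ hp])
      measurableSet_Ioo]
    have hm : MeasurableSet (B₀ ×ˢ I) := hB₀c.measurableSet.prod measurableSet_Ioo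
    refine integral_mono_of_nonneg ?_
      (((hiG.const_mul _).add (hiW.const_mul _)).const_mul _) ?_
    · filter_upwards [ae_restrict_mem hm] with p hp
      have h1 := (hB p hp.2.2.le).1
      simp only [Pi.zero_apply, mul_assoc]
      positivity
    · filter_upwards [ae_restrict_mem hm] with p hp
      obtain ⟨hpB, hpI⟩ := hp
      have h1 := (hB p hpI.2.le).1
      have h2 := (hB p hpI.2.le).2.1
      have h3 := sol_density_le (u := u) hR hpI.1 hpI.2 ((hBr _ hpB).trans hrR)
      have hd : deriv (u p.1) p.2 = timeDeriv T (fun p => u p.1 p.2) p :=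
        (hasDerivAt_timeDeriv hUs p.1 ⟨(hIsub hpI).1.lt_of_ne' (by
          have := hpI.1; intro h; rw [h] at this; linarith), by
          have := hpI.2; linarith [ht₀.2]⟩).deriv
      rw [hd] at h3
      have hg := gradSq_nonneg (fun y => u y p.2) p.1
      have hφp := hφ0 p.1
      -- The cut-off is discarded here, since the energy bounds `|∂_t u|²` without a weight; it is
      -- kept on the gradient, whose smallness depends on it.
      have h4 : φ p.1 * (128 * R ^ 4 * ‖timeDeriv T (fun p => u p.1 p.2) p‖ ^ 2)
          ≤ 128 * R ^ 4 * ‖timeDeriv T (fun p => u p.1 p.2) p‖ ^ 2 :=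
        mul_le_of_le_one_left (by positivity) (hφ1 p.1)
      rw [mul_assoc]
      calc _ ≤ (gradSq (fun y => u y p.2) p.1 / (2 * R ^ 2)
            + 128 * R ^ 4 * ‖timeDeriv T (fun p => u p.1 p.2) p‖ ^ 2) * (K / R ^ n * φ p.1) :=
            mul_le_mul h3 h2 h1 (by positivity)
        _ = K / R ^ n * (1 / (2 * R ^ 2) * (φ p.1 * gradSq (fun y => u y p.2) p.1)
            + φ p.1 * (128 * R ^ 4 * ‖timeDeriv T (fun p => u p.1 p.2) p‖ ^ 2)) := by ring
        _ ≤ _ := by gcongr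
  refine hsol.trans ?_
  have hiG' : IntegrableOn (fun p : E n × ℝ => 1 / (2 * R ^ 2) *
      (φ p.1 * gradSq (fun y => u y p.2) p.1)) (B₀ ×ˢ I) := hiG.const_mul _
  have hiW' : IntegrableOn (fun p : E n × ℝ => 128 * R ^ 4 *
      ‖timeDeriv T (fun p => u p.1 p.2) p‖ ^ 2) (B₀ ×ˢ I) := hiW.const_mul _
  rw [integral_const_mul, integral_add hiG' hiW', integral_const_mul, integral_const_mul]
  have hW : ∫ p in B₀ ×ˢ I, ‖timeDeriv T (fun p => u p.1 p.2) p‖ ^ 2 ≤ E₀ := by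
    have h1 := hen hbT
    have h2 : 0 ≤ ∫ x in B₀, ‖lap (fun y => u y (t₀ - R ^ 4)) x‖ ^ 2 :=
      integral_nonneg fun _ => sq_nonneg _
    refine le_trans (setIntegral_mono_set ?_ (Eventually.of_forall fun _ => sq_nonneg _)
      (LE.le.eventuallyLE (prod_mono Subset.rfl ?_))) (le_of_add_le_of_nonneg_right h1 h2)
    · exact (integrableOn_strip hWc hB₀c le_rfl hbT.2).mono_set
        (prod_mono Subset.rfl Ioc_subset_Icc_self)
    · exact fun s hs => ⟨by linarith [hs.1], hs.2.le⟩
  have hG : ∫ p in B₀ ×ˢ I, φ p.1 * gradSq (fun y => u y p.2) p.1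
      ≤ 15 * R ^ 4 * (2 * κ * A + κ * E₀) := by
    have hp := hiG
    rw [IntegrableOn, Measure.volume_eq_prod, ← Measure.prod_restrict] at hp
    rw [Measure.volume_eq_prod, ← Measure.prod_restrict, integral_prod_symm _ hp]
    calc _ ≤ ∫ _ in I, (2 * κ * A + κ * E₀) := by
          refine setIntegral_mono_on hp.integral_prod_right (integrableOn_const
            (by rw [hI]; exact measure_Ioo_lt_top.ne)) measurableSet_Ioo fun t ht => ?_
          have e : ∫ x in B₀, φ x * gradSq (fun y => u y t) x
              = ∫ x, φ x * gradSq (fun y => u y t) x :=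
            setIntegral_eq_integral_of_forall_compl_eq_zero fun x hx => by simp [hφB x hx]
          simp only
          rw [e]
          exact hgrad t ⟨(hIsub ht).1, by linarith [ht.2]⟩
      _ = _ := by
          simp only [integral_const, hI, smul_eq_mul, measureReal_restrict_apply_univ,
            Real.volume_real_Ioo]
          rw [max_eq_left (by linarith)]; ring
  have hRn : 0 ≤ K / R ^ n := by positivity
  refine mul_le_mul_of_nonneg_left (add_le_add ?_ (by gcongr)) hRn
  calc 1 / (2 * R ^ 2) * ∫ p in B₀ ×ˢ I, φ p.1 * gradSq (fun y => u y p.2) p.1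
      ≤ 1 / (2 * R ^ 2) * (15 * R ^ 4 * (2 * κ * A + κ * E₀)) := by gcongr
    _ = _ := by field_simp

end Main

end BiharmonicFlow

end

/-- Both inequalities weaken the same bound: the `∇Δu` terms are subtracted with non-negative
coefficients and are themselves non-negative. -/
theorem mainTheorem1 (n : ℕ) (hn : 1 ≤ n) :
    ∃ C : ℝ, 0 < C ∧ ∀ R₀ : ℝ, 0 < R₀ →
      ∃ φ₀ : BiharmonicFlow.E n → ℝ, BiharmonicFlow.IsCutoff φ₀ ∧
        ∀ (k : ℕ) (N : Set (BiharmonicFlow.E k)),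
          BiharmonicFlow.IsEmbeddedSubmanifold N → (IsCompact N ∨ N = univ) →
        ∀ (T : ℝ) (u : BiharmonicFlow.E n → ℝ → BiharmonicFlow.E k),
          BiharmonicFlow.IsBiharmonicMapHeatFlow N T u →
          BiharmonicFlow.HasLocallyFiniteEnergy T u →
        ∀ (x₀ : BiharmonicFlow.E n) (t₀ : ℝ), t₀ ∈ Ioo 0 T →
        ∀ φ : BiharmonicFlow.E n → ℝ, φ = (fun x => φ₀ (x - x₀)) →
        ∀ R : ℝ, R₀ ≤ R → R ≤ min (t₀ ^ ((1 : ℝ) / 4) / 2) 1 →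
          0 ≤ BiharmonicFlow.psiFirst x₀ t₀ u R φ ∧
          0 ≤ BiharmonicFlow.psiSecond x₀ t₀ u R φ ∧
          ∃ D : ℝ,
            HasDerivWithinAt (fun r => BiharmonicFlow.psi x₀ t₀ u r φ) D
              (Ioc 0 (t₀ ^ ((1 : ℝ) / 4) / 2)) R ∧
            (1 / 2 * (1 / R) * BiharmonicFlow.solitonIntegral x₀ t₀ u R φ
                - C * (1 + R ^ (1 - (n : ℤ))) *
                    (∫ p in BiharmonicFlow.layer n t₀ R,
                      BiharmonicFlow.gradSq (BiharmonicFlow.lap fun y => u y p.2) p.1)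
                - C * BiharmonicFlow.supIntegral (t₀ - R₀ ^ 4) φ
                    (fun x t => BiharmonicFlow.gradSq (fun y => u y t) x)
                - C * (R ^ 4 + R ^ (3 - (n : ℤ))) *
                    (∫ x, ‖BiharmonicFlow.lap (fun y => u y 0) x‖ ^ 2)) ≤ D ∧
            (1 / 2 * (1 / R) * BiharmonicFlow.solitonIntegral x₀ t₀ u R φ
                - C * (R ^ 4 + R ^ (5 - (n : ℤ))) *
                    BiharmonicFlow.supIntegral (t₀ - R₀ ^ 4) φ
                      (fun x t => BiharmonicFlow.gradSq
                        (BiharmonicFlow.lap fun y => u y t) x)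
                - C * BiharmonicFlow.supIntegral (t₀ - R₀ ^ 4) φ
                    (fun x t => BiharmonicFlow.gradSq (fun y => u y t) x)
                - C * (R ^ 4 + R ^ (3 - (n : ℤ))) *
                    (∫ x, ‖BiharmonicFlow.lap (fun y => u y 0) x‖ ^ 2)) ≤ D := by
  obtain ⟨C, hC, h⟩ := BiharmonicFlow.exists_cutoff_psi_estimate hn
  refine ⟨C, hC, fun R₀ hR₀ => ?_⟩
  obtain ⟨φ₀, hφ₀, h'⟩ := h R₀ hR₀
  refine ⟨φ₀, hφ₀, fun k N _ _ T u hu he x₀ t₀ ht₀ φ hφ R hR₀R hR => ?_⟩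
  obtain ⟨h1, h2, D, hD, hb⟩ := h' k N T u hu he x₀ t₀ ht₀ φ hφ R hR₀R hR
  have hRp : 0 < R := hR₀.trans_le hR₀R
  refine ⟨h1, h2, D, hD, le_trans ?_ hb, le_trans ?_ hb⟩
  · have h3 : 0 ≤ ∫ p in BiharmonicFlow.layer n t₀ R,
        BiharmonicFlow.gradSq (BiharmonicFlow.lap fun y => u y p.2) p.1 :=
      integral_nonneg fun p => BiharmonicFlow.gradSq_nonneg _ _
    have h4 := mul_nonneg (by positivity : 0 ≤ C * (1 + R ^ (1 - (n : ℤ)))) h3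
    linarith
  · have h3 := BiharmonicFlow.supIntegral_nonneg (S := t₀ - R₀ ^ 4) φ
      (h := fun x t => BiharmonicFlow.gradSq (BiharmonicFlow.lap fun y => u y t) x)
      fun x t => BiharmonicFlow.gradSq_nonneg _ _
    have h4 := mul_nonneg (by positivity : 0 ≤ C * (R ^ 4 + R ^ (5 - (n : ℤ)))) h3
    linarith
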